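/- Let $(X_n)_{n\ge1}$ be real random variables on a probability space and $S_N=X_1+\dots+X_N$. Suppose there are a complex Banach space $\mathcal B$, bounded operators $\mathcal L_t:\mathcal B\to\mathcal B$ ($t\in\mathbb R$), $v\in\mathcal B$ and $\ell\in\mathcal B'$ such that $\mathbb E(e^{itS_N})=\ell(\mathcal L_t^Nv)$ for all $t\in\mathbb R$ and $N\ge1$. Let $r\ge0$ be an integer, let $r_1>0$ and $\alpha>\frac{r+1}{2r_1}$ be real, and assume: * (A1) $t\mapsto\mathcal L_t$ is continuous in operator norm and, for some $\delta>0$, is $r+2$ times continuously differentiable on $|t|\le\delta$. * (A2) $1$ is an isolated point of the spectrum of $\mathcal L_0$ and a simple eigenvalue of $\mathcal L_0$ (algebraic multiplicity one), all other eigenvalues of $\mathcal L_0$ have absolute value less than $1$, and the essential spectrum of $\mathcal L_0$ (the set of $z$ for which $z-\mathcal L_0$ is not Fredholm) is contained in a disk $\{|z|\le\rho\}$ with $\rho<1$. * (A3) For all $t\ne0$, the spectrum of $\mathcal L_t$ is contained in $\{|z|<1\}$. * (A4) There are $K,r_2,N_0>0$ such that $\|\mathcal L_t^N\|\le N^{-r_2}$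 whenever $N>N_0$ and $K\le|t|\le N^{r_1}$. * (A5) There are $C>0$ and $N_1$ such that $\|\mathcal L_t^N\|\le C|t|^{-\alpha}$ whenever $N>N_1$ and $|t|>N^{r_1}$. For $m,k\ge0$ let $F_k^m$ be the space of $m$ times continuously differentiable $f:\mathbb R\to\mathbb C$ with $$C_k^m(f)=\max_{0\le j\le m}\|f^{(j)}\|_{L^1}+\max_{0\le j\le k}\|x^jf\|_{L^1}<\infty .$$ Then there are $A\in\mathbb R$ and $\sigma^2\ge0$ such that $\frac{S_N-NA}{\sqrt N}$ converges in distribution to $\mathcal N(0,\sigma^2)$. If $\sigma^2>0$, then, with $\mathfrak n$ the density of $\mathcal N(0,\sigma^2)$, both of the following hold. 1. (Weak local Edgeworth expansion of order $r$ for $f\in F^1_{r+1}$.) There are real polynomials $P_{p,l}$, $0\le p\le\lfloor r/2\rfloor$, such that, as $N\to\infty$, $$\sqrt N\,\mathbb E\big(f(S_N-NA)\big)=\frac1{2\pi}\sum_{p=0}^{\lfloor r/2\rfloor}\frac1{N^p}\int_{\mathbb R}P_{p,l}(z)f(z)\,dz+C^1_{r+1}(f)\,o\big(N^{-r/2}\big)\qquad\text{for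 all } f\in F^1_{r+1}.$$ 2. (Weak global Edgeworth expansion of order $r$ for $f\in F^1_0$.) There are real polynomials $P_{p,g}$, $0\le p\le r$, such that, as $N\to\infty$, $$\mathbb E\big(f(S_N-NA)\big)=\sum_{p=0}^{r}\frac1{N^{p/2}}\int_{\mathbb R}P_{p,g}(z)\,\mathfrak n(z)\,f(z\sqrt N)\,dz+C^1_0(f)\,o\big(N^{-(r+1)/2}\big)\qquad\text{for all } f\in F^1_0.$$ In each part the polynomials and the $o(\cdot)$ term do not depend on $f$, and all expectations and integrals converge absolutely. -/

import Mathlib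

open MeasureTheory ProbabilityTheory Filter Topology
open scoped NNReal ENNReal

namespace WeakEdgeworth

noncomputable section

/-- The partial sums `S_N = X_1 + ... + X_N`. -/
def partialSum {Ω : Type*} (X : ℕ → Ω → ℝ) (N : ℕ) (ω : Ω) : ℝ :=
  ∑ n ∈ Finset.Icc 1 N, X n ω

/-! ### Spectral notions -/

section Spectral

variable {B : Type*} [NormedAddCommGroup B] [NormedSpace ℂ B]

/-- The essential spectrum of a bounded operator: the set of all `z` such that `z - T` is not a
Fredholm operator. -/
def essentialSpectrum (T : B →L[ℂ] B) : Set ℂ :=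
  {z | ¬ (z • ContinuousLinearMap.id ℂ B - T).IsFredholm}

/-- `z` is an isolated point of the spectrum of `T`. -/
def IsIsolatedInSpectrum (T : B →L[ℂ] B) (z : ℂ) : Prop :=
  z ∈ spectrum ℂ T ∧ ∃ ε : ℝ, 0 < ε ∧ ∀ w ∈ spectrum ℂ T, ‖w - z‖ < ε → w = z

/-- `z` is a simple eigenvalue of `T`: its algebraic multiplicity, the dimension of the union of
the kernels of the powers of `T - z`, is one. -/
def IsSimpleEigenvalue (T : B →L[ℂ] B) (z : ℂ) : Prop :=
  Module.finrank ℂ (Module.End.maxGenEigenspace (T : B →ₗ[ℂ] B) z) = 1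

/-- (A1): `t ↦ L_t` is continuous in operator norm, and `s` times continuously differentiable on
some interval `[-δ, δ]`. -/
def AssumptionA1 (L : ℝ → B →L[ℂ] B) (s : ℕ) : Prop :=
  Continuous L ∧ ∃ δ : ℝ, 0 < δ ∧ ContDiffOn ℝ s L (Set.Icc (-δ) δ)

/-- (A2): spectral gap for `L_0`. -/
def AssumptionA2 (L : ℝ → B →L[ℂ] B) : Prop :=
  IsIsolatedInSpectrum (L 0) 1 ∧
  IsSimpleEigenvalue (L 0) 1 ∧
  (∀ z : ℂ, Module.End.HasEigenvalue (L 0 : B →ₗ[ℂ] B) z → z ≠ 1 → ‖z‖ < 1) ∧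
  ∃ ρ : ℝ, ρ < 1 ∧ essentialSpectrum (L 0) ⊆ Metric.closedBall 0 ρ

/-- (A3): for `t ≠ 0` the spectrum of `L_t` lies in the open unit disk. -/
def AssumptionA3 (L : ℝ → B →L[ℂ] B) : Prop :=
  ∀ t : ℝ, t ≠ 0 → spectrum ℂ (L t) ⊆ Metric.ball 0 1

/-- (A4) with the exponent `r₁`. -/
def AssumptionA4 (L : ℝ → B →L[ℂ] B) (r₁ : ℝ) : Prop :=
  ∃ K r₂ N₀ : ℝ, 0 < K ∧ 0 < r₂ ∧ 0 < N₀ ∧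
    ∀ N : ℕ, N₀ < N → ∀ t : ℝ, K ≤ |t| → |t| ≤ (N : ℝ) ^ r₁ →
      ‖L t ^ N‖ ≤ 1 / (N : ℝ) ^ r₂

/-- (A5) with the exponents `r₁` and `α`. -/
def AssumptionA5 (L : ℝ → B →L[ℂ] B) (r₁ α : ℝ) : Prop :=
  ∃ C N₁ : ℝ, 0 < C ∧
    ∀ N : ℕ, N₁ < N → ∀ t : ℝ, (N : ℝ) ^ r₁ < |t| → ‖L t ^ N‖ ≤ C / |t| ^ α

end Spectral

/-! ### The function spaces `F_k^m` -/

/-- `C^m(f) + C_k(f)`, where `C^m(f)` is the maximum of the `L¹` norms of `f, f', ..., f^(m)` and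
`C_k(f)` is the maximum of the `L¹` norms of `f, x f, ..., x^k f`; possibly infinite. -/
def eCNorm (m k : ℕ) (f : ℝ → ℂ) : ℝ≥0∞ :=
  (Finset.range (m + 1)).sup (fun j => eLpNorm (iteratedDeriv j f) 1 volume) +
    (Finset.range (k + 1)).sup (fun j => eLpNorm (fun x : ℝ => (x : ℂ) ^ j * f x) 1 volume)

/-- The norm `C_k^m(f)` as a real number. -/
def CNorm (m k : ℕ) (f : ℝ → ℂ) : ℝ := (eCNorm m k f).toReal

/-- The space `F_k^m` of `m` times continuously differentiable `f` with `C_k^m(f) < ∞`. -/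
def FSpace (m k : ℕ) : Set (ℝ → ℂ) := {f | ContDiff ℝ m f ∧ eCNorm m k f < ∞}

/-! ### Weak Edgeworth expansions -/

section Expansions

variable {Ω : Type*} [MeasurableSpace Ω]

/-- Weak global Edgeworth expansion of order `r` on the function space `F` with norm `nrm`, with
centering `A` and variance `v`; `gaussianPDFReal 0 v` is the density of the normal law with mean
`0` and variance `v`. The polynomials do not depend on `f`, and the error is `‖f‖` times a
quantity `o(N^{-(r+1)/2})` that does not depend on `f`. -/
def AdmitsWeakGlobalExpansion (P : Measure Ω) (S : ℕ → Ω → ℝ) (A : ℝ) (v : ℝ≥0) (r : ℕ)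
    (F : Set (ℝ → ℂ)) (nrm : (ℝ → ℂ) → ℝ) : Prop :=
  ∃ Q : ℕ → Polynomial ℝ,
    (∀ f ∈ F, ∀ N : ℕ, 1 ≤ N →
      Integrable (fun ω => f (S N ω - N * A)) P ∧
      ∀ p ≤ r, Integrable
        (fun z : ℝ => (((Q p).eval z * gaussianPDFReal 0 v z : ℝ) : ℂ) * f (z * √(N : ℝ)))) ∧
    ∀ ε : ℝ, 0 < ε → ∀ᶠ N : ℕ in atTop, ∀ f ∈ F,
      ‖(∫ ω, f (S N ω - N * A) ∂P) -
        ∑ p ∈ Finset.range (r + 1), ((1 / (N : ℝ) ^ ((p : ℝ) / 2) : ℝ) : ℂ) *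
          ∫ z : ℝ, (((Q p).eval z * gaussianPDFReal 0 v z : ℝ) : ℂ) * f (z * √(N : ℝ))‖
      ≤ nrm f * (ε * (N : ℝ) ^ (-((r : ℝ) + 1) / 2))

/-- Weak local Edgeworth expansion of order `r` on the function space `F` with norm `nrm`, with
centering `A`. The polynomials do not depend on `f`, and the error is `‖f‖` times a quantity
`o(N^{-r/2})` that does not depend on `f`. -/
def AdmitsWeakLocalExpansion (P : Measure Ω) (S : ℕ → Ω → ℝ) (A : ℝ) (r : ℕ)
    (F : Set (ℝ → ℂ)) (nrm : (ℝ → ℂ) → ℝ) : Prop :=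
  ∃ Q : ℕ → Polynomial ℝ,
    (∀ f ∈ F,
      (∀ N : ℕ, 1 ≤ N → Integrable (fun ω => f (S N ω - N * A)) P) ∧
      ∀ p ≤ r / 2, Integrable (fun z : ℝ => (((Q p).eval z : ℝ) : ℂ) * f z)) ∧
    ∀ ε : ℝ, 0 < ε → ∀ᶠ N : ℕ in atTop, ∀ f ∈ F,
      ‖((√(N : ℝ) : ℝ) : ℂ) * (∫ ω, f (S N ω - N * A) ∂P) -
        ((1 / (2 * Real.pi) : ℝ) : ℂ) *
          ∑ p ∈ Finset.range (r / 2 + 1), ((1 / (N : ℝ) ^ p : ℝ) : ℂ) *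
            ∫ z : ℝ, (((Q p).eval z : ℝ) : ℂ) * f z‖
      ≤ nrm f * (ε * (N : ℝ) ^ (-(r : ℝ) / 2))

end Expansions

end

end WeakEdgeworth

/-! Everything is read off from the characteristic functions Φ_N(t) = l(L_t^N v), at the scale t =
s/√N. When V > 0, it suffices that N^{r/2} times the L¹ distance in s between the centred, rescaled
Φ_N and an explicit Gaussian-times-polynomial tends to 0 (`tendsto_integral_rescale_sub`). Fourier
inversion turns this into a uniform bound between densities, so the error for a test function f is
at most ‖f‖₁ times a quantity free of f, and rescaling f gains a further N^{-1/2}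
(`norm_integral_sub_edgeworth_le`).

Near t = 0, (A2) leaves 1 as the only spectral point of L_0 of modulus at least 1. Bordering L_0 - 1
by its eigenvector and a normalizing functional makes it invertible (`isUnit_bordered_of_simple`).
The implicit function theorem then continues the eigenvalue to a function μ(t) that is C^{r+2} at 0,
and the inverse of the bordered operator supplies the spectral projection. Hence Φ_N = μ^N Z +
O(θ^N) (`exists_leading_eigenvalue`). Because the Φ_N are characteristic functions, μ and Z inherit
conjugate symmetry, and |μ| ≤ 1. So log μ(t) = iAt - Vt²/2 + t²χ(t), with an expansion whose
coefficients are real in the variable it (`exists_exponent`). Expanding exp(s²χ(s/√N)) Z(s/√N) in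
powers of N^{-1/2}, with errors absorbed by part of the Gaussian, produces the approximation; its
leading term alone gives the central limit theorem.

Away from 0, (A3) and compactness give exponential decay for bounded t. For large |t|, (A4) and (A5)
give only a fixed rate, but splitting L_t^N into many blocks multiplies the exponents, which beats
every power of N and leaves an integrable weight in t (`exists_pow_norm_le_inv`).

The inverse transform of the approximation is a combination of Hermite polynomials times the
Gaussian density; these are the global polynomials. Substituting z = x/√N and Taylor expanding at 0
gives the local ones, where parity removes the odd powers of N^{-1/2}
(`exists_norm_edgeworth_sub_local_le`). -/

namespace WeakEdgeworth

/-! ### Consequences of the spectral gap for `L 0`. -/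

section Spectral

variable {B : Type*} [NormedAddCommGroup B] [NormedSpace ℂ B]

/-- An operator that is bounded below and is a limit of invertible operators is invertible. -/
theorem isUnit_of_bounded_below_of_approx [CompleteSpace B] (T : B →L[ℂ] B) {κ : ℝ} (hκ : 0 < κ)
    (hT : ∀ x, κ * ‖x‖ ≤ ‖T x‖)
    (happ : ∀ ε : ℝ, 0 < ε → ∃ U : B →L[ℂ] B, IsUnit U ∧ ‖T - U‖ < ε) : IsUnit T := by
  -- Within κ/2 of `T` the lower bound survives as κ/2, so the inverse of `U` has norm at most 2/κ;
  -- `T` is then inside the Neumann-series radius around `U`.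
  obtain ⟨_, ⟨U, rfl⟩, hU⟩ := happ (κ / 2) (by positivity)
  have hlow : ∀ x, κ / 2 * ‖x‖ ≤ ‖(U : B →L[ℂ] B) x‖ := by
    intro x
    have h1 : ‖T x‖ ≤ ‖(U : B →L[ℂ] B) x‖ + ‖(T - (U : B →L[ℂ] B)) x‖ := by
      have : T x = (U : B →L[ℂ] B) x + (T - (U : B →L[ℂ] B)) x := by simp
      rw [this]; exact norm_add_le _ _
    have h2 := (T - (U : B →L[ℂ] B)).le_of_opNorm_le hU.le x
    nlinarith [hT x, h1, h2]
  have hinv : ‖((U⁻¹ : (B →L[ℂ] B)ˣ) : B →L[ℂ] B)‖ ≤ 2 / κ := by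
    refine ContinuousLinearMap.opNorm_le_bound _ (by positivity) fun y => ?_
    have h := hlow (((U⁻¹ : (B →L[ℂ] B)ˣ) : B →L[ℂ] B) y)
    rw [← mul_apply_eq_comp, Units.mul_inv, one_apply_eq_self] at h
    rw [div_mul_eq_mul_div, le_div_iff₀ hκ]
    linarith
  rcases subsingleton_or_nontrivial B with hB | hB
  · exact isUnit_of_subsingleton T
  have hpos : 0 < ‖((U⁻¹ : (B →L[ℂ] B)ˣ) : B →L[ℂ] B)‖ := Units.norm_pos _
  refine (U.ofNearby T ?_).isUnit
  refine hU.trans_le ?_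
  rw [le_inv_comm₀ (by positivity) hpos]
  simpa using hinv

theorem exists_bounded_below {F : Type*} [NormedAddCommGroup F] [NormedSpace ℂ F]
    [CompleteSpace F] [CompleteSpace B] (T : B →L[ℂ] F) (hinj : Function.Injective T)
    (hcl : IsClosed (Set.range T)) : ∃ κ : ℝ, 0 < κ ∧ ∀ x, κ * ‖x‖ ≤ ‖T x‖ := by
  obtain ⟨K, hK⟩ := T.antilipschitz_of_injective_of_isClosed_range hinj hcl
  have hb := hK.le_mul_norm (f := T) (map_zero _)
  refine ⟨((K : ℝ) + 1)⁻¹, by positivity, fun x => ?_⟩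
  rw [inv_mul_le_iff₀ (by positivity)]
  nlinarith [hb x, norm_nonneg (T x)]

theorem isUnit_smul_one_sub_of_notMem {T : B →L[ℂ] B} {z : ℂ} (hz : z ∉ spectrum ℂ T) :
    IsUnit (z • (1 : B →L[ℂ] B) - T) := by
  rw [spectrum.notMem_iff, Algebra.algebraMap_eq_smul_one] at hz
  exact hz

/-- A point of maximal modulus in the spectrum that lies outside the essential spectrum is an
eigenvalue. -/
theorem hasEigenvalue_of_forall_norm_le [CompleteSpace B] {T : B →L[ℂ] B} {z : ℂ} (hz0 : z ≠ 0)
    (hz : z ∈ spectrum ℂ T) (hmax : ∀ w ∈ spectrum ℂ T, ‖w‖ ≤ ‖z‖)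
    (hess : z ∉ essentialSpectrum T) :
    Module.End.HasEigenvalue (T : B →ₗ[ℂ] B) z := by
  by_contra hne
  have hfr : (z • (1 : B →L[ℂ] B) - T).IsFredholm := by
    exact not_not.mp hess
  have hinj : Function.Injective (z • (1 : B →L[ℂ] B) - T) := by
    rw [injective_iff_map_eq_zero]
    intro x hx
    by_contra hx0
    apply hne
    refine Module.End.hasEigenvalue_of_hasEigenvector (x := x) ⟨?_, hx0⟩
    rw [Module.End.mem_eigenspace_iff]
    have : z • x - T x = 0 := by simpa using hx
    exact (sub_eq_zero.mp this).symm
  obtain ⟨κ, hκ, hlow⟩ := exists_bounded_below _ hinj (by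
    have := hfr.isClosed_range
    rwa [LinearMap.coe_range] at this)
  have hu : IsUnit (z • (1 : B →L[ℂ] B) - T) := by
    refine isUnit_of_bounded_below_of_approx _ hκ hlow fun ε hε => ?_
    have hzp : 0 < ‖z‖ := norm_pos_iff.mpr hz0
    set s : ℝ := ε / (2 * ‖z‖ * (‖(1 : B →L[ℂ] B)‖ + 1)) with hs
    have hsp : 0 < s := by positivity
    -- Pushing z radially outward leaves the disk that contains the spectrum, so the approximants
    -- are invertible; s is small enough for the shift s z to have norm below ε.
    refine ⟨((1 + s : ℝ) * z) • (1 : B →L[ℂ] B) - T, ?_, ?_⟩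
    · refine isUnit_smul_one_sub_of_notMem fun hmem => ?_
      have := hmax _ hmem
      rw [norm_mul, Complex.norm_real, Real.norm_of_nonneg (by positivity)] at this
      nlinarith
    · have h1 : z • (1 : B →L[ℂ] B) - T - (((1 + s : ℝ) * z) • (1 : B →L[ℂ] B) - T)
          = (-(s * z) : ℂ) • (1 : B →L[ℂ] B) := by
        push_cast; module
      rw [h1, norm_smul, norm_neg, norm_mul, Complex.norm_real, Real.norm_of_nonneg hsp.le, hs]
      have : ε / (2 * ‖z‖ * (‖(1 : B →L[ℂ] B)‖ + 1)) * ‖z‖ * ‖(1 : B →L[ℂ] B)‖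
          = ε * (‖(1 : B →L[ℂ] B)‖ / (2 * (‖(1 : B →L[ℂ] B)‖ + 1))) := by
        field_simp
      rw [this]
      have h2 : ‖(1 : B →L[ℂ] B)‖ / (2 * (‖(1 : B →L[ℂ] B)‖ + 1)) < 1 := by
        rw [div_lt_one (by positivity)]; nlinarith [norm_nonneg (1 : B →L[ℂ] B)]
      nlinarith
  rw [spectrum.mem_iff, Algebra.algebraMap_eq_smul_one] at hz
  exact hz hu

/-- Under (A2), the spectrum of `L 0` meets the complement of the open unit disk only in `1`. -/
theorem AssumptionA2.eq_one_of_one_le_norm [CompleteSpace B] {L : ℝ → B →L[ℂ] B}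
    (h : AssumptionA2 L) {z : ℂ} (hz : z ∈ spectrum ℂ (L 0)) (h1 : 1 ≤ ‖z‖) : z = 1 := by
  obtain ⟨-, -, heig, ρ, hρ, hess⟩ := h
  have key : ∀ w ∈ spectrum ℂ (L 0), 1 ≤ ‖w‖ → (∀ u ∈ spectrum ℂ (L 0), ‖u‖ ≤ ‖w‖) → w = 1 := by
    intro w hw hw1 hmax
    have hw0 : w ≠ 0 := by rintro rfl; norm_num at hw1
    have hev := hasEigenvalue_of_forall_norm_le hw0 hw hmax fun hmem => by
      have := hess hmem
      rw [mem_closedBall_zero_iff] at this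
      linarith
    by_contra hne
    exact absurd (heig w hev hne) (not_lt.mpr hw1)
  -- A spectral point of maximal modulus must be 1 by `key`. The spectral radius is therefore 1, so
  -- z itself has maximal modulus and `key` applies to it.
  obtain ⟨w, hw, hmax⟩ := (spectrum.isCompact (𝕜 := ℂ) (L 0)).exists_isMaxOn ⟨z, hz⟩
    continuous_norm.continuousOn
  have hmax' : ∀ u ∈ spectrum ℂ (L 0), ‖u‖ ≤ ‖w‖ := fun u hu => hmax hu
  have hw1 := key w hw (h1.trans (hmax' z hz)) hmax'
  refine key z hz h1 fun u hu => (hmax' u hu).trans ?_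
  rw [hw1]; simpa using h1

/-- A simple eigenvalue has a one-dimensional kernel that meets the range trivially. -/
theorem IsSimpleEigenvalue.exists_eigenvector {T : B →L[ℂ] B} {z : ℂ}
    (h : IsSimpleEigenvalue T z) :
    ∃ e : B, e ≠ 0 ∧ T e = z • e ∧ (∀ x, T x = z • x → ∃ c : ℂ, x = c • e) ∧
      ∀ x (c : ℂ), T x - z • x = c • e → c = 0 := by
  obtain ⟨⟨e, he⟩, he0, hspan⟩ := finrank_eq_one_iff'.mp h
  have hspan' : ∀ x ∈ Module.End.maxGenEigenspace (T : B →ₗ[ℂ] B) z, ∃ c : ℂ, c • e = x := by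
    intro x hx
    obtain ⟨c, hc⟩ := hspan ⟨x, hx⟩
    exact ⟨c, congrArg Subtype.val hc⟩
  have he0' : e ≠ 0 := fun h0 => he0 (Subtype.ext h0)
  have hTe : ∃ c : ℂ, T e - z • e = c • e := by
    have hmem : (T : B →ₗ[ℂ] B) e ∈ Module.End.maxGenEigenspace (T : B →ₗ[ℂ] B) z :=
      Module.End.mapsTo_maxGenEigenspace_of_comm (Commute.refl _) z he
    obtain ⟨c, hc⟩ := hspan' _ hmem
    refine ⟨c - z, ?_⟩
    rw [sub_smul, hc]; rfl
  obtain ⟨c, hc⟩ := hTe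
  have hpow : ∀ k : ℕ, ((((T : B →ₗ[ℂ] B) - z • (1 : Module.End ℂ B)) ^ k)) e = c ^ k • e := by
    intro k
    induction k with
    | zero => simp
    | succ k ih =>
      rw [pow_succ', Module.End.mul_apply, ih, map_smul, pow_succ, mul_smul]
      congr 1
  -- On the one-dimensional generalized eigenspace `T - z` is a scalar, and a nilpotent scalar
  -- vanishes.
  have hc0 : c = 0 := by
    obtain ⟨k, hk⟩ := (Module.End.mem_maxGenEigenspace _ _ _).mp he
    rw [hpow] at hk
    exact eq_zero_of_pow_eq_zero ((smul_eq_zero.mp hk).resolve_right he0')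
  have hTe : T e = z • e := by rw [hc0, zero_smul] at hc; exact sub_eq_zero.mp hc
  have hker : ∀ x, T x = z • x → ∃ c : ℂ, x = c • e := by
    intro x hx
    obtain ⟨a, ha⟩ := hspan' x ((Module.End.mem_maxGenEigenspace _ _ _).mpr ⟨1, by
      simp [hx]⟩)
    exact ⟨a, ha.symm⟩
  refine ⟨e, he0', hTe, hker, fun x a hx => ?_⟩
  -- A preimage of a multiple of e is killed by (T - z)², so it lies in the generalized eigenspace,
  -- already known to be the line through e.
  obtain ⟨b, hb⟩ := hspan' x ((Module.End.mem_maxGenEigenspace _ _ _).mpr ⟨2, by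
      rw [pow_two, Module.End.mul_apply]
      have : ((T : B →ₗ[ℂ] B) - z • (1 : Module.End ℂ B)) x = a • e := hx
      rw [this, map_smul]
      simp [hTe]⟩)
  rw [← hb, map_smul, hTe, smul_comm b z e, sub_self] at hx
  exact (smul_eq_zero.mp hx.symm).resolve_right he0'

end Spectral

/-! ### Bordered operators. -/

section Bordered

variable {B : Type*} [NormedAddCommGroup B] [NormedSpace ℂ B]

/-- The bordered operator `(x, c) ↦ (S x - c e, ξ x)` on `B × ℂ`. -/
noncomputable def bordered (ξ : B →L[ℂ] ℂ) (S : B →L[ℂ] B) (e : B) : B × ℂ →L[ℂ] B × ℂ :=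
  (S.comp (ContinuousLinearMap.fst ℂ B ℂ) -
    (ContinuousLinearMap.snd ℂ B ℂ).smulRight e).prod (ξ.comp (ContinuousLinearMap.fst ℂ B ℂ))

@[simp]
theorem bordered_apply (ξ : B →L[ℂ] ℂ) (S : B →L[ℂ] B) (e : B) (p : B × ℂ) :
    bordered ξ S e p = (S p.1 - p.2 • e, ξ p.1) := rfl

/-- The system S x - c e = y, ξ x = a is solved explicitly: the first equation gives x up to the
multiple c s⁻¹ of e, and ξ fixes c. This supplies the invertible approximants for the singular case.
-/
theorem isUnit_bordered_of_isUnit [CompleteSpace B] {ξ : B →L[ℂ] ℂ} {S : B →L[ℂ] B} {e : B}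
    {s : ℂ} (hS : IsUnit S) (hs : s ≠ 0) (he : S e = s • e) (hξ : ξ e = 1) :
    IsUnit (bordered ξ S e) := by
  obtain ⟨U, rfl⟩ := hS
  set R : B →L[ℂ] B := ((U⁻¹ : (B →L[ℂ] B)ˣ) : B →L[ℂ] B) with hR
  have hUR : ∀ y, (U : B →L[ℂ] B) (R y) = y := fun y => by
    rw [hR, ← mul_apply_eq_comp, Units.mul_inv, one_apply_eq_self]
  have hRU : ∀ y, R ((U : B →L[ℂ] B) y) = y := fun y => by
    rw [hR, ← mul_apply_eq_comp, Units.inv_mul, one_apply_eq_self]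
  have hRe : R e = s⁻¹ • e := by
    have : R (s • e) = e := by rw [← he, hRU]
    rw [map_smul] at this
    rw [eq_inv_smul_iff₀ hs, this]
  rw [ContinuousLinearMap.isUnit_iff_bijective]
  constructor
  · rw [injective_iff_map_eq_zero]
    rintro ⟨x, c⟩ h
    simp only [bordered_apply, Prod.mk_eq_zero] at h
    obtain ⟨h1, h2⟩ := h
    have hx : x = (c * s⁻¹) • e := by
      rw [← hRU x, sub_eq_zero.mp h1, map_smul, hRe, smul_smul]
    rw [hx, map_smul, hξ, smul_eq_mul, mul_one] at h2
    have hc : c = 0 := by simpa [hs] using h2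
    simp [hx, hc]
  · rintro ⟨y, a⟩
    refine ⟨(R (y + ((a - ξ (R y)) * s) • e), (a - ξ (R y)) * s), ?_⟩
    simp only [bordered_apply, hUR, add_sub_cancel_right]
    rw [map_add, map_smul, hRe, map_add, smul_smul, map_smul, hξ]
    congr 1
    rw [smul_eq_mul, mul_one, mul_assoc, mul_inv_cancel₀ hs]
    ring

/-- Injectivity holds because e is not in the range of `T - 1` and ξ separates the kernel. Adding
the line through e keeps the range closed, so the bordered operator is bounded below. It is also the
limit of the bordered operators of T - 1 - ε/2, which are invertible since 1 + ε/2 is outside the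
spectrum. -/
theorem isUnit_bordered_of_simple [CompleteSpace B] {ξ : B →L[ℂ] ℂ} {T : B →L[ℂ] B} {e : B}
    (hspec : ∀ z ∈ spectrum ℂ T, 1 ≤ ‖z‖ → z = 1) (hcl : IsClosed (Set.range (T - 1 : B →L[ℂ] B)))
    (hTe : T e = e) (hker : ∀ x, T x = x → ∃ c : ℂ, x = c • e)
    (hran : ∀ x (c : ℂ), T x - x = c • e → c = 0) (hξ : ξ e = 1) :
    IsUnit (bordered ξ (T - 1) e) := by
  have hinj : Function.Injective (bordered ξ (T - 1) e) := by
    rw [injective_iff_map_eq_zero]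
    rintro ⟨x, c⟩ h
    simp only [bordered_apply, Prod.mk_eq_zero, sub_eq_zero] at h
    obtain ⟨h1, h2⟩ := h
    have hc : c = 0 := hran x c (by simpa using h1)
    obtain ⟨a, ha⟩ := hker x (by rw [hc] at h1; simpa [sub_eq_zero] using h1)
    rw [ha, map_smul, hξ, smul_eq_mul, mul_one] at h2
    simp [ha, h2, hc]
  have hclosed : IsClosed (Set.range (bordered ξ (T - 1) e)) := by
    have h1 : IsClosed ((((T - 1 : B →L[ℂ] B) : B →ₗ[ℂ] B).range ⊔ (ℂ ∙ e) : Submodule ℂ B) :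
        Set B) := by
      refine Submodule.isClosed_sup_finiteDimensional _ _ ?_
      rwa [LinearMap.coe_range]
    -- The second coordinate imposes no condition: adding a multiple of e changes ξ x freely and
    -- leaves (T - 1) x alone.
    have h2 : Set.range (bordered ξ (T - 1) e) = Prod.fst ⁻¹'
        ((((T - 1 : B →L[ℂ] B) : B →ₗ[ℂ] B).range ⊔ (ℂ ∙ e) : Submodule ℂ B) : Set B) := by
      ext ⟨y, a⟩
      constructor
      · rintro ⟨⟨x, c⟩, h⟩
        simp only [bordered_apply, Prod.mk.injEq] at h
        refine Submodule.mem_sup.mpr ⟨(T - 1) x, ⟨x, rfl⟩, -(c • e),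
          Submodule.neg_mem _ (Submodule.smul_mem _ _ (Submodule.mem_span_singleton_self e)), ?_⟩
        change (T - 1) x + -(c • e) = y
        rw [← sub_eq_add_neg, h.1]
      · intro h
        obtain ⟨_, ⟨x, rfl⟩, w, hw, hy⟩ := Submodule.mem_sup.mp h
        obtain ⟨c, rfl⟩ := Submodule.mem_span_singleton.mp hw
        refine ⟨(x + (a - ξ x) • e, -c), ?_⟩
        simp only [bordered_apply, map_add, map_smul, hξ, Prod.mk.injEq]
        constructor
        · change (T - 1) x + c • e = y at hy
          rw [← hy]
          simp [hTe]
        · simp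
    rw [h2]
    exact h1.preimage continuous_fst
  obtain ⟨κ, hκ, hlow⟩ := exists_bounded_below _ hinj hclosed
  refine isUnit_of_bounded_below_of_approx _ hκ hlow fun ε hε => ?_
  refine ⟨bordered ξ (T - 1 - (ε / 2 : ℂ) • 1) e, ?_, ?_⟩
  · refine isUnit_bordered_of_isUnit (s := -(ε / 2 : ℂ)) ?_ ?_ ?_ hξ
    · have hn : ((1 + ε / 2 : ℝ) : ℂ) ∉ spectrum ℂ T := by
        intro hmem
        have h := hspec _ hmem (by
          rw [Complex.norm_real, Real.norm_of_nonneg (by positivity)]; linarith)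
        have : (1 + ε / 2 : ℝ) = 1 := by exact_mod_cast h
        linarith
      have := (isUnit_smul_one_sub_of_notMem hn).neg
      convert this using 1
      push_cast
      module
    · simpa using hε.ne'
    · simp [hTe]
  · have : bordered ξ (T - 1) e - bordered ξ (T - 1 - (ε / 2 : ℂ) • 1) e
        = (ContinuousLinearMap.inl ℂ B ℂ).comp
          ((ε / 2 : ℂ) • ContinuousLinearMap.fst ℂ B ℂ) := by
      ext p <;> simp
    rw [this]
    refine lt_of_le_of_lt (ContinuousLinearMap.opNorm_le_bound _ (M := ε / 2) (by positivity)
      fun p => ?_) (half_lt_self hε)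
    simp only [ContinuousLinearMap.comp_apply, ContinuousLinearMap.inl_apply,
      smul_apply, ContinuousLinearMap.coe_fst', Prod.norm_def, norm_zero]
    rw [max_eq_left (norm_nonneg _), norm_smul]
    have : ‖(ε / 2 : ℂ)‖ = ε / 2 := by
      rw [show (ε / 2 : ℂ) = ((ε / 2 : ℝ) : ℂ) by push_cast; rfl, Complex.norm_real,
        Real.norm_of_nonneg (by positivity)]
    rw [this]
    gcongr
    exact le_max_left _ _

theorem contDiff_bordered (ξ : B →L[ℂ] ℂ) {n : WithTop ℕ∞} :
    ContDiff ℝ n (fun p : (B →L[ℂ] B) × B => bordered ξ p.1 p.2) := by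
  have : ContDiff ℂ n (fun p : (B →L[ℂ] B) × B => bordered ξ p.1 p.2) := by
    have h : (fun p : (B →L[ℂ] B) × B => bordered ξ p.1 p.2) = fun p =>
      (ContinuousLinearMap.inl ℂ B ℂ).comp (p.1.comp (ContinuousLinearMap.fst ℂ B ℂ) -
        (ContinuousLinearMap.snd ℂ B ℂ).smulRight p.2) +
      (ContinuousLinearMap.inr ℂ B ℂ).comp (ξ.comp (ContinuousLinearMap.fst ℂ B ℂ)) := by
      funext p
      ext q <;> simp
    rw [h]
    have h2 : ContDiff ℂ n fun p : (B →L[ℂ] B) × B =>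
        (ContinuousLinearMap.snd ℂ B ℂ).smulRight p.2 :=
      (ContinuousLinearMap.smulRightL ℂ (B × ℂ) B
        (ContinuousLinearMap.snd ℂ B ℂ)).contDiff.comp contDiff_snd
    exact (contDiff_const.clm_comp ((contDiff_fst.clm_comp contDiff_const).sub h2)).add
      contDiff_const
  exact this.restrict_scalars ℝ

end Bordered

/-! ### Smooth continuation of the simple eigenvalue. -/

section Perturbation

variable {B : Type*} [NormedAddCommGroup B] [NormedSpace ℂ B]

theorem contDiff_clm_apply_real {F : Type*} [NormedAddCommGroup F] [NormedSpace ℂ F]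
    {n : WithTop ℕ∞} : ContDiff ℝ n (fun p : (B →L[ℂ] F) × B => p.1 p.2) :=
  (isBoundedBilinearMap_apply (𝕜 := ℂ) (E := B) (F := F)).contDiff.restrict_scalars ℝ

theorem contDiff_smul_complex {n : WithTop ℕ∞} :
    ContDiff ℝ n (fun p : ℂ × B => p.1 • p.2) :=
  (isBoundedBilinearMap_smul (𝕜 := ℂ) (A := ℂ) (E := B)).contDiff.restrict_scalars ℝ

/-- The implicit function theorem applies to (t, x, m) ↦ (L_t x - m x, ξ x) at (0, e, 1): its
derivative in (x, m) is the bordered operator. The normalization ξ x = 1 removes the scaling freedom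
of eigenvectors. -/
theorem exists_perturbed_eigenpair [CompleteSpace B] {L : ℝ → B →L[ℂ] B} {n : ℕ} (hn : n ≠ 0)
    (hL : ContDiffAt ℝ n L 0) {e : B} {ξ : B →L[ℂ] ℂ} (he : L 0 e = e) (hξ : ξ e = 1)
    (hu : IsUnit (bordered ξ (L 0 - 1) e)) :
    ∃ (x : ℝ → B) (μ : ℝ → ℂ), ContDiffAt ℝ n x 0 ∧ ContDiffAt ℝ n μ 0 ∧ x 0 = e ∧ μ 0 = 1 ∧
      ∀ᶠ t in 𝓝 (0 : ℝ), L t (x t) = μ t • x t ∧ ξ (x t) = 1 := by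
  set f : ℝ × (B × ℂ) → B × ℂ := fun p => (L p.1 p.2.1 - p.2.2 • p.2.1, ξ p.2.1) with hf
  set u : ℝ × (B × ℂ) := (0, (e, 1)) with hu_def
  have hn' : (n : WithTop ℕ∞) ≠ 0 := by exact_mod_cast hn
  have hfst : ContDiff ℝ n (fun p : ℝ × (B × ℂ) => p.2.1) := contDiff_fst.comp contDiff_snd
  have hsnd : ContDiff ℝ n (fun p : ℝ × (B × ℂ) => p.2.2) := contDiff_snd.comp contDiff_snd
  have hLp : ContDiffAt ℝ n (fun p : ℝ × (B × ℂ) => L p.1) u :=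
    ContDiffAt.comp u (f := Prod.fst) (g := L) hL contDiff_fst.contDiffAt
  have hcd : ContDiffAt ℝ n f u := by
    refine ContDiffAt.prodMk (ContDiffAt.sub ?_ ?_) ?_
    · exact contDiff_clm_apply_real.contDiffAt.comp u (hLp.prodMk hfst.contDiffAt)
    · exact contDiff_smul_complex.contDiffAt.comp u (hsnd.prodMk hfst).contDiffAt
    · exact (ξ.contDiff.restrict_scalars ℝ).contDiffAt.comp u hfst.contDiffAt
  have hder : fderiv ℝ f u ∘L .inr ℝ ℝ (B × ℂ)
      = (bordered ξ (L 0 - 1) e).restrictScalars ℝ := by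
    have h1 : HasFDerivAt (fun q : B × ℂ => f (0, q)) (fderiv ℝ f u ∘L .inr ℝ ℝ (B × ℂ))
        ((e, 1) : B × ℂ) :=
      HasFDerivAt.comp (𝕜 := ℝ) ((e, 1) : B × ℂ) (g := f)
        (hcd.differentiableAt hn').hasFDerivAt (hasFDerivAt_prodMk_right (0 : ℝ) ((e, 1) : B × ℂ))
    have h2 : HasFDerivAt (fun q : B × ℂ => f (0, q)) (bordered ξ (L 0 - 1) e)
        ((e, 1) : B × ℂ) := by
      have h3 : HasFDerivAt (fun q : B × ℂ => f (0, q))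
          ((((L 0).comp (ContinuousLinearMap.fst ℂ B ℂ)) -
            ((1 : ℂ) • ContinuousLinearMap.fst ℂ B ℂ +
              (ContinuousLinearMap.snd ℂ B ℂ).smulRight e)).prod
            (ξ.comp (ContinuousLinearMap.fst ℂ B ℂ))) ((e, 1) : B × ℂ) := by
        refine HasFDerivAt.prodMk (HasFDerivAt.sub ?_ ?_) ?_
        · exact ((L 0).comp (ContinuousLinearMap.fst ℂ B ℂ)).hasFDerivAt
        · exact HasFDerivAt.smul (c := Prod.snd) (f := Prod.fst)
            (hasFDerivAt_snd (𝕜 := ℂ) (p := ((e, 1) : B × ℂ))) hasFDerivAt_fst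
        · exact (ξ.comp (ContinuousLinearMap.fst ℂ B ℂ)).hasFDerivAt
      convert h3 using 1
      ext p <;> simp
    exact h1.unique (h2.restrictScalars ℝ)
  have hinv : (fderiv ℝ f u ∘L .inr ℝ ℝ (B × ℂ)).IsInvertible := by
    rw [hder]
    obtain ⟨U, hU⟩ := hu
    refine ⟨(ContinuousLinearEquiv.ofUnit U).restrictScalars ℝ, ?_⟩
    rw [← hU]
    rfl
  refine ⟨fun t => (hcd.implicitFunction hn' hinv t).1, fun t => (hcd.implicitFunction hn' hinv t).2,
    (hcd.contDiffAt_implicitFunction hn' hinv).fst, (hcd.contDiffAt_implicitFunction hn' hinv).snd,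
    ?_, ?_, ?_⟩
  · exact congrArg Prod.fst (hcd.implicitFunction_apply_self hn' hinv)
  · exact congrArg Prod.snd (hcd.implicitFunction_apply_self hn' hinv)
  · filter_upwards [hcd.eventually_apply_implicitFunction hn' hinv] with t ht
    have hfu : f u = (0, 1) := by simp [hf, hu_def, he, hξ]
    rw [hfu] at ht
    have h1 := congrArg Prod.fst ht
    have h2 := congrArg Prod.snd ht
    exact ⟨sub_eq_zero.mp h1, h2⟩

end Perturbation

/-! ### Uniform exponential bounds for powers. -/

section PowerBounds

variable {B : Type*} [NormedAddCommGroup B] [NormedSpace ℂ B]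

theorem opNorm_pow_le (T : B →L[ℂ] B) (n : ℕ) : ‖T ^ n‖ ≤ ‖T‖ ^ n := by
  rcases Nat.eq_zero_or_pos n with rfl | hn
  · simp only [pow_zero]
    exact ContinuousLinearMap.norm_id_le
  · exact norm_pow_le' T hn

/-- Gelfand's formula: the roots ‖T^m‖^{1/m} converge to the spectral radius, which is below 1. -/
theorem exists_pow_norm_lt_one [CompleteSpace B] {T : B →L[ℂ] B}
    (hT : ∀ z ∈ spectrum ℂ T, ‖z‖ < 1) : ∃ m : ℕ, 0 < m ∧ ‖T ^ m‖ < 1 := by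
  rcases subsingleton_or_nontrivial B with hB | hB
  · exact ⟨1, one_pos, by rw [Subsingleton.elim (T ^ 1) 0, norm_zero]; exact one_pos⟩
  have hr : spectralRadius ℂ T < (1 : ℝ≥0) :=
    spectrum.spectralRadius_lt_of_forall_lt T fun z hz => by exact_mod_cast hT z hz
  have ht := spectrum.pow_nnnorm_pow_one_div_tendsto_nhds_spectralRadius T
  obtain ⟨m, hm, hm0⟩ := ((ht.eventually (gt_mem_nhds hr)).and (eventually_gt_atTop 0)).exists
  refine ⟨m, hm0, ?_⟩
  by_contra hge
  rw [not_lt] at hge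
  have h1 : (1 : ℝ≥0∞) ≤ (‖T ^ m‖₊ : ℝ≥0∞) := by exact_mod_cast hge
  have := ENNReal.one_le_rpow h1 (z := 1 / (m : ℝ)) (by positivity)
  exact absurd hm (not_lt.mpr (by simpa using this))

/-- A uniform exponential bound for the powers of operators near one whose spectrum lies in the
open unit disk. -/
theorem eventually_pow_norm_le [CompleteSpace B] {T : ℝ → B →L[ℂ] B} {t₀ : ℝ}
    (hc : ContinuousAt T t₀) (hT : ∀ z ∈ spectrum ℂ (T t₀), ‖z‖ < 1) :
    ∃ C θ : ℝ, 0 < C ∧ 0 < θ ∧ θ < 1 ∧ ∀ᶠ t in 𝓝 t₀, ∀ N : ℕ, ‖T t ^ N‖ ≤ C * θ ^ N := by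
  obtain ⟨m, hm, hlt⟩ := exists_pow_norm_lt_one hT
  -- With q strictly between ‖T t₀ ^ m‖ and 1, the bound ‖T t ^ m‖ < q is an open condition on t.
  set q : ℝ := (‖T t₀ ^ m‖ + 1) / 2 with hq
  have hq0 : 0 < q := by positivity
  have hq1 : q < 1 := by rw [hq]; linarith
  set M : ℝ := ‖T t₀‖ + 1 with hM
  have hM1 : 1 ≤ M := by rw [hM]; linarith [norm_nonneg (T t₀)]
  have hθm : (q ^ ((m : ℝ)⁻¹)) ^ m = q := Real.rpow_inv_natCast_pow hq0.le hm.ne'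
  set θ : ℝ := q ^ ((m : ℝ)⁻¹) with hθ
  have hθ0 : 0 < θ := Real.rpow_pos_of_pos hq0 _
  have hθ1 : θ < 1 := Real.rpow_lt_one hq0.le hq1 (by positivity)
  -- M^m pays for the N % m leftover factors, and 1/q for rounding N/m down.
  refine ⟨M ^ m / q, θ, by positivity, hθ0, hθ1, ?_⟩
  have e1 : ∀ᶠ t in 𝓝 t₀, ‖T t ^ m‖ < q :=
    (hc.pow m).norm.eventually (gt_mem_nhds (by
      change ‖T t₀ ^ m‖ < q; rw [hq]; linarith))
  have e2 : ∀ᶠ t in 𝓝 t₀, ‖T t‖ < M := hc.norm.eventually (gt_mem_nhds (by rw [hM]; linarith))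
  filter_upwards [e1, e2] with t h1 h2 N
  have hsplit : N = m * (N / m) + N % m := (Nat.div_add_mod N m).symm
  have hmod : N % m < m := Nat.mod_lt _ hm
  calc ‖T t ^ N‖ = ‖(T t ^ m) ^ (N / m) * T t ^ (N % m)‖ := by
        rw [← pow_mul, ← pow_add, ← hsplit]
    _ ≤ ‖T t ^ m‖ ^ (N / m) * ‖T t‖ ^ (N % m) :=
        (norm_mul_le _ _).trans (mul_le_mul (opNorm_pow_le _ _) (opNorm_pow_le _ _)
          (norm_nonneg _) (by positivity))
    _ ≤ q ^ (N / m) * M ^ m := by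
        refine mul_le_mul (pow_le_pow_left₀ (norm_nonneg _) h1.le _) ?_ (by positivity)
          (by positivity)
        exact (pow_le_pow_left₀ (norm_nonneg _) h2.le _).trans
          (pow_le_pow_right₀ hM1 hmod.le)
    _ ≤ M ^ m / q * θ ^ N := by
        have h3 : q ^ (N / m) * q ≤ θ ^ N := by
          rw [← pow_succ, ← hθm, ← pow_mul]
          refine pow_le_pow_of_le_one hθ0.le hθ1.le ?_
          rw [mul_add, mul_one]
          omega
        rw [div_mul_eq_mul_div, le_div_iff₀ hq0]
        nlinarith [pow_pos (show 0 < M by linarith) m]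

/-- A continuous family of operators with spectrum in the open unit disk has uniformly
exponentially small powers on compact sets. -/
theorem IsCompact.exists_pow_norm_le [CompleteSpace B] {T : ℝ → B →L[ℂ] B} {S : Set ℝ}
    (hS : IsCompact S) (hc : Continuous T) (hT : ∀ t ∈ S, ∀ z ∈ spectrum ℂ (T t), ‖z‖ < 1) :
    ∃ C θ : ℝ, 0 < C ∧ 0 < θ ∧ θ < 1 ∧ ∀ t ∈ S, ∀ N : ℕ, ‖T t ^ N‖ ≤ C * θ ^ N := by
  refine hS.induction_on (p := fun S => ∃ C θ : ℝ, 0 < C ∧ 0 < θ ∧ θ < 1 ∧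
    ∀ t ∈ S, ∀ N : ℕ, ‖T t ^ N‖ ≤ C * θ ^ N) ?_ ?_ ?_ ?_
  · exact ⟨1, 1 / 2, by norm_num, by norm_num, by norm_num, fun t ht => absurd ht (by simp)⟩
  · rintro s t hst ⟨C, θ, hC, hθ0, hθ1, h⟩
    exact ⟨C, θ, hC, hθ0, hθ1, fun u hu => h u (hst hu)⟩
  · rintro s t ⟨C, θ, hC, hθ0, hθ1, h⟩ ⟨C', θ', hC', hθ0', hθ1', h'⟩
    refine ⟨max C C', max θ θ', lt_max_of_lt_left hC, lt_max_of_lt_left hθ0, max_lt hθ1 hθ1',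
      fun u hu N => ?_⟩
    rcases hu with hu | hu
    · exact (h u hu N).trans (mul_le_mul (le_max_left _ _)
        (pow_le_pow_left₀ hθ0.le (le_max_left _ _) _) (by positivity) (by positivity))
    · exact (h' u hu N).trans (mul_le_mul (le_max_right _ _)
        (pow_le_pow_left₀ hθ0'.le (le_max_right _ _) _) (by positivity) (by positivity))
  · intro t ht
    obtain ⟨C, θ, hC, hθ0, hθ1, h⟩ := eventually_pow_norm_le hc.continuousAt (hT t ht)
    exact ⟨_, mem_nhdsWithin_of_mem_nhds h, C, θ, hC, hθ0, hθ1, fun u hu => hu⟩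

end PowerBounds

/-! ### Spectral projection and the leading term. -/

section LeadingEigenvalue

variable {B : Type*} [NormedAddCommGroup B] [NormedSpace ℂ B]

/-- The left eigenvector read off from the inverse of the bordered operator. -/
noncomputable def leftVector (ξ : B →L[ℂ] ℂ) (S : B →L[ℂ] B) (x : B) : B →L[ℂ] ℂ :=
  (ContinuousLinearMap.snd ℂ B ℂ).comp
    ((Ring.inverse (bordered ξ S x)).comp (ContinuousLinearMap.inl ℂ B ℂ))

theorem ring_inverse_bordered_apply {ξ : B →L[ℂ] ℂ} {S : B →L[ℂ] B} {x : B}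
    (hu : IsUnit (bordered ξ S x)) (p : B × ℂ) :
    Ring.inverse (bordered ξ S x) (S p.1 - p.2 • x, ξ p.1) = p := by
  rw [← bordered_apply, ← mul_apply_eq_comp, Ring.inverse_mul_cancel _ hu, one_apply_eq_self]

/-- The bordered operator sends (0, -1) to (x, 0). The resulting sign is the reason for the minus in
`eigenProj`. -/
theorem leftVector_self {ξ : B →L[ℂ] ℂ} {S : B →L[ℂ] B} {x : B}
    (hu : IsUnit (bordered ξ S x)) : leftVector ξ S x x = -1 := by
  have := ring_inverse_bordered_apply hu ((0, -1) : B × ℂ)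
  simp only [map_zero, zero_sub, neg_smul, one_smul, neg_neg] at this
  simp [leftVector, this]

/-- The bordered operator sends (y - ξ(y) x, 0) to (S y, 0), whose preimage has second coordinate 0.
-/
theorem leftVector_map {ξ : B →L[ℂ] ℂ} {S : B →L[ℂ] B} {x : B}
    (hu : IsUnit (bordered ξ S x)) (hS : S x = 0) (hξ : ξ x = 1) (y : B) :
    leftVector ξ S x (S y) = 0 := by
  have := ring_inverse_bordered_apply hu ((y - ξ y • x, 0) : B × ℂ)
  simp only [map_sub, map_smul, hS, hξ, zero_smul, smul_zero, sub_zero, smul_eq_mul, mul_one,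
    sub_self] at this
  simp [leftVector, this]

theorem exists_of_leftVector_eq_zero {ξ : B →L[ℂ] ℂ} {S : B →L[ℂ] B} {x : B}
    (hu : IsUnit (bordered ξ S x)) {w : B} (hw : leftVector ξ S x w = 0) : ∃ y, S y = w := by
  have h : bordered ξ S x (Ring.inverse (bordered ξ S x) (w, 0)) = (w, 0) := by
    rw [← mul_apply_eq_comp, Ring.mul_inverse_cancel _ hu, one_apply_eq_self]
  rw [bordered_apply] at h
  have h1 := congrArg Prod.fst h
  have h2 : (Ring.inverse (bordered ξ S x) (w, 0)).2 = 0 := by simpa [leftVector] using hw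
  exact ⟨_, by simpa [h2] using h1⟩

/-- The rank-one projection onto the leading eigenvector. -/
noncomputable def eigenProj (ξ : B →L[ℂ] ℂ) (S : B →L[ℂ] B) (x : B) : B →L[ℂ] B :=
  (-leftVector ξ S x).smulRight x

theorem eigenProj_apply (ξ : B →L[ℂ] ℂ) (S : B →L[ℂ] B) (x y : B) :
    eigenProj ξ S x y = -(leftVector ξ S x y) • x := rfl

/-- The projection is idempotent, commutes with T, and T acts on it as m, so the two summands of T
annihilate each other. The exponent is N + 1 because the zeroth powers do not split this way. -/
theorem pow_eq_eigenProj_add {ξ : B →L[ℂ] ℂ} {T : B →L[ℂ] B} {x : B} {m : ℂ}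
    (hu : IsUnit (bordered ξ (T - m • 1) x)) (hT : T x = m • x) (hξ : ξ x = 1) (N : ℕ) :
    T ^ (N + 1) = m ^ (N + 1) • eigenProj ξ (T - m • 1) x +
      (T - m • eigenProj ξ (T - m • 1) x) ^ (N + 1) := by
  set Pr := eigenProj ξ (T - m • 1) x with hPr
  have hS : (T - m • (1 : B →L[ℂ] B)) x = 0 := by simp [hT]
  have h1 : T * Pr = m • Pr := by
    ext y
    simp only [mul_apply_eq_comp, hPr, eigenProj_apply, map_smul, hT, smul_apply]
    rw [smul_comm]
  have h2 : Pr * T = m • Pr := by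
    ext y
    have := leftVector_map hu hS hξ y
    simp only [sub_apply, smul_apply, one_apply_eq_self, map_sub, map_smul,
      sub_eq_zero] at this
    simp only [mul_apply_eq_comp, hPr, eigenProj_apply, smul_apply, this, smul_eq_mul, smul_smul]
    ring_nf
  have h3 : Pr * Pr = Pr := by
    ext y
    simp only [mul_apply_eq_comp, hPr, eigenProj_apply, map_smul, leftVector_self hu]
    simp
  have h4 : Pr * (T - m • Pr) = 0 := by rw [mul_sub, h2, mul_smul_comm, h3, sub_self]
  induction N with
  | zero => simp
  | succ N ih =>
    rw [pow_succ' T, ih, mul_add, mul_smul_comm, h1, smul_smul, ← pow_succ]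
    congr 1
    have h5 : Pr * (T - m • Pr) ^ (N + 1) = 0 := by rw [pow_succ', ← mul_assoc, h4, zero_mul]
    rw [pow_succ' _ (N + 1), sub_mul, smul_mul_assoc, h5, smul_zero, sub_zero]

/-- T - Pr is zero on the line through e and agrees with T on the invariant kernel of Λ, where 1 has
left the spectrum. For z ≠ 1 the resolvent of T inverts it there; for z = 1, the kernel of T - 1 is
the line and its range is the kernel of Λ. -/
theorem spectrum_sub_eigenProj [CompleteSpace B] {ξ : B →L[ℂ] ℂ} {T : B →L[ℂ] B} {e : B}
    (hu : IsUnit (bordered ξ (T - 1) e)) (hT : T e = e) (hξ : ξ e = 1)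
    (hker : ∀ x, T x = x → ∃ c : ℂ, x = c • e)
    (hspec : ∀ z ∈ spectrum ℂ T, 1 ≤ ‖z‖ → z = 1) :
    ∀ z ∈ spectrum ℂ (T - eigenProj ξ (T - 1) e), ‖z‖ < 1 := by
  intro z hz
  by_contra! hz1
  have hS : (T - (1 : B →L[ℂ] B)) e = 0 := by simp [hT]
  set Λ := leftVector ξ (T - 1) e with hΛ
  set Pr := eigenProj ξ (T - 1) e with hPr
  have hPra : ∀ y, Pr y = -(Λ y) • e := fun y => rfl
  have hΛe : Λ e = -1 := leftVector_self hu
  have hΛT : ∀ y, Λ (T y) = Λ y := fun y => by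
    have := leftVector_map hu hS hξ y
    simpa [sub_eq_zero] using this
  have hz0 : z ≠ 0 := by rintro rfl; norm_num at hz1
  have hunit : z ≠ 1 → IsUnit (z • (1 : B →L[ℂ] B) - T) := fun hne =>
    isUnit_smul_one_sub_of_notMem fun hmem => hne (hspec z hmem hz1)
  rw [spectrum.mem_iff, Algebra.algebraMap_eq_smul_one] at hz
  apply hz
  rw [ContinuousLinearMap.isUnit_iff_bijective]
  constructor
  · rw [injective_iff_map_eq_zero]
    intro y hy
    have hy' : z • y - (T y - Pr y) = 0 := by simpa using hy
    have hΛy : Λ y = 0 := by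
      have := congrArg Λ hy'
      simp only [hPra, map_sub, map_smul, hΛT, smul_eq_mul, hΛe, map_zero] at this
      have : z * Λ y = 0 := by linear_combination this
      exact (mul_eq_zero.mp this).resolve_left hz0
    have hTy : z • y - T y = 0 := by simpa [hPra, hΛy] using hy'
    by_cases hne : z = 1
    · obtain ⟨c, hc⟩ := hker y (by rw [hne, one_smul, sub_eq_zero] at hTy; exact hTy.symm)
      have : c = 0 := by simpa [hc, hΛe] using hΛy
      simp [hc, this]
    · have hinj := ((ContinuousLinearMap.isUnit_iff_bijective).mp (hunit hne)).1
      exact hinj (by simpa using hTy)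
  · intro w
    -- The target splits as (w - Pr w) + Pr w: the first part is solved inside the kernel of Λ, the
    -- second by dividing by z.
    have hex : ∃ y, z • y - T y = w - Pr w ∧ Λ y = 0 := by
      have hΛw : Λ (w - Pr w) = 0 := by simp [hPra, hΛe]
      by_cases hne : z = 1
      · obtain ⟨y, hy⟩ := exists_of_leftVector_eq_zero hu hΛw
        have hy' : T y - y = w - Pr w := by simpa using hy
        refine ⟨-(y - Pr y), ?_, by simp [hPra, hΛe]⟩
        rw [← hy', hne]
        simp [hPra, hT, neg_add_eq_sub]
      · obtain ⟨y, hy⟩ := ((ContinuousLinearMap.isUnit_iff_bijective).mp (hunit hne)).2 (w - Pr w)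
        have hy' : z • y - T y = w - Pr w := by simpa using hy
        refine ⟨y, hy', ?_⟩
        rw [← hy', map_sub, map_smul, hΛT, smul_eq_mul] at hΛw
        have : (z - 1) * Λ y = 0 := by linear_combination hΛw
        exact (mul_eq_zero.mp this).resolve_left (sub_ne_zero.mpr hne)
    obtain ⟨y, hy, hΛy⟩ := hex
    refine ⟨y + z⁻¹ • Pr w, ?_⟩
    have h1 : Pr y = 0 := by simp [hPra, hΛy]
    have h2 : T (Pr w) = Pr w := by simp [hPra, hT]
    have h3 : Pr (Pr w) = Pr w := by simp [hPra, hΛe]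
    simp only [sub_apply, smul_apply, one_apply_eq_self, map_add, map_smul,
      h1, h2, h3, smul_smul, inv_mul_cancel₀ hz0, one_smul, sub_zero, sub_self]
    rw [hy, sub_add_cancel]

/-- The leading eigenvalue: powers of `L t` are, up to an exponentially small error, given by
powers of a smooth function of `t`. -/
theorem exists_leading_eigenvalue [CompleteSpace B] {L : ℝ → B →L[ℂ] B} {n : ℕ} (hn : n ≠ 0)
    (hA1 : AssumptionA1 L n) (hA2 : AssumptionA2 L) (v : B) (l : B →L[ℂ] ℂ) :
    ∃ μ Z : ℝ → ℂ, ContDiffAt ℝ n μ 0 ∧ ContDiffAt ℝ n Z 0 ∧ μ 0 = 1 ∧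
      ∃ C θ : ℝ, 0 < C ∧ 0 < θ ∧ θ < 1 ∧ ∀ᶠ t in 𝓝 (0 : ℝ), ∀ N : ℕ, 1 ≤ N →
        ‖l ((L t ^ N) v) - μ t ^ N * Z t‖ ≤ C * θ ^ N := by
  obtain ⟨-, δ, hδ, hcd⟩ := hA1
  have hL : ContDiffAt ℝ n L 0 := hcd.contDiffAt (Icc_mem_nhds (by linarith) hδ)
  have hspec : ∀ z ∈ spectrum ℂ (L 0), 1 ≤ ‖z‖ → z = 1 := fun z hz => hA2.eq_one_of_one_le_norm hz
  obtain ⟨e, he0, hTe, hker, hran⟩ := hA2.2.1.exists_eigenvector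
  simp only [one_smul] at hTe hker hran
  have hcl : IsClosed (Set.range (L 0 - 1 : B →L[ℂ] B)) := by
    obtain ⟨ρ, hρ, hess⟩ := hA2.2.2.2
    have hfr : ((1 : ℂ) • ContinuousLinearMap.id ℂ B - L 0).IsFredholm := by
      by_contra hne
      have := hess (show (1 : ℂ) ∈ essentialSpectrum (L 0) from hne)
      rw [mem_closedBall_zero_iff, norm_one] at this
      linarith
    have h1 := hfr.isClosed_range
    rw [LinearMap.coe_range] at h1
    convert h1 using 1
    ext y
    constructor
    · rintro ⟨x, rfl⟩; exact ⟨-x, by simp [neg_add_eq_sub]⟩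
    · rintro ⟨x, rfl⟩; exact ⟨-x, by simp [neg_add_eq_sub]⟩
  obtain ⟨ξ, hξ⟩ : ∃ ξ : B →L[ℂ] ℂ, ξ e = 1 := by
    obtain ⟨g, -, hg⟩ := exists_dual_vector ℂ e (norm_ne_zero_iff.mpr he0)
    refine ⟨(‖e‖ : ℂ)⁻¹ • g, ?_⟩
    have : (‖e‖ : ℂ) ≠ 0 := by exact_mod_cast norm_ne_zero_iff.mpr he0
    simp only [smul_apply, hg, smul_eq_mul]
    exact inv_mul_cancel₀ this
  have hu0 : IsUnit (bordered ξ (L 0 - 1) e) :=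
    isUnit_bordered_of_simple hspec hcl hTe hker hran hξ
  obtain ⟨x, μ, hx, hμ, hx0, hμ0, hev⟩ := exists_perturbed_eigenpair hn hL hTe hξ hu0
  have hS : ContDiffAt ℝ n (fun t => L t - μ t • (1 : B →L[ℂ] B)) 0 :=
    hL.sub (contDiff_smul_complex.contDiffAt.comp (0 : ℝ) (hμ.prodMk contDiffAt_const))
  have hG : ContDiffAt ℝ n (fun t => bordered ξ (L t - μ t • 1) (x t)) 0 :=
    (contDiff_bordered ξ).contDiffAt.comp (0 : ℝ) (hS.prodMk hx)
  have hG0 : bordered ξ (L 0 - μ 0 • 1) (x 0) = bordered ξ (L 0 - 1) e := by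
    rw [hμ0, hx0, one_smul]
  have hGi : ContDiffAt ℝ n (fun t => Ring.inverse (bordered ξ (L t - μ t • 1) (x t))) 0 := by
    refine ContDiffAt.comp (0 : ℝ) (g := Ring.inverse) ?_ hG
    obtain ⟨U, hU⟩ := hu0
    rw [hG0, ← hU]
    exact contDiffAt_ringInverse ℝ U
  have hunit : ∀ᶠ t in 𝓝 (0 : ℝ), IsUnit (bordered ξ (L t - μ t • 1) (x t)) := by
    refine hG.continuousAt.eventually (Units.isOpen.mem_nhds ?_)
    change IsUnit (bordered ξ (L 0 - μ 0 • 1) (x 0))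
    rw [hG0]
    exact hu0
  have hΛ : ContinuousAt (fun t => leftVector ξ (L t - μ t • 1) (x t)) 0 :=
    continuousAt_const.clm_comp (hGi.continuousAt.clm_comp continuousAt_const)
  have hPr : ContinuousAt (fun t => eigenProj ξ (L t - μ t • 1) (x t)) 0 := by
    have h := (ContinuousLinearMap.smulRightL ℂ B B).continuous₂.continuousAt.comp
      (hΛ.neg.prodMk hx.continuousAt)
    exact h
  have hQ : ContinuousAt (fun t => L t - μ t • eigenProj ξ (L t - μ t • 1) (x t)) 0 :=
    hL.continuousAt.sub (hμ.continuousAt.smul hPr)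
  obtain ⟨C, θ, hC, hθ0, hθ1, hpow⟩ := eventually_pow_norm_le hQ (by
    rw [hμ0, hx0, one_smul, one_smul]
    exact spectrum_sub_eigenProj hu0 hTe hξ hker hspec)
  refine ⟨μ, fun t => l (eigenProj ξ (L t - μ t • 1) (x t) v), hμ, ?_, hμ0,
    ‖l‖ * C * ‖v‖ + 1, θ, by positivity, hθ0, hθ1, ?_⟩
  · have h1 : ContDiffAt ℝ n (fun t => (leftVector ξ (L t - μ t • 1) (x t)) v) 0 := by
      have h2 : ContDiffAt ℝ n
          (fun t => Ring.inverse (bordered ξ (L t - μ t • 1) (x t)) (v, (0 : ℂ))) 0 :=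
        contDiff_clm_apply_real.contDiffAt.comp (0 : ℝ) (hGi.prodMk contDiffAt_const)
      exact h2.snd
    have h3 : ContDiffAt ℝ n (fun t => l (x t)) 0 :=
      (l.contDiff.restrict_scalars ℝ).contDiffAt.comp (0 : ℝ) hx
    have h4 := h1.neg.mul h3
    refine h4.congr_of_eventuallyEq (Eventually.of_forall fun t => ?_)
    simp [eigenProj_apply]
  · filter_upwards [hev, hunit, hpow] with t ⟨ht1, ht2⟩ hut hpt N hN
    obtain ⟨k, rfl⟩ := Nat.exists_eq_add_of_le' hN
    rw [pow_eq_eigenProj_add hut ht1 ht2 k]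
    simp only [add_apply, smul_apply, map_add, map_smul, smul_eq_mul,
      add_sub_cancel_left]
    refine (l.le_opNorm _).trans ?_
    have h5 := ContinuousLinearMap.le_of_opNorm_le _ (hpt (k + 1)) v
    have h6 := mul_le_mul_of_nonneg_left h5 (norm_nonneg l)
    have h7 : 0 < θ ^ (k + 1) := by positivity
    nlinarith

end LeadingEigenvalue

/-! ### Decay of the characteristic functions away from 0. -/

section Decay

variable {B : Type*} [NormedAddCommGroup B] [NormedSpace ℂ B]

theorem exists_geometric_le_inv_pow {θ : ℝ} (h0 : 0 < θ) (h1 : θ < 1) (k : ℕ) :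
    ∃ C : ℝ, 0 < C ∧ ∀ N : ℕ, (N : ℝ) ^ k * θ ^ N ≤ C := by
  have ht := tendsto_pow_const_mul_const_pow_of_lt_one k h0.le h1
  obtain ⟨C, hC⟩ := ht.bddAbove_range
  exact ⟨max C 1, by positivity, fun N => (hC ⟨N, rfl⟩).trans (le_max_left _ _)⟩

/-- J blocks of equal length carry the decay; one last block absorbs the remainder of the division
and need only be bounded. -/
theorem pow_norm_le_of_blocks (T : B →L[ℂ] B) {N J : ℕ} {D : ℝ}
    (h : ‖T ^ (N / (J + 1) + N % (J + 1))‖ ≤ D) :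
    ‖T ^ N‖ ≤ ‖T ^ (N / (J + 1))‖ ^ J * D := by
  have hN : N = N / (J + 1) * J + (N / (J + 1) + N % (J + 1)) := by
    have := Nat.div_add_mod N (J + 1)
    nlinarith
  calc ‖T ^ N‖ = ‖(T ^ (N / (J + 1))) ^ J * T ^ (N / (J + 1) + N % (J + 1))‖ := by
        rw [← pow_mul, ← pow_add, ← hN]
    _ ≤ _ := (norm_mul_le _ _).trans
        (mul_le_mul (opNorm_pow_le _ _) h (norm_nonneg _) (by positivity))

/-- Away from the origin the powers of `L t` decay faster than any power of `N`, with an integrable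
dependence on `t`. -/
theorem exists_pow_norm_le_inv [CompleteSpace B] {L : ℝ → B →L[ℂ] B} (hcont : Continuous L)
    {r₁ α : ℝ} (hr₁ : 0 < r₁) (hα : 0 < α) (hA3 : AssumptionA3 L) (hA4 : AssumptionA4 L r₁)
    (hA5 : AssumptionA5 L r₁ α) {δ : ℝ} (hδ : 0 < δ) (k : ℕ) :
    ∃ C : ℝ, 0 < C ∧ ∀ᶠ N : ℕ in atTop, ∀ t : ℝ, δ ≤ |t| →
      ‖L t ^ N‖ ≤ C / ((N : ℝ) ^ k * (1 + t ^ 2)) := by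
  obtain ⟨K, r₂, N₀, hK, hr₂, -, h4⟩ := hA4
  obtain ⟨C, N₁, hC, h5⟩ := hA5
  have hS : IsCompact {t : ℝ | δ ≤ |t| ∧ |t| ≤ K} := by
    refine (isCompact_Icc (a := -K) (b := K)).of_isClosed_subset ?_ fun t ht => abs_le.mp ht.2
    exact (isClosed_le continuous_const continuous_abs).inter
      (isClosed_le continuous_abs continuous_const)
  obtain ⟨C₁, θ, hC₁, hθ0, hθ1, hcomp⟩ := IsCompact.exists_pow_norm_le hS hcont fun t ht z hz => by
    have ht0 : t ≠ 0 := by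
      rintro rfl
      have := ht.1
      rw [abs_zero] at this
      linarith
    simpa using hA3 t ht0 hz
  obtain ⟨C₂, hC₂, hgeo⟩ := exists_geometric_le_inv_pow hθ0 hθ1 k
  -- With blocks of length m, J must beat two demands: m^{r₂ J} against m^{k + 2 r₁} when |t| ≤
  -- m^{r₁}, and |t|^{α J} against |t|^{k/r₁ + 2} when |t| > m^{r₁}.
  obtain ⟨J, hJ⟩ := exists_nat_gt (max ((k + 2 * r₁) / r₂) ((k / r₁ + 2) / α))
  have hJ1 : k + 2 * r₁ ≤ r₂ * J := by
    have := (le_max_left _ _).trans hJ.le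
    rw [div_le_iff₀ hr₂] at this
    linarith
  have hJ2 : k / r₁ + 2 ≤ α * J := by
    have := (le_max_right _ _).trans hJ.le
    rw [div_le_iff₀ hα] at this
    linarith
  -- A crude bound for the last block: 1 from (A4), and C/K^α from (A5) since |t| ≥ K.
  set D : ℝ := max 1 (C / K ^ α) with hD
  have hD0 : 0 < D := lt_max_of_lt_left one_pos
  -- From N ≤ (J + 1)(m + 1) and m ≥ 1 one gets N ≤ E m, which trades powers of N for powers of m.
  set E : ℝ := 2 * (J + 1) with hE
  have hE0 : 0 < E := by positivity
  have hbd : ∀ M : ℕ, max N₀ N₁ < M → 1 ≤ M → ∀ t : ℝ, K ≤ |t| → ‖L t ^ M‖ ≤ D := by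
    intro M hM hM1 t ht
    have hM1' : (1 : ℝ) ≤ M := by exact_mod_cast hM1
    rcases le_or_gt |t| ((M : ℝ) ^ r₁) with hle | hgt
    · refine (h4 M ((le_max_left _ _).trans_lt hM) t ht hle).trans (le_max_of_le_left ?_)
      rw [div_le_one (by positivity)]
      exact Real.one_le_rpow hM1' hr₂.le
    · refine (h5 M ((le_max_right _ _).trans_lt hM) t hgt).trans (le_max_of_le_right ?_)
      gcongr
  refine ⟨max (C₁ * C₂ * (1 + K ^ 2)) (max (2 * D * E ^ k) (2 * D * E ^ k * C ^ J)),
    lt_max_of_lt_left (by positivity), ?_⟩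
  obtain ⟨M₀, hM₀⟩ := exists_nat_gt (max N₀ N₁)
  filter_upwards [eventually_ge_atTop ((M₀ + 1) * (J + 1))] with N hN t ht
  have hm : M₀ + 1 ≤ N / (J + 1) := (Nat.le_div_iff_mul_le (Nat.succ_pos J)).mpr hN
  set m : ℕ := N / (J + 1) with hm_def
  have hN1 : 1 ≤ N := le_trans (by nlinarith [Nat.zero_le M₀, Nat.zero_le J]) hN
  have hNpos : (0 : ℝ) < N := by exact_mod_cast hN1
  have hm1 : (1 : ℝ) ≤ m := by exact_mod_cast (le_trans (Nat.le_add_left 1 M₀) hm)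
  have hm0 : (0 : ℝ) < m := by linarith
  have hmM : max N₀ N₁ < m := hM₀.trans (by exact_mod_cast hm)
  rw [le_div_iff₀ (by positivity)]
  rcases le_or_gt |t| K with htK | htK
  · refine le_max_of_le_left ?_
    have h1 := hcomp t ⟨ht, htK⟩ N
    have h2 : t ^ 2 ≤ K ^ 2 := sq_le_sq' (by linarith [neg_abs_le t]) ((le_abs_self t).trans htK)
    calc ‖L t ^ N‖ * ((N : ℝ) ^ k * (1 + t ^ 2))
        ≤ (C₁ * θ ^ N) * ((N : ℝ) ^ k * (1 + K ^ 2)) := by gcongr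
      _ = C₁ * ((N : ℝ) ^ k * θ ^ N) * (1 + K ^ 2) := by ring
      _ ≤ C₁ * C₂ * (1 + K ^ 2) := by gcongr; exact hgeo N
  · refine le_max_of_le_right ?_
    have hNE : (N : ℝ) ≤ E * m := by
      have h1 : N < (J + 1) * (m + 1) := by
        rw [hm_def, mul_comm]; exact Nat.lt_mul_of_div_lt (Nat.lt_succ_self _) (Nat.succ_pos J)
      have h2 : (N : ℝ) ≤ (J + 1) * (m + 1) := by exact_mod_cast h1.le
      rw [hE]
      nlinarith [Nat.cast_nonneg (α := ℝ) J]
    have hNk : (N : ℝ) ^ k ≤ E ^ k * (m : ℝ) ^ k := by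
      rw [← mul_pow]; gcongr
    have hblock : ‖L t ^ N‖ ≤ ‖L t ^ m‖ ^ J * D := by
      refine pow_norm_le_of_blocks _ (hbd _ ?_ ?_ t htK.le)
      · push_cast
        have : (0 : ℝ) ≤ (N % (J + 1) : ℕ) := Nat.cast_nonneg _
        linarith
      · omega
    rcases le_or_gt |t| ((m : ℝ) ^ r₁) with hle | hgt
    · refine le_max_of_le_left ?_
      have h1 := h4 m ((le_max_left _ _).trans_lt hmM) t htK.le hle
      have h2 : 1 + t ^ 2 ≤ 2 * (m : ℝ) ^ (2 * r₁) := by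
        have h3 : (1 : ℝ) ≤ (m : ℝ) ^ (2 * r₁) := Real.one_le_rpow hm1 (by positivity)
        have h4 : t ^ 2 ≤ (m : ℝ) ^ (2 * r₁) := by
          rw [mul_comm, Real.rpow_mul hm0.le, Real.rpow_two, ← sq_abs]
          gcongr
        linarith
      have h3 : (m : ℝ) ^ k * (m : ℝ) ^ (2 * r₁) ≤ ((m : ℝ) ^ r₂) ^ J := by
        rw [← Real.rpow_natCast, ← Real.rpow_natCast, ← Real.rpow_mul hm0.le,
          ← Real.rpow_add hm0]
        exact Real.rpow_le_rpow_of_exponent_le hm1 hJ1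
      have h5 : 0 < ((m : ℝ) ^ r₂) ^ J := by positivity
      calc ‖L t ^ N‖ * ((N : ℝ) ^ k * (1 + t ^ 2))
          ≤ ((1 / (m : ℝ) ^ r₂) ^ J * D) * ((E ^ k * (m : ℝ) ^ k) * (2 * (m : ℝ) ^ (2 * r₁))) := by
            refine mul_le_mul (hblock.trans ?_) (mul_le_mul hNk h2 (by positivity) (by positivity))
              (by positivity) (by positivity)
            gcongr
        _ = 2 * D * E ^ k * (((m : ℝ) ^ k * (m : ℝ) ^ (2 * r₁)) / ((m : ℝ) ^ r₂) ^ J) := by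
            rw [div_pow, one_pow]; ring
        _ ≤ 2 * D * E ^ k * 1 := by
            gcongr
            exact (div_le_one h5).mpr h3
        _ = 2 * D * E ^ k := mul_one _
    · refine le_max_of_le_right ?_
      have h1 := h5 m ((le_max_right _ _).trans_lt hmM) t hgt
      have ht1 : 1 ≤ |t| := (Real.one_le_rpow hm1 hr₁.le).trans hgt.le
      have ht0 : 0 < |t| := by linarith
      have h2 : 1 + t ^ 2 ≤ 2 * |t| ^ (2 : ℝ) := by
        rw [Real.rpow_two, sq_abs]
        have : 1 ≤ t ^ 2 := by rw [← sq_abs]; nlinarith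
        linarith
      have hm' : (m : ℝ) ^ k ≤ |t| ^ (k / r₁) := by
        have h3 : (m : ℝ) = ((m : ℝ) ^ r₁) ^ (r₁⁻¹) := by
          rw [← Real.rpow_mul hm0.le, mul_inv_cancel₀ hr₁.ne', Real.rpow_one]
        have h4 : (m : ℝ) ≤ |t| ^ (r₁⁻¹) := by
          rw [h3]
          exact Real.rpow_le_rpow (by positivity) hgt.le (by positivity)
        calc (m : ℝ) ^ k ≤ (|t| ^ (r₁⁻¹)) ^ k := by gcongr
          _ = |t| ^ (k / r₁) := by
            rw [← Real.rpow_natCast, ← Real.rpow_mul ht0.le]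
            congr 1
            rw [div_eq_inv_mul]
      have h3 : |t| ^ (k / r₁) * |t| ^ (2 : ℝ) ≤ (|t| ^ α) ^ J := by
        rw [← Real.rpow_natCast, ← Real.rpow_mul ht0.le, ← Real.rpow_add ht0]
        exact Real.rpow_le_rpow_of_exponent_le ht1 hJ2
      have h6 : 0 < (|t| ^ α) ^ J := by positivity
      calc ‖L t ^ N‖ * ((N : ℝ) ^ k * (1 + t ^ 2))
          ≤ ((C / |t| ^ α) ^ J * D) * ((E ^ k * |t| ^ (k / r₁)) * (2 * |t| ^ (2 : ℝ))) := by
            refine mul_le_mul (hblock.trans ?_)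
              (mul_le_mul (hNk.trans ?_) h2 (by positivity) (by positivity))
              (by positivity) (by positivity)
            · gcongr
            · gcongr
        _ = 2 * D * E ^ k * C ^ J * ((|t| ^ (k / r₁) * |t| ^ (2 : ℝ)) / (|t| ^ α) ^ J) := by
            rw [div_pow]; ring
        _ ≤ 2 * D * E ^ k * C ^ J * 1 := by
            gcongr
            exact (div_le_one h6).mpr h3
        _ = 2 * D * E ^ k * C ^ J := mul_one _

end Decay

/-! ### Symmetry and logarithm of the leading eigenvalue. -/

section Exponent

open Polynomial Asymptotics

/-- Taylor's formula with Peano remainder for a function with `f (-t) = conj (f t)`: the Taylor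
polynomial has real coefficients in the variable `i t`. -/
theorem exists_real_taylor {f : ℝ → ℂ} {n : ℕ} (hf : ContDiffAt ℝ n f 0)
    (hsymm : ∀ᶠ t in 𝓝 (0 : ℝ), f (-t) = (starRingEnd ℂ) (f t)) :
    ∃ p : ℝ[X], (fun t : ℝ => f t - aeval (Complex.I * t) p) =o[𝓝 0] fun t : ℝ => t ^ n := by
  obtain ⟨u, hu, hfu⟩ := hf.contDiffOn le_rfl (by simp)
  obtain ⟨ε, hε, hball⟩ := Metric.mem_nhds_iff.mp hu
  have ht := taylor_isLittleO (convex_ball (0 : ℝ) ε) (Metric.mem_ball_self hε) (hfu.mono hball)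
  rw [Metric.isOpen_ball.nhdsWithin_eq (Metric.mem_ball_self hε)] at ht
  obtain ⟨a, ha⟩ : ∃ a : ℕ → ℂ, (fun t : ℝ => f t - ∑ k ∈ Finset.range (n + 1), a k * (t : ℂ) ^ k)
      =o[𝓝 0] fun t : ℝ => t ^ n := by
    refine ⟨fun k => ((k.factorial : ℝ)⁻¹ : ℝ) * iteratedDerivWithin k f (Metric.ball 0 ε) 0, ?_⟩
    simp only [taylor_within_apply, sub_zero] at ht
    refine ht.congr_left fun t => ?_
    congr 1
    refine Finset.sum_congr rfl fun k _ => ?_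
    rw [Complex.real_smul]
    push_cast
    ring
  -- Averaging the expansion at t with the conjugate of the one at -t replaces a_k / i^k by its real
  -- part, while the symmetry leaves f unchanged.
  refine ⟨∑ k ∈ Finset.range (n + 1), C ((a k / Complex.I ^ k).re) * X ^ k, ?_⟩
  have ha' : (fun t : ℝ => (starRingEnd ℂ)
      (f (-t) - ∑ k ∈ Finset.range (n + 1), a k * ((-t : ℝ) : ℂ) ^ k)) =o[𝓝 0]
        fun t : ℝ => t ^ n := by
    have hneg : Tendsto (fun t : ℝ => -t) (𝓝 0) (𝓝 0) := by
      simpa using (continuous_neg (G := ℝ)).tendsto 0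
    have h1 := ha.comp_tendsto hneg
    refine IsLittleO.of_norm_left ?_
    simp only [RCLike.norm_conj]
    refine h1.norm_left.trans_isBigO (IsBigO.of_norm_eventuallyLE
      (Eventually.of_forall fun t => ?_)).of_norm_right
    simp only [Function.comp_apply, norm_pow, norm_neg, le_refl]
  refine ((ha.add ha').const_mul_left (1 / 2 : ℂ)).congr' ?_ (Eventually.of_forall fun t => rfl)
  filter_upwards [hsymm] with t ht
  rw [ht]
  simp only [map_sub, Complex.conj_conj, map_sum, map_mul, map_pow, Complex.conj_ofReal, aeval_C,
    aeval_X]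
  have hterm : ∀ k, (algebraMap ℝ ℂ) ((a k / Complex.I ^ k).re) * (Complex.I * t) ^ k
      = 1 / 2 * (a k * (t : ℂ) ^ k + (starRingEnd ℂ) (a k) * ((-t : ℝ) : ℂ) ^ k) := by
    intro k
    have hI : Complex.I ^ k ≠ 0 := pow_ne_zero _ Complex.I_ne_zero
    set b := a k / Complex.I ^ k with hb
    have hab : a k = b * Complex.I ^ k := by rw [hb, div_mul_cancel₀ _ hI]
    rw [hab]
    have hre : (algebraMap ℝ ℂ) b.re = (b + (starRingEnd ℂ) b) / 2 := by
      rw [Complex.add_conj]; simp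
    rw [hre, map_mul, map_pow, Complex.conj_I]
    push_cast
    rw [mul_pow, mul_assoc _ ((-Complex.I) ^ k), ← mul_pow (-Complex.I), neg_mul_neg, mul_pow]
    ring
  simp only [hterm, ← Finset.mul_sum, Finset.sum_add_distrib]
  ring

theorem tendsto_div_pow_of_norm_sub_le {a : ℕ → ℂ} {m z : ℂ} {C θ : ℝ} (hθ0 : 0 < θ)
    (hm : θ < ‖m‖) (h : ∀ N : ℕ, 1 ≤ N → ‖a N - m ^ N * z‖ ≤ C * θ ^ N) :
    Tendsto (fun N => a N / m ^ N) atTop (𝓝 z) := by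
  have hm0 : 0 < ‖m‖ := hθ0.trans hm
  rw [tendsto_iff_norm_sub_tendsto_zero]
  have hlim : Tendsto (fun N : ℕ => C * (θ / ‖m‖) ^ N) atTop (𝓝 0) := by
    have := (tendsto_pow_atTop_nhds_zero_of_lt_one (r := θ / ‖m‖) (by positivity)
      ((div_lt_one hm0).mpr hm)).const_mul C
    simpa using this
  refine squeeze_zero' (Eventually.of_forall fun N => norm_nonneg _) ?_ hlim
  filter_upwards [eventually_ge_atTop 1] with N hN
  have hmN : m ^ N ≠ 0 := pow_ne_zero _ (norm_pos_iff.mp hm0)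
  have : a N / m ^ N - z = (a N - m ^ N * z) / m ^ N := by field_simp
  rw [this, norm_div, norm_pow, div_pow, ← mul_div_assoc]
  gcongr
  exact h N hN

/-- Recovers the eigenvalue from the sequence alone, so that symmetries of the characteristic
functions pass to μ. -/
theorem tendsto_ratio_of_norm_sub_le {a : ℕ → ℂ} {m z : ℂ} {C θ : ℝ} (hθ0 : 0 < θ)
    (hm : θ < ‖m‖) (hz : z ≠ 0) (h : ∀ N : ℕ, 1 ≤ N → ‖a N - m ^ N * z‖ ≤ C * θ ^ N) :
    Tendsto (fun N => a (N + 1) / a N) atTop (𝓝 m) := by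
  have hm0 : m ≠ 0 := norm_pos_iff.mp (hθ0.trans hm)
  have h1 := tendsto_div_pow_of_norm_sub_le hθ0 hm h
  have h2 := (((tendsto_add_atTop_iff_nat 1).mpr h1).div h1 hz).mul_const m
  rw [div_self hz, one_mul] at h2
  refine h2.congr fun N => ?_
  simp only [Pi.div_apply]
  rw [pow_succ]
  -- When a N vanishes, both sides are 0 by the convention for division.
  by_cases haN : a N = 0
  · simp [haN]
  · field_simp

/-- The family of functions `Φ N`, given near the origin by powers of `μ`, consists of functions
that share the basic properties of characteristic functions. -/
theorem symm_of_norm_sub_le {Φ : ℕ → ℝ → ℂ} (h1 : ∀ N, 1 ≤ N → ∀ t, ‖Φ N t‖ ≤ 1)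
    (h2 : ∀ N, 1 ≤ N → ∀ t, Φ N (-t) = (starRingEnd ℂ) (Φ N t)) (h3 : ∀ N, 1 ≤ N → Φ N 0 = 1)
    {μ Z : ℝ → ℂ} (hμ : ContinuousAt μ 0) (hZ : ContinuousAt Z 0) (hμ0 : μ 0 = 1) {C θ : ℝ}
    (hθ0 : 0 < θ) (hθ1 : θ < 1)
    (happ : ∀ᶠ t in 𝓝 (0 : ℝ), ∀ N : ℕ, 1 ≤ N → ‖Φ N t - μ t ^ N * Z t‖ ≤ C * θ ^ N) :
    Z 0 = 1 ∧ (∀ᶠ t in 𝓝 (0 : ℝ), μ (-t) = (starRingEnd ℂ) (μ t)) ∧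
      (∀ᶠ t in 𝓝 (0 : ℝ), Z (-t) = (starRingEnd ℂ) (Z t)) ∧ ∀ᶠ t in 𝓝 (0 : ℝ), ‖μ t‖ ≤ 1 := by
  have hZ0 : Z 0 = 1 := by
    have h := tendsto_div_pow_of_norm_sub_le (m := μ 0) hθ0 (by simpa [hμ0] using hθ1)
      happ.self_of_nhds
    refine tendsto_nhds_unique h (tendsto_const_nhds.congr' ?_)
    filter_upwards [eventually_ge_atTop 1] with N hN
    rw [h3 N hN, hμ0, one_pow, div_one]
  have e1 : ∀ᶠ t in 𝓝 (0 : ℝ), θ < ‖μ t‖ :=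
    hμ.norm.eventually (lt_mem_nhds (by simpa [hμ0] using hθ1))
  have e2 : ∀ᶠ t in 𝓝 (0 : ℝ), Z t ≠ 0 := hZ.eventually_ne (by simp [hZ0])
  have hall := (happ.and e1).and e2
  have hneg : Tendsto (fun t : ℝ => -t) (𝓝 0) (𝓝 0) := by
    simpa using (continuous_neg (G := ℝ)).tendsto 0
  have hall' := hneg.eventually hall
  have hμs : ∀ᶠ t in 𝓝 (0 : ℝ), μ (-t) = (starRingEnd ℂ) (μ t) := by
    filter_upwards [hall, hall'] with t ⟨⟨a, b⟩, c⟩ ⟨⟨a', b'⟩, c'⟩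
    have l1 := (Complex.continuous_conj.tendsto _).comp (tendsto_ratio_of_norm_sub_le hθ0 b c a)
    have l2 := tendsto_ratio_of_norm_sub_le hθ0 b' c' a'
    refine tendsto_nhds_unique l2 (l1.congr' ?_)
    filter_upwards [eventually_ge_atTop 1] with N hN
    rw [Function.comp_apply, map_div₀, h2 N hN, h2 (N + 1) (by omega)]
  refine ⟨hZ0, hμs, ?_, ?_⟩
  · filter_upwards [hall, hall', hμs] with t ⟨⟨a, b⟩, c⟩ ⟨⟨a', b'⟩, c'⟩ hs
    have l1 := (Complex.continuous_conj.tendsto _).comp (tendsto_div_pow_of_norm_sub_le hθ0 b a)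
    have l2 := tendsto_div_pow_of_norm_sub_le hθ0 b' a'
    refine tendsto_nhds_unique l2 (l1.congr' ?_)
    filter_upwards [eventually_ge_atTop 1] with N hN
    rw [Function.comp_apply, map_div₀, map_pow, h2 N hN, hs]
  · filter_upwards [hall] with t ⟨⟨a, b⟩, c⟩
    -- If |μ(t)| > 1, the term μ^N Z would grow without bound, since Z(t) ≠ 0, while Φ_N is at most
    -- 1 and the error at most |C|.
    by_contra! hgt
    have hz : 0 < ‖Z t‖ := norm_pos_iff.mpr c
    obtain ⟨N, hN⟩ := pow_unbounded_of_one_lt ((1 + |C|) / ‖Z t‖) hgt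
    rw [div_lt_iff₀ hz] at hN
    have hN' : 1 + |C| < ‖μ t‖ ^ (N + 1) * ‖Z t‖ := hN.trans_le
      (mul_le_mul_of_nonneg_right (pow_le_pow_right₀ hgt.le (Nat.le_succ N)) hz.le)
    have h4 := a (N + 1) (by omega)
    have h5 := h1 (N + 1) (by omega) t
    have h6 : ‖μ t ^ (N + 1) * Z t‖ ≤ ‖Φ (N + 1) t‖ + ‖Φ (N + 1) t - μ t ^ (N + 1) * Z t‖ := by
      have := norm_sub_le (Φ (N + 1) t) (Φ (N + 1) t - μ t ^ (N + 1) * Z t)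
      simpa using this
    rw [norm_mul, norm_pow] at h6
    have h7 : C * θ ^ (N + 1) ≤ |C| :=
      (mul_le_mul_of_nonneg_right (le_abs_self C) (by positivity)).trans
        (mul_le_of_le_one_right (abs_nonneg C) (pow_le_one₀ hθ0.le hθ1.le))
    linarith

/-- The expansion of the leading eigenvalue in exponential form. -/
theorem exists_exponent {μ : ℝ → ℂ} {r : ℕ} (hμ : ContDiffAt ℝ (r + 2 : ℕ) μ 0) (hμ0 : μ 0 = 1)
    (hsymm : ∀ᶠ t in 𝓝 (0 : ℝ), μ (-t) = (starRingEnd ℂ) (μ t))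
    (hle : ∀ᶠ t in 𝓝 (0 : ℝ), ‖μ t‖ ≤ 1) :
    ∃ (A V : ℝ) (p : ℝ[X]) (χ : ℝ → ℂ), 0 ≤ V ∧ p.coeff 0 = 0 ∧
      ((fun u : ℝ => χ u - aeval (Complex.I * u) p) =o[𝓝 0] fun u : ℝ => u ^ r) ∧
      ∀ᶠ u in 𝓝 (0 : ℝ), μ u =
        Complex.exp (Complex.I * A * u - V / 2 * (u : ℂ) ^ 2 + (u : ℂ) ^ 2 * χ u) := by
  have hslit : ∀ᶠ t in 𝓝 (0 : ℝ), μ t ∈ Complex.slitPlane :=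
    hμ.continuousAt.eventually (Complex.isOpen_slitPlane.mem_nhds (by simp [hμ0]))
  have hg : ContDiffAt ℝ (r + 2 : ℕ) (fun t => Complex.log (μ t)) 0 := by
    have h1 : ContDiffAt ℝ (r + 2 : ℕ) Complex.log (μ 0) :=
      (Complex.contDiffAt_log (by simp [hμ0])).restrict_scalars ℝ
    exact h1.comp (0 : ℝ) hμ
  have hgs : ∀ᶠ t in 𝓝 (0 : ℝ), Complex.log (μ (-t)) = (starRingEnd ℂ) (Complex.log (μ t)) := by
    filter_upwards [hsymm, hslit] with t h1 h2
    rw [h1, Complex.log_conj _ (Complex.slitPlane_arg_ne_pi h2)]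
  obtain ⟨P, hP⟩ := exists_real_taylor hg hgs
  have hP0 : P.coeff 0 = 0 := by
    have h := (hP.bound (c := 1) one_pos).self_of_nhds
    simp only [hμ0, Complex.log_one, Complex.ofReal_zero, mul_zero, zero_sub, norm_neg,
      zero_pow (Nat.succ_ne_zero (r + 1)), norm_zero, norm_le_zero_iff] at h
    rw [aeval_def, eval₂_at_zero] at h
    simpa using h
  -- P(y) = A y + P₂ y² + y³ q(y). At y = iu the middle term is -V u²/2 and the last is u² times -y
  -- q(y), hence the choice -(X q) below.
  set q := P.divX.divX.divX with hq
  set A := P.coeff 1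
  set V := 2 * P.coeff 2 with hV
  have hPq : ∀ y : ℂ, aeval y P = y * A + y ^ 2 * P.coeff 2 + y ^ 3 * aeval y q := by
    intro y
    have e1 : P = ((q * X + C (P.coeff 2)) * X + C (P.coeff 1)) * X + C (P.coeff 0) := by
      have a3 : q * X + C (P.coeff 2) = P.divX.divX := by
        simpa [hq, coeff_divX] using divX_mul_X_add P.divX.divX
      have a2 : P.divX.divX * X + C (P.coeff 1) = P.divX := by
        simpa [coeff_divX] using divX_mul_X_add P.divX
      rw [a3, a2, divX_mul_X_add]
    conv_lhs => rw [e1, hP0]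
    simp only [map_add, map_mul, aeval_X, aeval_C, map_zero]
    simp only [Complex.coe_algebraMap]
    ring
  set num : ℝ → ℂ := fun u => Complex.log (μ u) - Complex.I * A * u + V / 2 * (u : ℂ) ^ 2 with hnum
  -- At u = 0 division gives χ(0) = 0, which agrees with the limit.
  set χ : ℝ → ℂ := fun u => num u / (u : ℂ) ^ 2 with hχ
  have hnum0 : num 0 = 0 := by simp [hnum, hμ0]
  have hmul : ∀ u : ℝ, (u : ℂ) ^ 2 * χ u = num u := by
    intro u
    by_cases hu : u = 0
    · subst hu; simp [hnum0]
    · have : (u : ℂ) ^ 2 ≠ 0 := by simpa using hu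
      rw [hχ]
      exact mul_div_cancel₀ _ this
  have hdiff : ∀ u : ℝ, (u : ℂ) ^ 2 * (χ u - aeval (Complex.I * u) (-(X * q)))
      = Complex.log (μ u) - aeval (Complex.I * u) P := by
    intro u
    rw [mul_sub, hmul, hPq]
    simp only [hnum, hV, map_neg, map_mul, aeval_X, mul_pow, Complex.I_sq]
    have hI3 : Complex.I ^ 3 = -Complex.I := Complex.I_pow_three
    rw [hI3]
    push_cast
    ring
  have hχo : (fun u : ℝ => χ u - aeval (Complex.I * u) (-(X * q))) =o[𝓝 0] fun u : ℝ => u ^ r := by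
    rw [isLittleO_iff]
    intro c hc
    filter_upwards [hP.bound hc] with u hu
    by_cases hu0 : u = 0
    · subst hu0
      simp only [hχ, hnum0, Complex.ofReal_zero, zero_div, mul_zero, map_neg, map_mul, aeval_X,
        zero_mul, neg_zero, sub_zero, norm_zero]
      positivity
    · rw [← hdiff, norm_mul, norm_pow, Complex.norm_real, norm_pow, pow_add] at hu
      have hu2 : 0 < ‖u‖ ^ 2 := by positivity
      rw [norm_pow]
      nlinarith
  refine ⟨A, V, -(X * q), χ, ?_, by simp, hχo, ?_⟩
  · have hχ0 : Tendsto χ (𝓝 0) (𝓝 0) := by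
      have h1 : Tendsto (fun u : ℝ => χ u - aeval (Complex.I * u) (-(X * q))) (𝓝 0) (𝓝 0) := by
        have hO : (fun u : ℝ => u ^ r) =O[𝓝 0] fun _ : ℝ => (1 : ℝ) :=
          (continuous_pow r).continuousAt.norm.isBoundedUnder_le.isBigO_one ℝ
        exact (isLittleO_one_iff ℝ).mp (hχo.trans_isBigO hO)
      have h2 : Tendsto (fun u : ℝ => aeval (Complex.I * u) (-(X * q))) (𝓝 0) (𝓝 0) := by
        have h3 : Continuous fun u : ℝ => aeval (Complex.I * (u : ℂ)) (-(X * q)) := by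
          have : Continuous fun y : ℂ => aeval y (-(X * q)) := Polynomial.continuous_aeval _
          exact this.comp (by fun_prop)
        have h4 := h3.tendsto 0
        simpa using h4
      simpa using h1.add h2
    -- |μ| ≤ 1 reads Re χ ≤ V/2 off the origin; letting u → 0, where χ → 0, yields V ≥ 0.
    have hre : ∀ᶠ u in 𝓝[≠] (0 : ℝ), (χ u).re ≤ V / 2 := by
      filter_upwards [nhdsWithin_le_nhds hle, nhdsWithin_le_nhds hslit, self_mem_nhdsWithin]
        with u h1 h2 hu
      have h3 : (Complex.log (μ u)).re ≤ 0 := by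
        rw [Complex.log_re]
        exact Real.log_nonpos (norm_nonneg _) h1
      have h4 := congrArg Complex.re (hmul u)
      have h5 : ((u : ℂ) ^ 2 * χ u).re = u ^ 2 * (χ u).re := by
        rw [← Complex.ofReal_pow, Complex.re_ofReal_mul]
      have h6 : (num u).re = (Complex.log (μ u)).re + V / 2 * u ^ 2 := by
        have e : num u = Complex.log (μ u) - Complex.I * ((A * u : ℝ) : ℂ)
            + ((V / 2 * u ^ 2 : ℝ) : ℂ) := by
          simp only [hnum]; push_cast; ring
        rw [e, Complex.add_re, Complex.sub_re, Complex.I_mul_re, Complex.ofReal_re,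
          Complex.ofReal_im]
        ring
      rw [h5, h6] at h4
      have hu2 : 0 < u ^ 2 := by
        have : u ≠ 0 := hu
        positivity
      nlinarith
    have hlim : Tendsto (fun u => (χ u).re) (𝓝[≠] (0 : ℝ)) (𝓝 0) := by
      have := (Complex.continuous_re.tendsto 0).comp
        (hχ0.mono_left (nhdsWithin_le_nhds (s := {0}ᶜ)))
      simpa [Function.comp_def] using this
    have := le_of_tendsto hlim hre
    linarith
  · filter_upwards [hslit] with u hu
    rw [hmul]
    have : Complex.I * A * u - V / 2 * (u : ℂ) ^ 2 + num u = Complex.log (μ u) := by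
      simp only [hnum]; ring
    rw [this, Complex.exp_log (Complex.slitPlane_ne_zero hu)]

end Exponent

/-! ### Expansion of the correction factor near 0. -/

section NearZero

open Polynomial Asymptotics

theorem exists_aeval_eq_trunc_add {R : Type*} [CommRing R] [Algebra ℝ R] (n : ℕ) (g : ℝ[X]) :
    ∃ h : ℝ[X], ∀ y : R, aeval y g
      = ∑ j ∈ Finset.range n, algebraMap ℝ R (g.coeff j) * y ^ j + y ^ n * aeval y h := by
  induction n generalizing g with
  | zero => exact ⟨g, fun y => by simp⟩
  | succ n ih =>
    obtain ⟨h, hh⟩ := ih g.divX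
    refine ⟨h, fun y => ?_⟩
    conv_lhs => rw [← divX_mul_X_add g]
    rw [Finset.sum_range_succ', map_add, map_mul, aeval_X, aeval_C, hh y, add_mul, Finset.sum_mul]
    simp only [coeff_divX, pow_zero, mul_one]
    have : ∀ j, algebraMap ℝ R (g.coeff (j + 1)) * y ^ j * y
        = algebraMap ℝ R (g.coeff (j + 1)) * y ^ (j + 1) := fun j => by ring
    simp only [this]
    ring

theorem continuous_aeval_I_mul (g : ℝ[X]) : Continuous fun u : ℝ => aeval (Complex.I * u) g :=
  (Polynomial.continuous_aeval (A := ℂ) g).comp (by fun_prop)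

theorem isLittleO_aeval_sub_trunc (r : ℕ) (g : ℝ[X]) :
    (fun u : ℝ => aeval (Complex.I * u) g -
      ∑ j ∈ Finset.range (r + 1), (g.coeff j : ℂ) * (Complex.I * u) ^ j) =o[𝓝 0]
      fun u : ℝ => u ^ r := by
  obtain ⟨h, hh⟩ := exists_aeval_eq_trunc_add (R := ℂ) (r + 1) g
  have h1 : (fun u : ℝ => aeval (Complex.I * u) h) =O[𝓝 0] fun _ : ℝ => (1 : ℝ) :=
    (continuous_aeval_I_mul h).continuousAt.norm.isBoundedUnder_le.isBigO_one ℝ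
  have h2 : (fun u : ℝ => (Complex.I * (u : ℂ)) ^ (r + 1)) =o[𝓝 0] fun u : ℝ => u ^ r := by
    have : (fun u : ℝ => u ^ (r + 1)) =o[𝓝 0] fun u : ℝ => u ^ r :=
      isLittleO_pow_pow (Nat.lt_succ_self r)
    refine IsLittleO.of_norm_left ?_
    simp only [norm_pow, norm_mul, Complex.norm_I, one_mul, Complex.norm_real]
    simpa only [norm_pow] using this.norm_left
  have h3 := h2.mul_isBigO h1
  simp only [mul_one] at h3
  refine h3.congr_left fun u => ?_
  rw [hh]
  simp

/-- The polynomials `R_j(w) = ∑_k [y^j](p(y)^k q(y)) w^k / k!`, the coefficients of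
`exp (w p(y)) q(y)`. -/
noncomputable def expCoeff (p q : ℝ[X]) (r j : ℕ) : ℝ[X] :=
  ∑ k ∈ Finset.range (r + 1), C ((p ^ k * q).coeff j / k.factorial) * X ^ k

theorem eval_expCoeff (p q : ℝ[X]) (r j : ℕ) (w : ℝ) :
    (expCoeff p q r j).eval w
      = ∑ k ∈ Finset.range (r + 1), (p ^ k * q).coeff j / k.factorial * w ^ k := by
  simp [expCoeff, eval_finsetSum]

theorem norm_exp_sub_exp_le (x y : ℂ) :
    ‖Complex.exp x - Complex.exp y‖ ≤ ‖x - y‖ * Real.exp (‖y‖ + ‖x - y‖) := by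
  have h1 : Complex.exp x - Complex.exp y = Complex.exp y * (Complex.exp (x - y) - 1) := by
    rw [mul_sub, ← Complex.exp_add]; ring_nf
  have h2 := Complex.norm_exp_sub_sum_le_norm_mul_exp (x - y) 1
  simp only [Finset.range_one, Finset.sum_singleton, pow_zero, Nat.factorial_zero, Nat.cast_one,
    div_one, pow_one] at h2
  rw [h1, norm_mul, Real.exp_add]
  have h3 := Complex.norm_exp_le_exp_norm y
  calc _ ≤ Real.exp ‖y‖ * (‖x - y‖ * Real.exp ‖x - y‖) :=
        mul_le_mul h3 h2 (norm_nonneg _) (Real.exp_pos _).le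
    _ = _ := by ring

/-- The expansion of `exp (w χ(u)) Z(u)` in powers of `u`, with an error that is uniform in `w`. -/
theorem eventually_norm_exp_mul_sub_le {χ Z : ℝ → ℂ} {p q : ℝ[X]} {r : ℕ} (hp0 : p.coeff 0 = 0)
    (hχ : (fun u : ℝ => χ u - aeval (Complex.I * u) p) =o[𝓝 0] fun u : ℝ => u ^ r)
    (hZ : (fun u : ℝ => Z u - aeval (Complex.I * u) q) =o[𝓝 0] fun u : ℝ => u ^ r)
    {a : ℝ} (ha : 0 < a) {ε : ℝ} (hε : 0 < ε) :
    ∀ᶠ u in 𝓝 (0 : ℝ), ∀ w : ℝ, 0 ≤ w →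
      ‖Complex.exp (w * χ u) * Z u -
        ∑ j ∈ Finset.range (r + 1), (Complex.I * u) ^ j * ((expCoeff p q r j).eval w : ℝ)‖
      ≤ ε * |u| ^ r * ((1 + w) ^ (r + 1) * Real.exp (a * w)) := by
  have hone : (fun u : ℝ => u ^ r) =O[𝓝 0] fun _ : ℝ => (1 : ℝ) :=
    (continuous_pow r).continuousAt.norm.isBoundedUnder_le.isBigO_one ℝ
  set P : ℝ → ℂ := fun u => aeval (Complex.I * u) p with hP
  set Q : ℝ → ℂ := fun u => aeval (Complex.I * u) q with hQ
  have hPc : Tendsto P (𝓝 0) (𝓝 0) := by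
    have h := (continuous_aeval_I_mul p).tendsto 0
    have h0 : aeval (Complex.I * ((0 : ℝ) : ℂ)) p = 0 := by
      rw [Complex.ofReal_zero, mul_zero, aeval_def, eval₂_at_zero, hp0, map_zero]
    rwa [h0] at h
  set M : ℝ := ‖Q 0‖ + 1 with hM
  have hM0 : 0 < M := by positivity
  have hQc : Tendsto Q (𝓝 0) (𝓝 (Q 0)) := (continuous_aeval_I_mul q).tendsto 0
  have hχP : Tendsto (fun u => χ u - P u) (𝓝 0) (𝓝 0) :=
    (isLittleO_one_iff ℝ).mp (hχ.trans_isBigO hone)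
  have hZc : Tendsto Z (𝓝 0) (𝓝 (Q 0)) := by
    have h1 : Tendsto (fun u => Z u - Q u) (𝓝 0) (𝓝 0) :=
      (isLittleO_one_iff ℝ).mp (hZ.trans_isBigO hone)
    simpa using h1.add hQc
  have hPo : (fun u : ℝ => P u ^ (r + 1)) =o[𝓝 0] fun u : ℝ => u ^ r := by
    obtain ⟨h, hh⟩ := exists_aeval_eq_trunc_add (R := ℂ) 1 p
    have hPO : P =O[𝓝 0] fun u : ℝ => u := by
      have h1 : (fun u : ℝ => aeval (Complex.I * u) h) =O[𝓝 0] fun _ : ℝ => (1 : ℝ) :=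
        (continuous_aeval_I_mul h).continuousAt.norm.isBoundedUnder_le.isBigO_one ℝ
      have h2 : (fun u : ℝ => Complex.I * (u : ℂ)) =O[𝓝 0] fun u : ℝ => u :=
        IsBigO.of_norm_eventuallyLE (Eventually.of_forall fun u => by simp) |>.of_norm_right
      have h3 := h2.mul h1
      simp only [mul_one] at h3
      refine h3.congr_left fun u => ?_
      rw [hP]
      simp only [hh, Finset.range_one, Finset.sum_singleton, hp0, map_zero, zero_mul, zero_add,
        pow_one]
    exact (hPO.pow (r + 1)).trans_isLittleO (isLittleO_pow_pow (Nat.lt_succ_self r))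
  -- The four errors below cost M, 1, M and r + 1 multiples of η.
  set η : ℝ := ε / (2 * M + r + 2) with hη
  have hη0 : 0 < η := by positivity
  have htr : ∀ᶠ u in 𝓝 (0 : ℝ), ∀ k ∈ Finset.range (r + 1),
      ‖P u ^ k * Q u - ∑ j ∈ Finset.range (r + 1),
        ((p ^ k * q).coeff j : ℂ) * (Complex.I * u) ^ j‖ ≤ η * |u| ^ r := by
    rw [Filter.eventually_all_finset]
    intro k _
    have h1 := (isLittleO_aeval_sub_trunc r (p ^ k * q)).bound hη0
    filter_upwards [h1] with u hu
    simpa [hP, hQ] using hu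
  filter_upwards [hχ.bound hη0, hZ.bound hη0, hPo.bound hη0, htr,
    hPc.norm.eventually (gt_mem_nhds (show ‖(0 : ℂ)‖ < a / 2 by simpa using ha)),
    hχP.norm.eventually (gt_mem_nhds (show ‖(0 : ℂ)‖ < a / 2 by simpa using ha)),
    hZc.norm.eventually (gt_mem_nhds (show ‖Q 0‖ < M by linarith)),
    hQc.norm.eventually (gt_mem_nhds (show ‖Q 0‖ < M by linarith))]
    with u h1 h2 h3 h4 h5 h6 h7 h8 w hw
  rw [norm_pow, Real.norm_eq_abs] at h1 h2
  rw [norm_pow, norm_pow, Real.norm_eq_abs] at h3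
  set G : ℝ := (1 + w) ^ (r + 1) * Real.exp (a * w) with hG
  have hw1 : 1 ≤ 1 + w := by linarith
  have hGe : ∀ (k : ℕ) (b : ℝ), k ≤ r + 1 → b ≤ a * w → w ^ k * Real.exp b ≤ G := by
    intro k b hk hb
    refine mul_le_mul ?_ (Real.exp_le_exp.mpr hb) (Real.exp_pos _).le (by positivity)
    exact (pow_le_pow_left₀ hw (by linarith) k).trans (pow_le_pow_right₀ hw1 hk)
  have hηu : 0 ≤ η * |u| ^ r := by positivity
  -- The errors come from replacing χ by P, replacing Z by Q, cutting the exponential series after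
  -- order r (P is O(u)), and truncating each P^k Q at degree r. Both ‖P‖ and ‖χ - P‖ are below a/2,
  -- so no exponent exceeds a w.
  have hdecomp : Complex.exp (w * χ u) * Z u -
        ∑ j ∈ Finset.range (r + 1), (Complex.I * u) ^ j * ((expCoeff p q r j).eval w : ℝ)
      = (Complex.exp (w * χ u) - Complex.exp (w * P u)) * Z u + Complex.exp (w * P u) * (Z u - Q u)
        + (Complex.exp (w * P u) -
            ∑ k ∈ Finset.range (r + 1), (w * P u) ^ k / (k.factorial : ℂ)) * Q u
        + ∑ k ∈ Finset.range (r + 1), ((w ^ k / k.factorial : ℝ) : ℂ) *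
          (P u ^ k * Q u - ∑ j ∈ Finset.range (r + 1),
            ((p ^ k * q).coeff j : ℂ) * (Complex.I * u) ^ j) := by
    have e1 : ∑ j ∈ Finset.range (r + 1), (Complex.I * u) ^ j * ((expCoeff p q r j).eval w : ℝ)
        = ∑ k ∈ Finset.range (r + 1), ((w ^ k / k.factorial : ℝ) : ℂ) *
          ∑ j ∈ Finset.range (r + 1), ((p ^ k * q).coeff j : ℂ) * (Complex.I * u) ^ j := by
      simp only [eval_expCoeff, Complex.ofReal_sum, Finset.mul_sum]
      rw [Finset.sum_comm]
      refine Finset.sum_congr rfl fun k _ => Finset.sum_congr rfl fun j _ => ?_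
      push_cast
      ring
    have e2 : ∑ k ∈ Finset.range (r + 1), ((w ^ k / k.factorial : ℝ) : ℂ) * (P u ^ k * Q u)
        = (∑ k ∈ Finset.range (r + 1), (w * P u) ^ k / (k.factorial : ℂ)) * Q u := by
      rw [Finset.sum_mul]
      refine Finset.sum_congr rfl fun k _ => ?_
      push_cast
      ring
    simp only [mul_sub, Finset.sum_sub_distrib]
    rw [e1, e2]
    ring
  have hwn : ‖(w : ℂ)‖ = w := by rw [Complex.norm_real, Real.norm_of_nonneg hw]
  have t1 : ‖(Complex.exp (w * χ u) - Complex.exp (w * P u)) * Z u‖ ≤ M * (η * |u| ^ r) * G := by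
    rw [norm_mul]
    have h9 := norm_exp_sub_exp_le (w * χ u) (w * P u)
    rw [← mul_sub, norm_mul, norm_mul, hwn] at h9
    calc _ ≤ (w * ‖χ u - P u‖ * Real.exp (w * ‖P u‖ + w * ‖χ u - P u‖)) * M :=
          mul_le_mul h9 h7.le (norm_nonneg _) (by positivity)
      _ = M * ‖χ u - P u‖ * (w ^ 1 * Real.exp (w * ‖P u‖ + w * ‖χ u - P u‖)) := by ring
      _ ≤ M * (η * |u| ^ r) * G := by
          refine mul_le_mul (mul_le_mul_of_nonneg_left h1 hM0.le) (hGe 1 _ (by omega) ?_)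
            (by positivity) (by positivity)
          nlinarith
  have hexp : ‖Complex.exp (w * P u)‖ ≤ G := by
    refine (Complex.norm_exp_le_exp_norm _).trans ?_
    rw [norm_mul, hwn]
    have := hGe 0 (w * ‖P u‖) (by omega) (by nlinarith)
    simpa using this
  have t2 : ‖Complex.exp (w * P u) * (Z u - Q u)‖ ≤ (η * |u| ^ r) * G := by
    rw [norm_mul, mul_comm]
    exact mul_le_mul h2 hexp (norm_nonneg _) hηu
  have t3 : ‖(Complex.exp (w * P u) -
      ∑ k ∈ Finset.range (r + 1), (w * P u) ^ k / (k.factorial : ℂ)) * Q u‖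
      ≤ M * (η * |u| ^ r) * G := by
    rw [norm_mul]
    have h9 := Complex.norm_exp_sub_sum_le_norm_mul_exp (w * P u) (r + 1)
    rw [norm_mul, hwn, mul_pow] at h9
    calc _ ≤ (w ^ (r + 1) * ‖P u‖ ^ (r + 1) * Real.exp (w * ‖P u‖)) * M :=
          mul_le_mul h9 h8.le (norm_nonneg _) (by positivity)
      _ = M * ‖P u‖ ^ (r + 1) * (w ^ (r + 1) * Real.exp (w * ‖P u‖)) := by ring
      _ ≤ M * (η * |u| ^ r) * G := by
          refine mul_le_mul (mul_le_mul_of_nonneg_left h3 hM0.le) (hGe _ _ le_rfl (by nlinarith))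
            (by positivity) (by positivity)
  have t4 : ‖∑ k ∈ Finset.range (r + 1), ((w ^ k / k.factorial : ℝ) : ℂ) *
      (P u ^ k * Q u - ∑ j ∈ Finset.range (r + 1),
        ((p ^ k * q).coeff j : ℂ) * (Complex.I * u) ^ j)‖ ≤ (r + 1) * (η * |u| ^ r) * G := by
    calc _ ≤ ∑ k ∈ Finset.range (r + 1), G * (η * |u| ^ r) := by
          refine norm_sum_le_of_le _ fun k hk => ?_
          rw [norm_mul, Complex.norm_real, Real.norm_of_nonneg (by positivity)]
          refine mul_le_mul ?_ (h4 k hk) (norm_nonneg _) (by positivity)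
          have h10 := hGe k 0 (by have := Finset.mem_range.mp hk; omega) (by positivity)
          rw [Real.exp_zero, mul_one] at h10
          refine le_trans (div_le_self (by positivity) ?_) h10
          exact_mod_cast Nat.succ_le_of_lt (Nat.factorial_pos k)
      _ = (r + 1) * (η * |u| ^ r) * G := by
          rw [Finset.sum_const, Finset.card_range, nsmul_eq_mul]; push_cast; ring
  rw [hdecomp]
  refine ((norm_add_le _ _).trans (add_le_add ((norm_add_le _ _).trans (add_le_add
    ((norm_add_le _ _).trans (add_le_add t1 t2)) t3)) t4)).trans (le_of_eq ?_)
  have : ε = η * (2 * M + r + 2) := by rw [hη]; field_simp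
  rw [this]
  ring

end NearZero

/-! ### L¹ convergence of the rescaled characteristic functions. -/

section FourierConvergence

open Polynomial Asymptotics

theorem exists_abs_eval_le (g : ℝ[X]) :
    ∃ C : ℝ, 0 ≤ C ∧ ∀ w : ℝ, 0 ≤ w → |g.eval w| ≤ C * (1 + w) ^ g.natDegree := by
  refine ⟨∑ k ∈ Finset.range (g.natDegree + 1), |g.coeff k|,
    Finset.sum_nonneg fun _ _ => abs_nonneg _, fun w hw => ?_⟩
  rw [eval_eq_sum_range, Finset.sum_mul]
  refine (Finset.abs_sum_le_sum_abs _ _).trans (Finset.sum_le_sum fun k hk => ?_)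
  rw [abs_mul, abs_pow, abs_of_nonneg hw]
  refine mul_le_mul_of_nonneg_left ?_ (abs_nonneg _)
  exact (pow_le_pow_left₀ hw (by linarith) k).trans
    (pow_le_pow_right₀ (by linarith) (Nat.lt_succ_iff.mp (Finset.mem_range.mp hk)))

/-- Half of the Gaussian absorbs the polynomial, by x^m / m! ≤ e^x at x = (b/2)(1 + s²). -/
theorem integrable_one_add_sq_pow_mul_exp (m : ℕ) {b : ℝ} (hb : 0 < b) :
    Integrable fun s : ℝ => (1 + s ^ 2) ^ m * Real.exp (-b * s ^ 2) := by
  have hg := (integrable_exp_neg_mul_sq (half_pos hb)).const_mul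
    ((m.factorial : ℝ) * (2 / b) ^ m * Real.exp (b / 2))
  refine hg.mono' (Continuous.aestronglyMeasurable (by fun_prop)) (Eventually.of_forall fun s => ?_)
  rw [Real.norm_of_nonneg (by positivity)]
  have h1 := Real.pow_div_factorial_le_exp (b / 2 * (1 + s ^ 2)) (by positivity) m
  rw [div_le_iff₀ (by positivity)] at h1
  have h2 : (1 + s ^ 2) ^ m ≤ (m.factorial : ℝ) * (2 / b) ^ m * Real.exp (b / 2 * (1 + s ^ 2)) := by
    have : (1 + s ^ 2) ^ m = (2 / b) ^ m * (b / 2 * (1 + s ^ 2)) ^ m := by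
      rw [← mul_pow]; congr 1; field_simp
    rw [this]
    calc _ ≤ (2 / b) ^ m * (Real.exp (b / 2 * (1 + s ^ 2)) * m.factorial) := by gcongr
      _ = _ := by ring
  calc _ ≤ ((m.factorial : ℝ) * (2 / b) ^ m * Real.exp (b / 2 * (1 + s ^ 2))) *
        Real.exp (-b * s ^ 2) := by gcongr
    _ = (m.factorial : ℝ) * (2 / b) ^ m * Real.exp (b / 2) * Real.exp (-(b / 2) * s ^ 2) := by
      rw [mul_assoc, mul_assoc, mul_assoc, mul_assoc, ← Real.exp_add, ← Real.exp_add]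
      ring_nf

/-- The Fourier transform of the Edgeworth approximation of order `r` with parameter
`h = 1 / √N`. -/
noncomputable def edgeworthFourier (V : ℝ) (p q : ℝ[X]) (r : ℕ) (h s : ℝ) : ℂ :=
  (Real.exp (-(V / 2) * s ^ 2) : ℂ) * ∑ j ∈ Finset.range (r + 1),
    (h : ℂ) ^ j * ((Complex.I * s) ^ j * ((expCoeff p q r j).eval (s ^ 2) : ℝ))

theorem continuous_edgeworthFourier (V : ℝ) (p q : ℝ[X]) (r : ℕ) (h : ℝ) :
    Continuous (edgeworthFourier V p q r h) := by
  unfold edgeworthFourier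
  fun_prop

theorem exists_norm_edgeworthFourier_le (V : ℝ) (p q : ℝ[X]) (r : ℕ) :
    ∃ (K : ℝ) (m : ℕ), 0 ≤ K ∧ ∀ h : ℝ, |h| ≤ 1 → ∀ s : ℝ,
      ‖edgeworthFourier V p q r h s‖ ≤ K * ((1 + s ^ 2) ^ m * Real.exp (-(V / 2) * s ^ 2)) := by
  choose C hC0 hC using exists_abs_eval_le
  set m := ∑ j ∈ Finset.range (r + 1), (j + (expCoeff p q r j).natDegree) with hm
  refine ⟨∑ j ∈ Finset.range (r + 1), C (expCoeff p q r j), m,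
    Finset.sum_nonneg fun _ _ => hC0 _, fun h hh s => ?_⟩
  rw [edgeworthFourier, norm_mul, Complex.norm_real, Real.norm_of_nonneg (Real.exp_pos _).le,
    mul_comm (Real.exp _), ← mul_assoc]
  refine mul_le_mul_of_nonneg_right ?_ (Real.exp_pos _).le
  rw [Finset.sum_mul]
  refine norm_sum_le_of_le _ fun j hj => ?_
  rw [norm_mul, norm_mul, norm_pow, norm_pow, norm_mul, Complex.norm_I, one_mul, Complex.norm_real,
    Complex.norm_real, Complex.norm_real, Real.norm_eq_abs, Real.norm_eq_abs, Real.norm_eq_abs]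
  have h1 : |s| ^ j ≤ (1 + s ^ 2) ^ j := by
    refine pow_le_pow_left₀ (abs_nonneg s) ?_ j
    nlinarith [sq_abs s, sq_nonneg (|s| - 1)]
  have h2 : |h| ^ j ≤ 1 := pow_le_one₀ (abs_nonneg h) hh
  calc |h| ^ j * (|s| ^ j * |(expCoeff p q r j).eval (s ^ 2)|)
      ≤ 1 * ((1 + s ^ 2) ^ j * (C (expCoeff p q r j) *
        (1 + s ^ 2) ^ (expCoeff p q r j).natDegree)) := by
        refine mul_le_mul h2 (mul_le_mul h1 (hC _ _ (sq_nonneg s)) (abs_nonneg _) (by positivity))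
          (by positivity) zero_le_one
    _ = C (expCoeff p q r j) * (1 + s ^ 2) ^ (j + (expCoeff p q r j).natDegree) := by ring
    _ ≤ C (expCoeff p q r j) * (1 + s ^ 2) ^ m := by
        refine mul_le_mul_of_nonneg_left (pow_le_pow_right₀ (by nlinarith) ?_) (hC0 _)
        exact Finset.single_le_sum (f := fun j => j + (expCoeff p q r j).natDegree)
          (fun _ _ => Nat.zero_le _) hj

theorem integrable_edgeworthFourier {V : ℝ} (hV : 0 < V) (p q : ℝ[X]) (r : ℕ) {h : ℝ}
    (hh : |h| ≤ 1) : Integrable (edgeworthFourier V p q r h) := by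
  obtain ⟨K, m, -, hK⟩ := exists_norm_edgeworthFourier_le V p q r
  exact ((integrable_one_add_sq_pow_mul_exp m (half_pos hV)).const_mul K).mono'
    (continuous_edgeworthFourier V p q r h).aestronglyMeasurable (Eventually.of_forall (hK h hh))

/-- The centered and rescaled characteristic function. -/
noncomputable def rescale (A : ℝ) (Φ : ℕ → ℝ → ℂ) (N : ℕ) (s : ℝ) : ℂ :=
  Complex.exp (-(Complex.I * A * √(N : ℝ) * s)) * Φ N ((√(N : ℝ))⁻¹ * s)

theorem norm_rescale (A : ℝ) (Φ : ℕ → ℝ → ℂ) (N : ℕ) (s : ℝ) :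
    ‖rescale A Φ N s‖ = ‖Φ N ((√(N : ℝ))⁻¹ * s)‖ := by
  rw [rescale, norm_mul]
  have : -(Complex.I * A * √(N : ℝ) * s) = ((-(A * √(N : ℝ) * s) : ℝ) : ℂ) * Complex.I := by
    push_cast; ring
  rw [this, Complex.norm_exp_ofReal_mul_I, one_mul]

theorem tendsto_inv_sqrt_mul (s : ℝ) :
    Tendsto (fun N : ℕ => (√(N : ℝ))⁻¹ * s) atTop (𝓝 0) := by
  have h : Tendsto (fun N : ℕ => (√(N : ℝ))⁻¹) atTop (𝓝 0) :=
    tendsto_inv_atTop_zero.comp (Real.tendsto_sqrt_atTop.comp tendsto_natCast_atTop_atTop)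
  simpa using h.mul_const s

/-- The rescaled leading term. -/
theorem rescaled_leading_term {A V : ℝ} {m c : ℂ} {N : ℕ} (hN : 1 ≤ N) {s : ℝ}
    (hm : m = Complex.exp (Complex.I * A * ((√(N : ℝ))⁻¹ * s : ℝ)
      - V / 2 * (((√(N : ℝ))⁻¹ * s : ℝ) : ℂ) ^ 2 + (((√(N : ℝ))⁻¹ * s : ℝ) : ℂ) ^ 2 * c)) :
    Complex.exp (-(Complex.I * A * √(N : ℝ) * s)) * m ^ N
      = (Real.exp (-(V / 2) * s ^ 2) : ℂ) * Complex.exp ((s ^ 2 : ℝ) * c) := by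
  have hN0 : (0 : ℝ) < N := by exact_mod_cast hN
  have hs : (√(N : ℝ) : ℂ) ≠ 0 := by exact_mod_cast (Real.sqrt_pos.mpr hN0).ne'
  have hs2 : (N : ℂ) = (√(N : ℝ) : ℂ) ^ 2 := by
    rw [← Complex.ofReal_pow, Real.sq_sqrt hN0.le, Complex.ofReal_natCast]
  rw [hm, ← Complex.exp_nat_mul, Complex.ofReal_exp, ← Complex.exp_add, ← Complex.exp_add, hs2]
  congr 1
  push_cast
  field_simp
  ring

/-- The near-zero expansion is used at w = s² and u = s/√N. Its growth e^{V s²/4} is absorbed by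
e^{-V s²/2}, and √N^r |u|^r = |s|^r removes N from the main error. -/
theorem norm_rescale_sub_le {Φ : ℕ → ℝ → ℂ} {A V C θ ε : ℝ} {m z c : ℂ} {p q : ℝ[X]} {r N : ℕ}
    {s : ℝ} (hN : 1 ≤ N)
    (hm : m = Complex.exp (Complex.I * A * ((√(N : ℝ))⁻¹ * s : ℝ)
      - V / 2 * (((√(N : ℝ))⁻¹ * s : ℝ) : ℂ) ^ 2 + (((√(N : ℝ))⁻¹ * s : ℝ) : ℂ) ^ 2 * c))
    (happ : ‖Φ N ((√(N : ℝ))⁻¹ * s) - m ^ N * z‖ ≤ C * θ ^ N)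
    (hexp : ∀ w : ℝ, 0 ≤ w → ‖Complex.exp (w * c) * z -
        ∑ j ∈ Finset.range (r + 1), (Complex.I * ((√(N : ℝ))⁻¹ * s : ℝ)) ^ j *
          ((expCoeff p q r j).eval w : ℝ)‖
      ≤ ε * |(√(N : ℝ))⁻¹ * s| ^ r * ((1 + w) ^ (r + 1) * Real.exp (V / 4 * w))) :
    √(N : ℝ) ^ r * ‖rescale A Φ N s - edgeworthFourier V p q r (√(N : ℝ))⁻¹ s‖
      ≤ ε * (|s| ^ r * ((1 + s ^ 2) ^ (r + 1) * Real.exp (-(V / 4) * s ^ 2)))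
        + √(N : ℝ) ^ r * (C * θ ^ N) := by
  have hN0 : (0 : ℝ) < N := by exact_mod_cast hN
  have hsq : 0 < √(N : ℝ) := Real.sqrt_pos.mpr hN0
  set t : ℝ := (√(N : ℝ))⁻¹ * s with ht
  have hpe : ∀ x : ℝ, ‖Complex.exp (-(Complex.I * A * √(N : ℝ) * x))‖ = 1 := fun x => by
    have : -(Complex.I * A * √(N : ℝ) * x) = ((-(A * √(N : ℝ) * x) : ℝ) : ℂ) * Complex.I := by
      push_cast; ring
    rw [this, Complex.norm_exp_ofReal_mul_I]
  have hdec : rescale A Φ N s - edgeworthFourier V p q r (√(N : ℝ))⁻¹ s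
      = Complex.exp (-(Complex.I * A * √(N : ℝ) * s)) * (Φ N t - m ^ N * z)
        + (Real.exp (-(V / 2) * s ^ 2) : ℂ) * (Complex.exp ((s ^ 2 : ℝ) * c) * z -
          ∑ j ∈ Finset.range (r + 1), (Complex.I * (t : ℝ)) ^ j *
            ((expCoeff p q r j).eval (s ^ 2) : ℝ)) := by
    have h1 : edgeworthFourier V p q r (√(N : ℝ))⁻¹ s = (Real.exp (-(V / 2) * s ^ 2) : ℂ) *
        ∑ j ∈ Finset.range (r + 1), (Complex.I * (t : ℝ)) ^ j *
            ((expCoeff p q r j).eval (s ^ 2) : ℝ) := by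
      rw [edgeworthFourier]
      congr 1
      refine Finset.sum_congr rfl fun j _ => ?_
      rw [ht]
      push_cast
      ring
    have h2 := rescaled_leading_term (A := A) (V := V) (m := m) (c := c) hN hm
    rw [h1, rescale, mul_sub, mul_sub, ← mul_assoc, ← mul_assoc, ← h2]
    ring
  have hnear := hexp (s ^ 2) (sq_nonneg s)
  have hs_eq : √(N : ℝ) ^ r * |t| ^ r = |s| ^ r := by
    rw [← mul_pow, ht, abs_mul, abs_of_pos (inv_pos.mpr hsq), ← mul_assoc,
      mul_inv_cancel₀ hsq.ne', one_mul]
  rw [hdec]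
  calc _ ≤ √(N : ℝ) ^ r * (C * θ ^ N + Real.exp (-(V / 2) * s ^ 2) *
        (ε * |t| ^ r * ((1 + s ^ 2) ^ (r + 1) * Real.exp (V / 4 * s ^ 2)))) := by
        refine mul_le_mul_of_nonneg_left ((norm_add_le _ _).trans (add_le_add ?_ ?_))
          (by positivity)
        · rw [norm_mul, hpe, one_mul]; exact happ
        · rw [norm_mul, Complex.norm_real, Real.norm_of_nonneg (Real.exp_pos _).le]
          exact mul_le_mul_of_nonneg_left hnear (Real.exp_pos _).le
    _ = ε * ((√(N : ℝ) ^ r * |t| ^ r) * ((1 + s ^ 2) ^ (r + 1) *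
          (Real.exp (-(V / 2) * s ^ 2) * Real.exp (V / 4 * s ^ 2))))
        + √(N : ℝ) ^ r * (C * θ ^ N) := by ring
    _ = _ := by
        rw [hs_eq, ← Real.exp_add]
        congr 5
        ring

theorem sqrt_natCast_le {N : ℕ} (hN : 1 ≤ N) : √(N : ℝ) ≤ N := by
  have h1 : (1 : ℝ) ≤ N := by exact_mod_cast hN
  rw [Real.sqrt_le_left (by linarith)]
  nlinarith

/-- The extra power of N in the hypothesis converts the weight in t = s/√N into one in s: N (1 +
s²/N) = N + s². -/
theorem far_bound {x C : ℝ} {r N : ℕ} {s : ℝ} (hN : 1 ≤ N) (hC : 0 ≤ C)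
    (h : x ≤ C / ((N : ℝ) ^ (r + 1) * (1 + ((√(N : ℝ))⁻¹ * s) ^ 2))) :
    √(N : ℝ) ^ r * x ≤ C / (1 + s ^ 2) := by
  have hN1 : (1 : ℝ) ≤ N := by exact_mod_cast hN
  have hN0 : (0 : ℝ) < N := by linarith
  have h1 : (N : ℝ) ^ (r + 1) * (1 + ((√(N : ℝ))⁻¹ * s) ^ 2) = (N : ℝ) ^ r * (N + s ^ 2) := by
    rw [mul_pow, inv_pow, Real.sq_sqrt hN0.le]
    field_simp
    ring
  rw [h1] at h
  calc √(N : ℝ) ^ r * x ≤ (N : ℝ) ^ r * (C / ((N : ℝ) ^ r * (N + s ^ 2))) := by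
        calc _ ≤ √(N : ℝ) ^ r * (C / ((N : ℝ) ^ r * (N + s ^ 2))) := by gcongr
          _ ≤ _ := by gcongr; exact sqrt_natCast_le hN
    _ = C / (N + s ^ 2) := by field_simp
    _ ≤ C / (1 + s ^ 2) := by gcongr

/-- The rescaled characteristic functions are close in `L¹` to the Edgeworth approximation. -/
theorem tendsto_integral_rescale_sub {Φ : ℕ → ℝ → ℂ} {μ Z χ : ℝ → ℂ} {A V : ℝ} {p q : ℝ[X]} {r : ℕ}
    {C θ : ℝ} (hΦc : ∀ N, 1 ≤ N → Continuous (Φ N)) (hV : 0 < V) (hC : 0 < C) (hθ0 : 0 < θ)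
    (hθ1 : θ < 1)
    (happ : ∀ᶠ t in 𝓝 (0 : ℝ), ∀ N : ℕ, 1 ≤ N → ‖Φ N t - μ t ^ N * Z t‖ ≤ C * θ ^ N)
    (hμ : ∀ᶠ u in 𝓝 (0 : ℝ), μ u =
        Complex.exp (Complex.I * A * u - V / 2 * (u : ℂ) ^ 2 + (u : ℂ) ^ 2 * χ u))
    (hp0 : p.coeff 0 = 0)
    (hχ : (fun u : ℝ => χ u - aeval (Complex.I * u) p) =o[𝓝 0] fun u : ℝ => u ^ r)
    (hZ : (fun u : ℝ => Z u - aeval (Complex.I * u) q) =o[𝓝 0] fun u : ℝ => u ^ r)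
    (hdecay : ∀ δ : ℝ, 0 < δ → ∃ D : ℝ, 0 < D ∧ ∀ᶠ N : ℕ in atTop, ∀ t : ℝ, δ ≤ |t| →
      ‖Φ N t‖ ≤ D / ((N : ℝ) ^ (r + 1) * (1 + t ^ 2))) :
    Tendsto (fun N : ℕ => ∫ s : ℝ, √(N : ℝ) ^ r *
        ‖rescale A Φ N s - edgeworthFourier V p q r (√(N : ℝ))⁻¹ s‖) atTop (𝓝 0) ∧
      ∀ᶠ N : ℕ in atTop, Integrable (rescale A Φ N) := by
  have hV4 : 0 < V / 4 := by positivity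
  have hnear := fun (ε : ℝ) (hε : 0 < ε) =>
    (happ.and hμ).and (eventually_norm_exp_mul_sub_le hp0 hχ hZ hV4 hε)
  obtain ⟨δ, hδ, hball⟩ := Metric.eventually_nhds_iff.mp (hnear 1 one_pos)
  obtain ⟨D, hD, hfar⟩ := hdecay δ hδ
  obtain ⟨K, m, hK0, hK⟩ := exists_norm_edgeworthFourier_le V p q r
  obtain ⟨C₂, hC₂, hgeo⟩ := exists_geometric_le_inv_pow hθ0 hθ1 (r + 1)
  set F : ℕ → ℝ → ℝ := fun N s => √(N : ℝ) ^ r *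
        ‖rescale A Φ N s - edgeworthFourier V p q r (√(N : ℝ))⁻¹ s‖ with hF
  -- The dominating function collects the near-zero expansion error with ε = 1, the exponential
  -- error together with the far decay, and the tail of the approximation, where |s| ≥ δ√N turns
  -- √N^r into a power of |s|/δ.
  set g : ℝ → ℝ := fun s =>
    (1 + s ^ 2) ^ (r + (r + 1)) * Real.exp (-(V / 4) * s ^ 2) +
      (C * C₂ * (1 + δ ^ 2) + D) * (1 + s ^ 2)⁻¹ +
      (K * (δ⁻¹) ^ r) * ((1 + s ^ 2) ^ (r + m) * Real.exp (-(V / 2) * s ^ 2)) with hg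
  have hs_le : ∀ s : ℝ, |s| ≤ 1 + s ^ 2 := fun s => by
    nlinarith [sq_abs s, sq_nonneg (|s| - 1)]
  have hg_int : Integrable g :=
    ((integrable_one_add_sq_pow_mul_exp _ hV4).add (integrable_inv_one_add_sq.const_mul _)).add
      ((integrable_one_add_sq_pow_mul_exp _ (half_pos hV)).const_mul _)
  have hbound : ∀ᶠ N : ℕ in atTop, ∀ s : ℝ, F N s ≤ g s := by
    filter_upwards [eventually_ge_atTop 1, hfar] with N hN hNfar s
    have hN1 : (1 : ℝ) ≤ N := by exact_mod_cast hN
    have hN0 : (0 : ℝ) < N := by linarith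
    have hsq : 0 < √(N : ℝ) := Real.sqrt_pos.mpr hN0
    have hsq1 : 1 ≤ √(N : ℝ) := Real.one_le_sqrt.mpr hN1
    have habs : |(√(N : ℝ))⁻¹ * s| = |s| / √(N : ℝ) := by
      rw [abs_mul, abs_of_pos (inv_pos.mpr hsq), inv_mul_eq_div]
    have hp1 : 0 ≤ (1 + s ^ 2) ^ (r + (r + 1)) * Real.exp (-(V / 4) * s ^ 2) := by positivity
    have hp3 : 0 ≤ (K * (δ⁻¹) ^ r) * ((1 + s ^ 2) ^ (r + m) * Real.exp (-(V / 2) * s ^ 2)) := by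
      positivity
    rcases lt_or_ge |(√(N : ℝ))⁻¹ * s| δ with hlt | hge
    · obtain ⟨⟨h1, h2⟩, h3⟩ := hball (y := (√(N : ℝ))⁻¹ * s) (by simpa [dist_eq_norm] using hlt)
      have h4 := norm_rescale_sub_le (r := r) hN h2 (h1 N hN) h3
      have h5 : |s| ^ r * ((1 + s ^ 2) ^ (r + 1) * Real.exp (-(V / 4) * s ^ 2))
          ≤ (1 + s ^ 2) ^ (r + (r + 1)) * Real.exp (-(V / 4) * s ^ 2) := by
        rw [pow_add (1 + s ^ 2) r (r + 1), mul_assoc ((1 + s ^ 2) ^ r)]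
        gcongr
        exact hs_le s
      have h6 : √(N : ℝ) ^ r * (C * θ ^ N) ≤ C * C₂ * (1 + δ ^ 2) * (1 + s ^ 2)⁻¹ := by
        have h7 : s ^ 2 ≤ δ ^ 2 * N := by
          rw [habs, div_lt_iff₀ hsq] at hlt
          calc s ^ 2 = |s| ^ 2 := (sq_abs s).symm
            _ ≤ (δ * √(N : ℝ)) ^ 2 := by gcongr
            _ = δ ^ 2 * N := by rw [mul_pow, Real.sq_sqrt hN0.le]
        have h8 : 1 + s ^ 2 ≤ (1 + δ ^ 2) * N := by nlinarith
        have h9 : √(N : ℝ) ^ r * (C * θ ^ N) * (1 + s ^ 2) ≤ C * C₂ * (1 + δ ^ 2) := by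
          calc _ ≤ (N : ℝ) ^ r * (C * θ ^ N) * ((1 + δ ^ 2) * N) := by
                gcongr
                exact sqrt_natCast_le hN
            _ = C * ((N : ℝ) ^ (r + 1) * θ ^ N) * (1 + δ ^ 2) := by ring
            _ ≤ C * C₂ * (1 + δ ^ 2) := by gcongr; exact hgeo N
        rwa [← div_eq_mul_inv, le_div_iff₀ (by positivity)]
      have h10 : 0 ≤ D * (1 + s ^ 2)⁻¹ := by positivity
      simp only [hF, hg, add_mul]
      rw [one_mul] at h4
      linarith
    · have h1 : √(N : ℝ) ^ r * ‖rescale A Φ N s‖ ≤ D * (1 + s ^ 2)⁻¹ := by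
        rw [norm_rescale, ← div_eq_mul_inv]
        exact far_bound hN hD.le (hNfar _ hge)
      have h2 : √(N : ℝ) ^ r * ‖edgeworthFourier V p q r (√(N : ℝ))⁻¹ s‖
          ≤ (K * (δ⁻¹) ^ r) * ((1 + s ^ 2) ^ (r + m) * Real.exp (-(V / 2) * s ^ 2)) := by
        have h3 := hK (√(N : ℝ))⁻¹ (by
          rw [abs_of_pos (inv_pos.mpr hsq)]; exact inv_le_one_of_one_le₀ hsq1) s
        have h4 : √(N : ℝ) ^ r ≤ (δ⁻¹) ^ r * (1 + s ^ 2) ^ r := by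
          rw [← mul_pow]
          refine pow_le_pow_left₀ hsq.le ?_ r
          rw [habs, le_div_iff₀ hsq] at hge
          rw [inv_mul_eq_div, le_div_iff₀ hδ]
          linarith [hs_le s]
        calc _ ≤ ((δ⁻¹) ^ r * (1 + s ^ 2) ^ r) *
              (K * ((1 + s ^ 2) ^ m * Real.exp (-(V / 2) * s ^ 2))) := by gcongr
          _ = _ := by ring
      have h5 : F N s ≤ √(N : ℝ) ^ r * ‖rescale A Φ N s‖
          + √(N : ℝ) ^ r * ‖edgeworthFourier V p q r (√(N : ℝ))⁻¹ s‖ := by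
        rw [← mul_add]
        exact mul_le_mul_of_nonneg_left (norm_sub_le _ _) (by positivity)
      have h6 : 0 ≤ C * C₂ * (1 + δ ^ 2) * (1 + s ^ 2)⁻¹ := by positivity
      simp only [hg, add_mul]
      linarith
  have hcont : ∀ N, 1 ≤ N → Continuous (rescale A Φ N) := fun N hN => by
    have := hΦc N hN
    unfold rescale
    fun_prop
  have hmeas : ∀ N, 1 ≤ N → Continuous (F N) := fun N hN => by
    have h1 := hcont N hN
    have h2 := continuous_edgeworthFourier V p q r (√(N : ℝ))⁻¹
    simp only [hF]
    fun_prop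
  refine ⟨?_, ?_⟩
  -- For fixed s, s/√N enters every neighbourhood of 0, so the near-zero estimate is available with
  -- arbitrary ε.
  · have hlim : ∀ s : ℝ, Tendsto (fun N => F N s) atTop (𝓝 0) := by
      intro s
      rw [Metric.tendsto_atTop']
      intro ε hε
      set G := |s| ^ r * ((1 + s ^ 2) ^ (r + 1) * Real.exp (-(V / 4) * s ^ 2)) with hG
      have hG0 : 0 ≤ G := by positivity
      have hε' : 0 < ε / (2 * (G + 1)) := by positivity
      have e1 := (tendsto_inv_sqrt_mul s).eventually (hnear _ hε')
      have e2 : Tendsto (fun N : ℕ => (C * (N : ℝ) ^ r * θ ^ N)) atTop (𝓝 0) := by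
        have := (tendsto_pow_const_mul_const_pow_of_lt_one r hθ0.le hθ1).const_mul C
        simpa [mul_assoc] using this
      have e3 := e2.eventually (gt_mem_nhds (half_pos hε))
      have e4 : ∀ᶠ N : ℕ in atTop, dist (F N s) 0 < ε := by
        filter_upwards [e1, e3, eventually_ge_atTop 1] with N h1 h2 hN
        obtain ⟨⟨h3, h4⟩, h5⟩ := h1
        have h6 := norm_rescale_sub_le (r := r) hN h4 (h3 N hN) h5
        have h7 : √(N : ℝ) ^ r * (C * θ ^ N) ≤ C * (N : ℝ) ^ r * θ ^ N := by
          calc _ ≤ (N : ℝ) ^ r * (C * θ ^ N) := by gcongr; exact sqrt_natCast_le hN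
            _ = _ := by ring
        have h8 : ε / (2 * (G + 1)) * G ≤ ε / 2 := by
          rw [div_mul_eq_mul_div, div_le_div_iff₀ (by positivity) (by positivity)]
          nlinarith
        have h9 : 0 ≤ F N s := by positivity
        rw [Real.dist_0_eq_abs, abs_of_nonneg h9]
        linarith
      obtain ⟨n, hn⟩ := eventually_atTop.mp e4
      exact ⟨n, fun N hN => hn N hN.le⟩
    have h := tendsto_integral_filter_of_dominated_convergence (μ := volume) (l := atTop)
      (F := F) (f := fun _ => (0 : ℝ)) g ?_ ?_ hg_int
      (Eventually.of_forall hlim)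
    · simpa using h
    · filter_upwards [eventually_ge_atTop 1] with N hN using (hmeas N hN).aestronglyMeasurable
    · filter_upwards [hbound] with N hN
      refine Eventually.of_forall fun s => ?_
      rw [Real.norm_of_nonneg (by positivity)]
      exact hN s
  · filter_upwards [hbound, eventually_ge_atTop 1] with N hN hN1
    have hsq1 : 1 ≤ √(N : ℝ) := Real.one_le_sqrt.mpr (by exact_mod_cast hN1)
    have hE : Integrable (edgeworthFourier V p q r (√(N : ℝ))⁻¹) :=
      integrable_edgeworthFourier hV p q r (by
        rw [abs_of_pos (by positivity)]; exact inv_le_one_of_one_le₀ hsq1)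
    have hdiff : Integrable (fun s => rescale A Φ N s - edgeworthFourier V p q r (√(N : ℝ))⁻¹ s) := by
      refine hg_int.mono' ((hcont N hN1).sub
        (continuous_edgeworthFourier _ _ _ _ _)).aestronglyMeasurable
        (Eventually.of_forall fun s => le_trans ?_ (hN s))
      exact le_mul_of_one_le_left (norm_nonneg _) (one_le_pow₀ hsq1)
    exact (hdiff.add hE).congr (Eventually.of_forall fun s => by simp)

end FourierConvergence

/-! ### Fourier inversion for probability measures. -/

section Inversion

/-- The inverse Fourier transform, with the normalization of probability theory. -/
noncomputable def invFourier (ψ : ℝ → ℂ) (x : ℝ) : ℂ :=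
  ((2 * Real.pi : ℝ) : ℂ)⁻¹ * ∫ s : ℝ, Complex.exp (-(Complex.I * s * x)) * ψ s

theorem norm_exp_neg_I_mul (s x : ℝ) : ‖Complex.exp (-(Complex.I * s * x))‖ = 1 := by
  have : -(Complex.I * s * x) = ((-(s * x) : ℝ) : ℂ) * Complex.I := by push_cast; ring
  rw [this, Complex.norm_exp_ofReal_mul_I]

theorem integrable_exp_mul {ψ : ℝ → ℂ} (hψ : Integrable ψ) (x : ℝ) :
    Integrable fun s : ℝ => Complex.exp (-(Complex.I * s * x)) * ψ s :=
  hψ.bdd_mul (c := 1) (Continuous.aestronglyMeasurable (by fun_prop))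
    (Eventually.of_forall fun s => (norm_exp_neg_I_mul s x).le)

theorem norm_invFourier_le (ψ : ℝ → ℂ) (x : ℝ) :
    ‖invFourier ψ x‖ ≤ (2 * Real.pi)⁻¹ * ∫ s : ℝ, ‖ψ s‖ := by
  rw [invFourier, norm_mul, norm_inv, Complex.norm_real, Real.norm_of_nonneg (by positivity)]
  refine mul_le_mul_of_nonneg_left ((norm_integral_le_integral_norm _).trans (le_of_eq ?_))
    (by positivity)
  simp only [norm_mul, norm_exp_neg_I_mul, one_mul]

theorem continuous_invFourier {ψ : ℝ → ℂ} (hψ : Integrable ψ) : Continuous (invFourier ψ) := by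
  refine continuous_const.mul (continuous_of_dominated (bound := fun s => ‖ψ s‖) ?_ ?_ hψ.norm ?_)
  · exact fun x => (integrable_exp_mul hψ x).aestronglyMeasurable
  · exact fun x => Eventually.of_forall fun s => by rw [norm_mul, norm_exp_neg_I_mul, one_mul]
  · exact Eventually.of_forall fun s => by fun_prop

theorem invFourier_sub {ψ₁ ψ₂ : ℝ → ℂ} (h₁ : Integrable ψ₁) (h₂ : Integrable ψ₂) (x : ℝ) :
    invFourier (fun s => ψ₁ s - ψ₂ s) x = invFourier ψ₁ x - invFourier ψ₂ x := by
  rw [invFourier, invFourier, invFourier, ← mul_sub,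
    ← integral_sub (integrable_exp_mul h₁ x) (integrable_exp_mul h₂ x)]
  simp only [mul_sub]

theorem invFourier_gaussian {V : ℝ≥0} (hV : 0 < V) (x : ℝ) :
    invFourier (fun s => (Real.exp (-(V / 2) * s ^ 2) : ℂ)) x = (gaussianPDFReal 0 V x : ℂ) := by
  have hV' : (0 : ℝ) < V := hV
  have h := fourierIntegral_gaussian (b := ((V / 2 : ℝ) : ℂ))
    (by rw [Complex.ofReal_re]; positivity) (-(x : ℂ))
  have h1 : ∫ s : ℝ, Complex.exp (-(Complex.I * s * x)) * (Real.exp (-(V / 2) * s ^ 2) : ℂ)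
      = ((Real.pi / (V / 2) : ℝ) : ℂ) ^ ((1 / 2 : ℝ) : ℂ) *
        ((Real.exp (-x ^ 2 / (2 * V)) : ℝ) : ℂ) := by
    convert h using 1
    · congr 1
      ext s
      push_cast
      ring_nf
    · push_cast
      congr 2
      have : (V : ℂ) ≠ 0 := by exact_mod_cast hV'.ne'
      field_simp
      ring
  rw [invFourier, h1, ← Complex.ofReal_cpow (by positivity), ← Complex.ofReal_inv,
    ← Complex.ofReal_mul, ← Complex.ofReal_mul, gaussianPDFReal, ← Real.sqrt_eq_rpow, sub_zero,
    ← mul_assoc]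
  congr 2
  rw [show Real.pi / ((V : ℝ) / 2) = (2 * Real.pi) ^ 2 / (2 * Real.pi * V) by field_simp,
    Real.sqrt_div (by positivity), Real.sqrt_sq (by positivity)]
  field_simp

/-- Averaging the Gaussian kernel against a probability measure. -/
theorem integral_gaussianPDFReal_sub {m : Measure ℝ} [IsProbabilityMeasure m] {V : ℝ≥0}
    (hV : 0 < V) (w : ℝ) :
    ∫ y, (gaussianPDFReal 0 V (w - y) : ℂ) ∂m
      = invFourier (fun s => (Real.exp (-(V / 2) * s ^ 2) : ℂ) * charFun m s) w := by
  have hV' : (0 : ℝ) < V := hV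
  have hint : Integrable (Function.uncurry fun (y s : ℝ) =>
      Complex.exp (-(Complex.I * s * (w - y : ℝ))) * (Real.exp (-(V / 2) * s ^ 2) : ℂ))
      (m.prod volume) := by
    have h1 : Integrable (fun s : ℝ => (Real.exp (-(V / 2) * s ^ 2) : ℂ)) :=
      (integrable_exp_neg_mul_sq (half_pos hV')).ofReal
    have h2 : Integrable (fun z : ℝ × ℝ => (Real.exp (-(V / 2) * z.2 ^ 2) : ℂ)) (m.prod volume) :=
      h1.comp_snd m
    exact h2.bdd_mul (c := 1) (Continuous.aestronglyMeasurable (by fun_prop))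
      (Eventually.of_forall fun z => (norm_exp_neg_I_mul _ _).le)
  simp_rw [← invFourier_gaussian hV, invFourier]
  rw [integral_const_mul, integral_integral_swap hint]
  congr 2
  ext s
  rw [charFun_apply_real, ← integral_const_mul, ← integral_const_mul]
  congr 1
  ext y
  rw [mul_comm, mul_left_comm]
  congr 1
  rw [← Complex.exp_add]
  congr 1
  push_cast
  ring

/-- Smoothing by a small Gaussian. -/
theorem integral_integral_gaussian {m : Measure ℝ} [IsProbabilityMeasure m] {f : ℝ → ℂ}
    (hf : Continuous f) (hfi : Integrable f) {c : ℝ} (hc : 0 < c) :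
    ∫ y, (∫ x, f (y + c * x) ∂gaussianReal 0 1) ∂m
      = ∫ w, f w * invFourier (fun s => (Real.exp (-(c ^ 2 / 2) * s ^ 2) : ℂ) * charFun m s) w := by
  set V : ℝ≥0 := ⟨c ^ 2, sq_nonneg c⟩ with hVdef
  have hVc : (V : ℝ) = c ^ 2 := rfl
  have hV : 0 < V := by
    rw [← NNReal.coe_pos, hVc]; positivity
  have h1 : ∀ y, ∫ x, f (y + c * x) ∂gaussianReal 0 1
      = ∫ w, f w * (gaussianPDFReal 0 V (w - y) : ℂ) := by
    intro y
    have h2 : (gaussianReal 0 1).map (c * ·) = gaussianReal 0 V := by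
      rw [gaussianReal_map_const_mul, mul_zero, mul_one]
      rfl
    have h3 : ∫ x, f (y + c * x) ∂gaussianReal 0 1 = ∫ x, f (y + x) ∂gaussianReal 0 V := by
      rw [← h2, integral_map (by fun_prop) (Continuous.aestronglyMeasurable (by fun_prop))]
    rw [h3, integral_gaussianReal_eq_integral_smul hV.ne',
      ← integral_add_left_eq_self (fun w => f w * (gaussianPDFReal 0 V (w - y) : ℂ)) y]
    congr 1
    ext x
    rw [add_sub_cancel_left, Complex.real_smul, mul_comm]
  simp_rw [h1]
  have hpdf : Continuous (gaussianPDFReal 0 V) := by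
    unfold gaussianPDFReal
    fun_prop
  have hint : Integrable (Function.uncurry fun (y w : ℝ) =>
      f w * (gaussianPDFReal 0 V (w - y) : ℂ)) (m.prod volume) := by
    refine (hfi.comp_snd m).mul_bdd (c := (√(2 * Real.pi * V))⁻¹)
      (Continuous.aestronglyMeasurable (by fun_prop)) (Eventually.of_forall fun z => ?_)
    rw [Complex.norm_real, Real.norm_of_nonneg (gaussianPDFReal_nonneg _ _ _), gaussianPDFReal]
    refine mul_le_of_le_one_right (by positivity) (Real.exp_le_one_iff.mpr ?_)
    rw [neg_div]
    exact neg_nonpos.mpr (by positivity)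
  rw [integral_integral_swap hint]
  congr 1
  ext w
  rw [integral_const_mul, integral_gaussianPDFReal_sub hV, hVc]

/-- A probability measure with integrable characteristic function has the inverse Fourier
transform of that function as a density. -/
theorem integral_eq_integral_mul_invFourier {m : Measure ℝ} [IsProbabilityMeasure m]
    (hm : Integrable (charFun m)) {f : ℝ → ℂ} (hf : Continuous f) (hfi : Integrable f) {M : ℝ}
    (hfM : ∀ x, ‖f x‖ ≤ M) :
    ∫ x, f x ∂m = ∫ x, f x * invFourier (charFun m) x := by
  -- The identity is exact after smoothing by a Gaussian of width c n; both sides then converge by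
  -- dominated convergence as the width shrinks.
  set c : ℕ → ℝ := fun n => 1 / ((n : ℝ) + 1) with hc
  have hc0 : Tendsto c atTop (𝓝 0) := tendsto_one_div_add_atTop_nhds_zero_nat
  have hcp : ∀ n, 0 < c n := fun n => by rw [hc]; positivity
  have hM0 : 0 ≤ M := (norm_nonneg _).trans (hfM 0)
  have l1 : Tendsto (fun n => ∫ y, (∫ x, f (y + c n * x) ∂gaussianReal 0 1) ∂m) atTop
      (𝓝 (∫ y, f y ∂m)) := by
    refine tendsto_integral_of_dominated_convergence (fun _ => M) ?_ (integrable_const M) ?_ ?_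
    · intro n
      have : Continuous (Function.uncurry fun y x : ℝ => f (y + c n * x)) := by fun_prop
      exact this.stronglyMeasurable.integral_prod_right'.aestronglyMeasurable
    · refine fun n => Eventually.of_forall fun y => ?_
      have := norm_integral_le_of_norm_le_const (μ := gaussianReal 0 1)
        (Eventually.of_forall fun x => hfM (y + c n * x))
      simpa using this
    · refine Eventually.of_forall fun y => ?_
      have h := tendsto_integral_of_dominated_convergence (μ := gaussianReal 0 1)
        (F := fun n x => f (y + c n * x)) (f := fun _ => f y) (fun _ => M)
        (fun n => Continuous.aestronglyMeasurable (by fun_prop)) (integrable_const M)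
        (fun n => Eventually.of_forall fun x => hfM _)
        (Eventually.of_forall fun x => by
          have h2 : Tendsto (fun n => y + c n * x) atTop (𝓝 y) := by
            simpa using (hc0.mul_const x).const_add y
          exact (hf.tendsto y).comp h2)
      simpa using h
  have hle : ∀ (n : ℕ) (s : ℝ),
      ‖(Real.exp (-(c n ^ 2 / 2) * s ^ 2) : ℂ) * charFun m s‖ ≤ ‖charFun m s‖ := by
    intro n s
    rw [norm_mul, Complex.norm_real, Real.norm_of_nonneg (Real.exp_pos _).le]
    refine mul_le_of_le_one_left (norm_nonneg _) (Real.exp_le_one_iff.mpr ?_)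
    have : 0 ≤ c n ^ 2 / 2 * s ^ 2 := by positivity
    linarith
  have hint : ∀ n, Integrable fun s : ℝ => (Real.exp (-(c n ^ 2 / 2) * s ^ 2) : ℂ) * charFun m s :=
    fun n => hm.mono (Continuous.aestronglyMeasurable (by fun_prop) |>.mul hm.1)
      (Eventually.of_forall (hle n))
  have l2 : Tendsto (fun n => ∫ w, f w *
      invFourier (fun s => (Real.exp (-(c n ^ 2 / 2) * s ^ 2) : ℂ) * charFun m s) w) atTop
      (𝓝 (∫ w, f w * invFourier (charFun m) w)) := by
    refine tendsto_integral_of_dominated_convergence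
      (fun w => ‖f w‖ * ((2 * Real.pi)⁻¹ * ∫ s, ‖charFun m s‖)) ?_ (hfi.norm.mul_const _) ?_ ?_
    · exact fun n => (hf.mul (continuous_invFourier (hint n))).aestronglyMeasurable
    · refine fun n => Eventually.of_forall fun w => ?_
      rw [norm_mul]
      refine mul_le_mul_of_nonneg_left ((norm_invFourier_le _ _).trans ?_) (norm_nonneg _)
      exact mul_le_mul_of_nonneg_left (integral_mono (hint n).norm hm.norm (hle n)) (by positivity)
    · refine Eventually.of_forall fun w => Tendsto.const_mul _ (Tendsto.const_mul _ ?_)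
      refine tendsto_integral_of_dominated_convergence (fun s => ‖charFun m s‖)
        (fun n => (integrable_exp_mul (hint n) w).1) hm.norm
        (fun n => Eventually.of_forall fun s => ?_) (Eventually.of_forall fun s => ?_)
      · rw [norm_mul, norm_exp_neg_I_mul, one_mul]; exact hle n s
      · refine Tendsto.const_mul _ ?_
        have h3 : Tendsto (fun n => (Real.exp (-(c n ^ 2 / 2) * s ^ 2) : ℂ)) atTop (𝓝 1) := by
          have h4 : Continuous fun a : ℝ => (Real.exp (-(a ^ 2 / 2) * s ^ 2) : ℂ) := by fun_prop
          have h5 := (h4.tendsto 0).comp hc0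
          simpa [Function.comp_def] using h5
        simpa using h3.mul_const (charFun m s)
  refine tendsto_nhds_unique l1 (l2.congr fun n => ?_)
  rw [integral_integral_gaussian hf hfi (hcp n)]

/-- Both terms are integrals of f against inverse transforms, whose difference is bounded uniformly
by the L¹ distance of the transforms. The sup bound M of f does not enter the estimate. -/
theorem norm_integral_sub_le {m : Measure ℝ} [IsProbabilityMeasure m]
    (hm : Integrable (charFun m)) {ψ : ℝ → ℂ} (hψ : Integrable ψ) {f : ℝ → ℂ} (hf : Continuous f)
    (hfi : Integrable f) {M : ℝ} (hfM : ∀ x, ‖f x‖ ≤ M) :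
    ‖∫ x, f x ∂m - ∫ x, f x * invFourier ψ x‖
      ≤ (∫ x, ‖f x‖) * ((2 * Real.pi)⁻¹ * ∫ s, ‖charFun m s - ψ s‖) := by
  have hbdd : ∀ {φ : ℝ → ℂ}, Integrable φ → Integrable fun x => f x * invFourier φ x := fun hφ =>
    hfi.mul_bdd (c := (2 * Real.pi)⁻¹ * ∫ s, ‖_‖) (continuous_invFourier hφ).aestronglyMeasurable
      (Eventually.of_forall fun x => norm_invFourier_le _ x)
  rw [integral_eq_integral_mul_invFourier hm hf hfi hfM, ← integral_sub (hbdd hm) (hbdd hψ),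
    ← integral_mul_const]
  refine norm_integral_le_of_norm_le (hfi.norm.mul_const _) (Eventually.of_forall fun x => ?_)
  rw [← mul_sub, ← invFourier_sub hm hψ, norm_mul]
  exact mul_le_mul_of_nonneg_left (norm_invFourier_le _ x) (norm_nonneg _)

end Inversion

/-! ### Hermite polynomials and the Edgeworth polynomials. -/

section Hermite

open Polynomial

/-- The Hermite polynomials for the Gaussian density of variance `V`. -/
noncomputable def hermiteVar (V : ℝ) : ℕ → ℝ[X]
  | 0 => 1
  | 1 => C V⁻¹ * X
  | n + 2 => C V⁻¹ * (X * hermiteVar V (n + 1) - C ((n : ℝ) + 1) * hermiteVar V n)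

/-- The recursion preserves parity. This is the origin of the vanishing of the odd powers of
N^{-1/2} in the local expansion. -/
theorem coeff_hermiteVar_eq_zero (V : ℝ) (n : ℕ) :
    ∀ j, Odd (n + j) → (hermiteVar V n).coeff j = 0 := by
  induction n using Nat.twoStepInduction with
  | zero =>
    intro j hj
    have : j ≠ 0 := by rintro rfl; simp at hj
    rw [hermiteVar, coeff_one]
    simp [this]
  | one =>
    intro j hj
    have : (1 : ℕ) ≠ j := by rintro rfl; exact absurd hj (by decide)
    rw [hermiteVar, coeff_C_mul, coeff_X, if_neg this, mul_zero]
  | more n ih0 ih1 =>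
    intro j hj
    rw [hermiteVar, coeff_C_mul, coeff_sub, coeff_C_mul, ih0 j (by
      rcases hj with ⟨k, hk⟩; exact ⟨k - 1, by omega⟩)]
    rcases j with _ | j
    · simp
    · rw [coeff_X_mul, ih1 j (by rcases hj with ⟨k, hk⟩; exact ⟨k - 1, by omega⟩)]
      simp

theorem integrable_pow_mul_gaussian {V : ℝ} (hV : 0 < V) (n : ℕ) :
    Integrable fun s : ℝ => (s : ℂ) ^ n * (Real.exp (-(V / 2) * s ^ 2) : ℂ) := by
  refine (integrable_one_add_sq_pow_mul_exp n (half_pos hV)).mono'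
    (Continuous.aestronglyMeasurable (by fun_prop)) (Eventually.of_forall fun s => ?_)
  rw [norm_mul, norm_pow, Complex.norm_real, Complex.norm_real,
    Real.norm_of_nonneg (Real.exp_pos _).le, Real.norm_eq_abs]
  refine mul_le_mul_of_nonneg_right (pow_le_pow_left₀ (abs_nonneg s) ?_ n) (Real.exp_pos _).le
  nlinarith [sq_abs s, sq_nonneg (|s| - 1)]

theorem invFourier_const_mul (c : ℂ) (ψ : ℝ → ℂ) (x : ℝ) :
    invFourier (fun s => c * ψ s) x = c * invFourier ψ x := by
  simp only [invFourier, mul_left_comm _ c]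
  rw [integral_const_mul, mul_left_comm]

theorem invFourier_finset_sum {ι : Type*} (t : Finset ι) {ψ : ι → ℝ → ℂ}
    (h : ∀ i ∈ t, Integrable (ψ i)) (x : ℝ) :
    invFourier (fun s => ∑ i ∈ t, ψ i s) x = ∑ i ∈ t, invFourier (ψ i) x := by
  simp only [invFourier, Finset.mul_sum]
  rw [integral_finsetSum _ fun i hi => integrable_exp_mul (h i hi) x, Finset.mul_sum]

/-- Integration by parts for the moments of the Gaussian. -/
theorem invFourier_pow_gaussian_succ {V : ℝ} (hV : 0 < V) (n : ℕ) (x : ℝ) :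
    V * invFourier (fun s => (s : ℂ) ^ (n + 1) * (Real.exp (-(V / 2) * s ^ 2) : ℂ)) x
      = n * invFourier (fun s => (s : ℂ) ^ (n - 1) * (Real.exp (-(V / 2) * s ^ 2) : ℂ)) x
        - Complex.I * x *
          invFourier (fun s => (s : ℂ) ^ n * (Real.exp (-(V / 2) * s ^ 2) : ℂ)) x := by
  have hi := fun k => integrable_exp_mul (integrable_pow_mul_gaussian hV k) x
  set E : ℝ → ℂ := fun s => (Real.exp (-(V / 2) * s ^ 2) : ℂ) with hE
  set F : ℝ → ℂ := fun s => Complex.exp (-(Complex.I * s * x)) with hF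
  have hd : ∀ s : ℝ, HasDerivAt (fun s : ℝ => F s * ((s : ℂ) ^ n * E s))
      ((n : ℂ) * (F s * ((s : ℂ) ^ (n - 1) * E s))
        - Complex.I * x * (F s * ((s : ℂ) ^ n * E s))
        - V * (F s * ((s : ℂ) ^ (n + 1) * E s))) s := by
    intro s
    have h0 : HasDerivAt (fun s : ℝ => (s : ℂ)) 1 s := Complex.ofRealCLM.hasDerivAt
    have h1 : HasDerivAt F (F s * (-(Complex.I * x))) s := by
      have := (((h0.const_mul Complex.I).mul_const (x : ℂ)).fun_neg).cexp
      rwa [mul_one] at this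
    have h2 : HasDerivAt (fun s : ℝ => (s : ℂ) ^ n) ((n : ℂ) * (s : ℂ) ^ (n - 1)) s := by
      have := h0.fun_pow n
      rwa [mul_one] at this
    have h3 : HasDerivAt E (E s * (-(V : ℂ) * s)) s := by
      have h4 : HasDerivAt (fun s : ℝ => Real.exp (-(V / 2) * s ^ 2))
          (Real.exp (-(V / 2) * s ^ 2) * (-V * s)) s := by
        have h5 := (((hasDerivAt_id' s).fun_pow 2).const_mul (-(V / 2))).exp
        convert h5 using 1
        push_cast
        ring
      have := h4.ofReal_comp
      convert this using 1
      simp only [hE]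
      push_cast
      ring
    exact (h1.fun_mul (h2.fun_mul h3)).congr_deriv (by ring)
  have hint := integral_eq_zero_of_hasDerivAt_of_integrable hd
    ((((hi (n - 1)).const_mul (n : ℂ)).sub ((hi n).const_mul (Complex.I * x))).sub
      ((hi (n + 1)).const_mul (V : ℂ))) (hi n)
  have e : Integrable fun s : ℝ => (n : ℂ) * (F s * ((s : ℂ) ^ (n - 1) * E s))
      - Complex.I * x * (F s * ((s : ℂ) ^ n * E s)) :=
    ((hi (n - 1)).const_mul (n : ℂ)).sub ((hi n).const_mul (Complex.I * x))
  rw [integral_sub e ((hi (n + 1)).const_mul (V : ℂ)),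
    integral_sub ((hi (n - 1)).const_mul (n : ℂ)) ((hi n).const_mul (Complex.I * x)),
    integral_const_mul, integral_const_mul, integral_const_mul] at hint
  simp only [invFourier]
  linear_combination (-((2 * Real.pi : ℝ) : ℂ)⁻¹) * hint

/-- Integration by parts gives a two-step recursion in n, and `hermiteVar` satisfies the same
recursion up to powers of -i. -/
theorem invFourier_pow_gaussian {V : ℝ≥0} (hV : 0 < V) (n : ℕ) (x : ℝ) :
    invFourier (fun s => (s : ℂ) ^ n * (Real.exp (-(V / 2) * s ^ 2) : ℂ)) x
      = (-Complex.I) ^ n * (((hermiteVar V n).eval x * gaussianPDFReal 0 V x : ℝ) : ℂ) := by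
  have hV' : (0 : ℝ) < V := hV
  have hVc : (V : ℂ) ≠ 0 := by exact_mod_cast hV'.ne'
  have hrec := fun n => invFourier_pow_gaussian_succ hV' n x
  have h0 := invFourier_gaussian hV x
  induction n using Nat.twoStepInduction with
  | zero => simpa [hermiteVar] using h0
  | one =>
    have h1 := hrec 0
    simp only [zero_add, Nat.cast_zero, zero_mul, pow_zero, one_mul, zero_sub] at h1
    rw [h0] at h1
    have : (V : ℂ) * ((-Complex.I) ^ 1 *
        (((hermiteVar V 1).eval x * gaussianPDFReal 0 V x : ℝ) : ℂ))
        = -(Complex.I * x * (gaussianPDFReal 0 V x : ℂ)) := by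
      rw [hermiteVar]
      simp only [eval_mul, eval_C, eval_X]
      push_cast
      field_simp
    exact mul_left_cancel₀ hVc (h1.trans this.symm)
  | more n ih0 ih1 =>
    have h1 := hrec (n + 1)
    rw [Nat.add_sub_cancel, ih0, ih1] at h1
    refine mul_left_cancel₀ hVc (h1.trans ?_)
    rw [hermiteVar]
    simp only [eval_mul, eval_C, eval_X, eval_sub]
    push_cast
    field_simp
    have hI : Complex.I ^ 2 = -1 := Complex.I_sq
    rw [pow_add, pow_add]
    linear_combination (((n : ℂ) + 1) * gaussianPDFReal 0 V x *
      (((hermiteVar V n).eval x : ℝ) : ℂ) * (-Complex.I) ^ n) * hI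

/-- The Edgeworth polynomials. -/
noncomputable def edgeworthPoly (V : ℝ) (p q : ℝ[X]) (r j : ℕ) : ℝ[X] :=
  ∑ k ∈ Finset.range (r + 1),
    C ((p ^ k * q).coeff j / k.factorial * (-1) ^ k) * hermiteVar V (j + 2 * k)

theorem coeff_edgeworthPoly_eq_zero (V : ℝ) (p q : ℝ[X]) (r j i : ℕ) (h : Odd (j + i)) :
    (edgeworthPoly V p q r j).coeff i = 0 := by
  rw [edgeworthPoly, finsetSum_coeff]
  refine Finset.sum_eq_zero fun k _ => ?_
  rw [coeff_C_mul, coeff_hermiteVar_eq_zero, mul_zero]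
  rcases h with ⟨a, ha⟩
  exact ⟨a + k, by omega⟩

theorem invFourier_edgeworthFourier {V : ℝ≥0} (hV : 0 < V) (p q : ℝ[X]) (r : ℕ) (h x : ℝ) :
    invFourier (edgeworthFourier V p q r h) x
      = ∑ j ∈ Finset.range (r + 1), (h : ℂ) ^ j *
        (((edgeworthPoly V p q r j).eval x * gaussianPDFReal 0 V x : ℝ) : ℂ) := by
  have hV' : (0 : ℝ) < V := hV
  have h1 : edgeworthFourier V p q r h = fun s : ℝ => ∑ j ∈ Finset.range (r + 1),
      ∑ k ∈ Finset.range (r + 1),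
        ((h : ℂ) ^ j * (Complex.I ^ j * (((p ^ k * q).coeff j / k.factorial : ℝ) : ℂ))) *
          ((s : ℂ) ^ (j + 2 * k) * (Real.exp (-(V / 2) * s ^ 2) : ℂ)) := by
    ext s
    rw [edgeworthFourier, Finset.mul_sum]
    refine Finset.sum_congr rfl fun j _ => ?_
    rw [eval_expCoeff, Complex.ofReal_sum, Finset.mul_sum, Finset.mul_sum, Finset.mul_sum]
    refine Finset.sum_congr rfl fun k _ => ?_
    rw [pow_add, pow_mul]
    push_cast
    ring
  rw [h1, invFourier_finset_sum _ fun j _ => integrable_finsetSum _ fun k _ =>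
    (integrable_pow_mul_gaussian hV' _).const_mul _]
  refine Finset.sum_congr rfl fun j _ => ?_
  rw [invFourier_finset_sum _ fun k _ => (integrable_pow_mul_gaussian hV' _).const_mul _,
    edgeworthPoly, eval_finsetSum, Finset.sum_mul, Complex.ofReal_sum, Finset.mul_sum]
  refine Finset.sum_congr rfl fun k _ => ?_
  rw [invFourier_const_mul, invFourier_pow_gaussian hV]
  -- The powers of i cancel to a sign, so the Edgeworth polynomials are real.
  have hI : Complex.I ^ j * (-Complex.I) ^ (j + 2 * k) = (-1) ^ k := by
    rw [pow_add, ← mul_assoc, ← mul_pow, pow_mul]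
    simp
  simp only [eval_mul, eval_C]
  push_cast
  linear_combination ((h : ℂ) ^ j * (((p ^ k * q).coeff j : ℂ) / k.factorial) *
    ((((hermiteVar V (j + 2 * k)).eval x : ℝ) : ℂ) * gaussianPDFReal 0 V x)) * hI

end Hermite

/-! ### Taylor expansion of Gaussian terms at the origin. -/

section GaussianTaylor

open Polynomial

theorem gaussianPDFReal_zero_eq (V : ℝ≥0) (z : ℝ) :
    gaussianPDFReal 0 V z = gaussianPDFReal 0 V 0 * Real.exp (-(z ^ 2 / (2 * V))) := by
  simp [gaussianPDFReal, neg_div]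

theorem continuous_gaussianPDFReal_zero (V : ℝ≥0) : Continuous (gaussianPDFReal 0 V) := by
  rw [gaussianPDFReal_def]
  fun_prop

theorem abs_pow_mul_exp_le {V : ℝ≥0} (hV : 0 < V) (k : ℕ) (z : ℝ) :
    |z| ^ k * Real.exp (-(z ^ 2 / (2 * V))) ≤ 1 + (2 * V) ^ k * k.factorial := by
  have hV' : (0 : ℝ) < V := hV
  have h1 : |z| ^ k ≤ 1 + (z ^ 2) ^ k := by
    rcases le_total |z| 1 with h | h
    · have := pow_le_one₀ (n := k) (abs_nonneg z) h
      nlinarith [pow_nonneg (sq_nonneg z) k]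
    · have : |z| ^ k ≤ (z ^ 2) ^ k := by
        refine pow_le_pow_left₀ (abs_nonneg z) ?_ k
        nlinarith [sq_abs z]
      linarith
  have h2 := Real.pow_div_factorial_le_exp (z ^ 2 / (2 * V)) (by positivity) k
  rw [div_le_iff₀ (by positivity), div_pow, div_le_iff₀ (by positivity)] at h2
  have h3 : Real.exp (-(z ^ 2 / (2 * V))) ≤ 1 := Real.exp_le_one_iff.mpr (by
    have : 0 ≤ z ^ 2 / (2 * V) := by positivity
    linarith)
  have h4 : Real.exp (z ^ 2 / (2 * V)) * Real.exp (-(z ^ 2 / (2 * V))) = 1 := by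
    rw [← Real.exp_add, add_neg_cancel, Real.exp_zero]
  calc |z| ^ k * Real.exp (-(z ^ 2 / (2 * V)))
      ≤ (1 + Real.exp (z ^ 2 / (2 * V)) * k.factorial * (2 * V) ^ k) *
          Real.exp (-(z ^ 2 / (2 * V))) := by
        refine mul_le_mul_of_nonneg_right (h1.trans ?_) (Real.exp_pos _).le
        linarith
    _ = Real.exp (-(z ^ 2 / (2 * V))) + (2 * V) ^ k * k.factorial *
          (Real.exp (z ^ 2 / (2 * V)) * Real.exp (-(z ^ 2 / (2 * V)))) := by ring
    _ ≤ _ := by rw [h4, mul_one]; linarith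

theorem exists_abs_eval_mul_gaussian_le {V : ℝ≥0} (hV : 0 < V) (g : ℝ[X]) :
    ∃ M : ℝ, 0 ≤ M ∧ ∀ z : ℝ, |g.eval z * gaussianPDFReal 0 V z| ≤ M := by
  have h0 := gaussianPDFReal_nonneg 0 V 0
  refine ⟨(∑ k ∈ Finset.range (g.natDegree + 1), |g.coeff k| * (1 + (2 * V) ^ k * k.factorial)) *
    gaussianPDFReal 0 V 0, by positivity, fun z => ?_⟩
  rw [gaussianPDFReal_zero_eq, mul_left_comm, abs_mul, abs_of_nonneg h0, mul_comm]
  refine mul_le_mul_of_nonneg_right ?_ h0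
  rw [eval_eq_sum_range, Finset.sum_mul]
  refine (Finset.abs_sum_le_sum_abs _ _).trans (Finset.sum_le_sum fun k _ => ?_)
  rw [abs_mul, abs_mul, abs_of_nonneg (Real.exp_pos _).le, abs_pow, mul_assoc]
  exact mul_le_mul_of_nonneg_left (abs_pow_mul_exp_le hV k z) (abs_nonneg _)

/-- The Taylor polynomial of the centered Gaussian density. -/
noncomputable def gaussianTaylor (V : ℝ≥0) (n : ℕ) : ℝ[X] :=
  C (gaussianPDFReal 0 V 0) * ∑ j ∈ Finset.range n, C ((-(2 * V : ℝ)⁻¹) ^ j / j.factorial) * X ^ (2 * j)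

theorem coeff_gaussianTaylor_eq_zero (V : ℝ≥0) (n : ℕ) {i : ℕ} (hi : Odd i) :
    (gaussianTaylor V n).coeff i = 0 := by
  rw [gaussianTaylor, coeff_C_mul, finsetSum_coeff, Finset.sum_eq_zero, mul_zero]
  intro j _
  rw [coeff_C_mul, coeff_X_pow, if_neg, mul_zero]
  rintro rfl
  exact absurd hi (by simp)

/-- The n-th exponential remainder is of order (z²)^n; for |z| ≤ 1 the weaker |z|^n suffices. -/
theorem abs_gaussian_sub_gaussianTaylor_le (V : ℝ≥0) (n : ℕ) {z : ℝ} (hz : |z| ≤ 1) :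
    |gaussianPDFReal 0 V z - (gaussianTaylor V n).eval z|
      ≤ gaussianPDFReal 0 V 0 * ((2 * V : ℝ)⁻¹ ^ n * Real.exp (2 * V : ℝ)⁻¹) * |z| ^ n := by
  have h0 := gaussianPDFReal_nonneg 0 V 0
  have h1 := Complex.norm_exp_sub_sum_le_norm_mul_exp ((-(z ^ 2 / (2 * V)) : ℝ) : ℂ) n
  have h2 : Complex.exp ((-(z ^ 2 / (2 * V)) : ℝ) : ℂ) - ∑ m ∈ Finset.range n,
      ((-(z ^ 2 / (2 * V)) : ℝ) : ℂ) ^ m / (m.factorial : ℂ)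
      = ((Real.exp (-(z ^ 2 / (2 * V))) - ∑ m ∈ Finset.range n,
          (-(z ^ 2 / (2 * V))) ^ m / m.factorial : ℝ) : ℂ) := by
    push_cast
    rfl
  have hz2 : z ^ 2 ≤ 1 := by rw [← sq_abs]; nlinarith [abs_nonneg z]
  have hzz : z ^ 2 ≤ |z| := by rw [← sq_abs]; nlinarith [abs_nonneg z]
  rw [h2, Complex.norm_real, Complex.norm_real, Real.norm_eq_abs, Real.norm_eq_abs, abs_neg,
    abs_of_nonneg (by positivity : 0 ≤ z ^ 2 / (2 * (V : ℝ)))] at h1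
  have h3 : (gaussianTaylor V n).eval z = gaussianPDFReal 0 V 0 *
      ∑ m ∈ Finset.range n, (-(z ^ 2 / (2 * V))) ^ m / m.factorial := by
    rw [gaussianTaylor, eval_mul, eval_C, eval_finsetSum]
    congr 1
    refine Finset.sum_congr rfl fun j _ => ?_
    rw [eval_mul, eval_C, eval_pow, eval_X, pow_mul, div_eq_mul_inv (z ^ 2), ← mul_neg, mul_pow]
    ring
  rw [h3, gaussianPDFReal_zero_eq V z, ← mul_sub, abs_mul, abs_of_nonneg h0, mul_assoc]
  refine mul_le_mul_of_nonneg_left (h1.trans ?_) h0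
  have h4 : z ^ 2 / (2 * (V : ℝ)) ≤ (2 * V : ℝ)⁻¹ := by
    rw [div_eq_mul_inv]
    exact mul_le_of_le_one_left (by positivity) hz2
  have h5 : (z ^ 2 / (2 * (V : ℝ))) ^ n ≤ (2 * V : ℝ)⁻¹ ^ n * |z| ^ n := by
    rw [div_eq_mul_inv, mul_pow, mul_comm]
    gcongr
  calc _ ≤ ((2 * V : ℝ)⁻¹ ^ n * |z| ^ n) * Real.exp (2 * V : ℝ)⁻¹ := by gcongr
    _ = _ := by ring

/-- Taylor expansion, with a global remainder bound, of a polynomial times a Gaussian. -/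
theorem exists_abs_eval_mul_gaussian_sub_le {V : ℝ≥0} (hV : 0 < V) (g : ℝ[X]) (n : ℕ) :
    ∃ C : ℝ, 0 ≤ C ∧ ∀ z : ℝ, |g.eval z * gaussianPDFReal 0 V z -
      ∑ i ∈ Finset.range n, (g * gaussianTaylor V n).coeff i * z ^ i| ≤ C * |z| ^ n := by
  obtain ⟨M, hM0, hM⟩ := exists_abs_eval_mul_gaussian_le hV g
  set G := g * gaussianTaylor V n with hG
  obtain ⟨h, hh⟩ := exists_aeval_eq_trunc_add (R := ℝ) n G
  obtain ⟨C₁, hC₁⟩ := (isCompact_Icc (a := (-1 : ℝ)) (b := 1)).exists_bound_of_continuousOn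
    h.continuous.continuousOn
  obtain ⟨C₂, hC₂⟩ := (isCompact_Icc (a := (-1 : ℝ)) (b := 1)).exists_bound_of_continuousOn
    g.continuous.continuousOn
  set D := gaussianPDFReal 0 V 0 * ((2 * V : ℝ)⁻¹ ^ n * Real.exp (2 * V : ℝ)⁻¹) with hD
  have hD0 : 0 ≤ D := by
    have := gaussianPDFReal_nonneg 0 V 0
    positivity
  set S := ∑ i ∈ Finset.range n, |G.coeff i| with hS
  have hS0 : 0 ≤ S := Finset.sum_nonneg fun _ _ => abs_nonneg _
  refine ⟨|C₁| + |C₂| * D + M + S, by positivity, fun z => ?_⟩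
  have hzn : 0 ≤ |z| ^ n := by positivity
  -- For |z| ≤ 1 this is Taylor's estimate; for |z| ≥ 1 the bounded function and the truncated
  -- polynomial are each at most a constant times |z|^n.
  rcases le_total |z| 1 with hz | hz
  · have hz' : z ∈ Set.Icc (-1 : ℝ) 1 := abs_le.mp hz
    have h1 := hh z
    simp only [coe_aeval_eq_eval, Algebra.algebraMap_self, RingHom.id_apply] at h1
    have h2 : g.eval z * gaussianPDFReal 0 V z - ∑ i ∈ Finset.range n, G.coeff i * z ^ i
        = g.eval z * (gaussianPDFReal 0 V z - (gaussianTaylor V n).eval z) + z ^ n * h.eval z := by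
      have h3 : G.eval z = g.eval z * (gaussianTaylor V n).eval z := by rw [hG, eval_mul]
      linear_combination h1 - h3
    rw [h2]
    calc _ ≤ |g.eval z| * |gaussianPDFReal 0 V z - (gaussianTaylor V n).eval z|
          + |z| ^ n * |h.eval z| := by
          refine (abs_add_le _ _).trans ?_
          rw [abs_mul, abs_mul, abs_pow]
      _ ≤ |C₂| * (D * |z| ^ n) + |z| ^ n * |C₁| := by
          refine add_le_add (mul_le_mul ((hC₂ z hz').trans (le_abs_self _))
            (abs_gaussian_sub_gaussianTaylor_le V n hz) (abs_nonneg _) (abs_nonneg _))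
            (mul_le_mul_of_nonneg_left ((hC₁ z hz').trans (le_abs_self _)) hzn)
      _ ≤ _ := by nlinarith [mul_nonneg hM0 hzn, mul_nonneg hS0 hzn]
  · have h1 : (1 : ℝ) ≤ |z| ^ n := one_le_pow₀ hz
    have h2 : |∑ i ∈ Finset.range n, G.coeff i * z ^ i| ≤ S * |z| ^ n := by
      rw [hS, Finset.sum_mul]
      refine (Finset.abs_sum_le_sum_abs _ _).trans (Finset.sum_le_sum fun i hi => ?_)
      rw [abs_mul, abs_pow]
      exact mul_le_mul_of_nonneg_left
        (pow_le_pow_right₀ hz (Finset.mem_range.mp hi).le) (abs_nonneg _)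
    calc _ ≤ |g.eval z * gaussianPDFReal 0 V z| + |∑ i ∈ Finset.range n, G.coeff i * z ^ i| :=
          abs_sub _ _
      _ ≤ M * |z| ^ n + S * |z| ^ n := add_le_add ((hM z).trans (le_mul_of_one_le_right hM0 h1)) h2
      _ ≤ _ := by
          have : 0 ≤ (|C₁| + |C₂| * D) * |z| ^ n := by positivity
          linarith

theorem coeff_mul_gaussianTaylor_eq_zero (V : ℝ≥0) (n : ℕ) {g : ℝ[X]} {a : ℕ}
    (hg : ∀ i, Odd (a + i) → g.coeff i = 0) {i : ℕ} (hi : Odd (a + i)) :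
    (g * gaussianTaylor V n).coeff i = 0 := by
  rw [coeff_mul]
  refine Finset.sum_eq_zero fun x hx => ?_
  rw [Finset.HasAntidiagonal.mem_antidiagonal] at hx
  rcases Nat.even_or_odd x.2 with h | h
  · rw [hg, zero_mul]
    rcases h with ⟨b, hb⟩
    rcases hi with ⟨c, hc⟩
    exact ⟨c - b, by omega⟩
  · rw [coeff_gaussianTaylor_eq_zero V n h, mul_zero]

theorem sum_range_eq_sum_even {M : Type*} [AddCommMonoid M] {a : ℕ → M}
    (ha : ∀ m, Odd m → a m = 0) (r : ℕ) :
    ∑ m ∈ Finset.range (r + 1), a m = ∑ q ∈ Finset.range (r / 2 + 1), a (2 * q) := by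
  induction r with
  | zero => simp
  | succ r ih =>
    rw [Finset.sum_range_succ, ih]
    rcases Nat.even_or_odd (r + 1) with h | h
    · obtain ⟨k, hk⟩ := h
      have h1 : (r + 1) / 2 = r / 2 + 1 := by omega
      rw [h1, Finset.sum_range_succ _ (r / 2 + 1)]
      congr 2
      omega
    · obtain ⟨k, hk⟩ := h
      have h1 : (r + 1) / 2 = r / 2 := by omega
      rw [ha _ ⟨k, hk⟩, add_zero, h1]

end GaussianTaylor

/-! ### Integrability and boundedness of test functions. -/

section FunctionSpace

variable {k : ℕ} {f : ℝ → ℂ}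

theorem eLpNorm_pow_mul_le (f : ℝ → ℂ) (m : ℕ) {j k : ℕ} (hj : j ≤ k) :
    eLpNorm (fun x : ℝ => (x : ℂ) ^ j * f x) 1 volume ≤ eCNorm m k f :=
  (Finset.le_sup (f := fun j => eLpNorm (fun x : ℝ => (x : ℂ) ^ j * f x) 1 volume)
    (Finset.mem_range_succ_iff.mpr hj)).trans le_add_self

theorem integrable_pow_mul_of_mem (hf : f ∈ FSpace 1 k) {j : ℕ} (hj : j ≤ k) :
    Integrable fun x : ℝ => (x : ℂ) ^ j * f x := by
  have hc : Continuous f := hf.1.continuous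
  rw [← memLp_one_iff_integrable]
  exact ⟨Continuous.aestronglyMeasurable (by fun_prop),
    (eLpNorm_pow_mul_le f 1 hj).trans_lt hf.2⟩

theorem integral_norm_pow_mul_le (hf : f ∈ FSpace 1 k) {j : ℕ} (hj : j ≤ k) :
    ∫ x : ℝ, |x| ^ j * ‖f x‖ ≤ CNorm 1 k f := by
  have h1 : ∫ x : ℝ, |x| ^ j * ‖f x‖ = ∫ x : ℝ, ‖(x : ℂ) ^ j * f x‖ := by
    simp only [norm_mul, norm_pow, Complex.norm_real, Real.norm_eq_abs]
  rw [h1, integral_norm_eq_lintegral_enorm (integrable_pow_mul_of_mem hf hj).aestronglyMeasurable,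
    ← eLpNorm_one_eq_lintegral_enorm]
  exact ENNReal.toReal_mono hf.2.ne (eLpNorm_pow_mul_le f 1 hj)

theorem integrable_of_mem (hf : f ∈ FSpace 1 k) : Integrable f := by
  simpa using integrable_pow_mul_of_mem hf (Nat.zero_le k)

theorem integral_norm_le (hf : f ∈ FSpace 1 k) : ∫ x : ℝ, ‖f x‖ ≤ CNorm 1 k f := by
  simpa using integral_norm_pow_mul_le hf (Nat.zero_le k)

/-- Since f' is integrable, f(x) = f(0) + ∫ f' is bounded. This makes the expectations converge and
allows the inversion formula. -/
theorem exists_norm_le_of_mem (hf : f ∈ FSpace 1 k) : ∃ M : ℝ, ∀ x, ‖f x‖ ≤ M := by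
  have hd : ∀ x, HasDerivAt f (deriv f x) x := fun x =>
    (hf.1.differentiable (by simp) x).hasDerivAt
  have hcd : Continuous (deriv f) := hf.1.continuous_deriv (by simp)
  have hi : Integrable (deriv f) := by
    rw [← memLp_one_iff_integrable]
    refine ⟨hcd.aestronglyMeasurable, lt_of_le_of_lt ?_ hf.2⟩
    have h1 : eLpNorm (iteratedDeriv 1 f) 1 volume ≤ eCNorm 1 k f :=
      (Finset.le_sup (f := fun j => eLpNorm (iteratedDeriv j f) 1 volume)
        (Finset.mem_range_succ_iff.mpr le_rfl)).trans le_self_add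
    rwa [iteratedDeriv_one] at h1
  refine ⟨‖f 0‖ + ∫ x, ‖deriv f x‖, fun x => ?_⟩
  have h2 : ∫ y in (0 : ℝ)..x, deriv f y = f x - f 0 :=
    intervalIntegral.integral_eq_sub_of_hasDerivAt (fun y _ => hd y) (hcd.intervalIntegrable _ _)
  have h3 : ‖f x - f 0‖ ≤ ∫ x, ‖deriv f x‖ := by
    rw [← h2]
    exact intervalIntegral.norm_integral_le_integral_norm_uIoc.trans
      (setIntegral_le_integral hi.norm (Eventually.of_forall fun _ => norm_nonneg _))
  calc ‖f x‖ = ‖f 0 + (f x - f 0)‖ := by rw [add_sub_cancel]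
    _ ≤ _ := (norm_add_le _ _).trans (by linarith)

end FunctionSpace

/-! ### The central limit theorem. -/

section CentralLimit

theorem tendsto_rescale {Φ : ℕ → ℝ → ℂ} {μ Z χ : ℝ → ℂ} {A V C θ : ℝ} (hθ0 : 0 < θ) (hθ1 : θ < 1)
    (happ : ∀ᶠ t in 𝓝 (0 : ℝ), ∀ N : ℕ, 1 ≤ N → ‖Φ N t - μ t ^ N * Z t‖ ≤ C * θ ^ N)
    (hμ : ∀ᶠ u in 𝓝 (0 : ℝ), μ u =
        Complex.exp (Complex.I * A * u - V / 2 * (u : ℂ) ^ 2 + (u : ℂ) ^ 2 * χ u))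
    (hχ : Tendsto χ (𝓝 0) (𝓝 0)) (hZ : Tendsto Z (𝓝 0) (𝓝 1)) (s : ℝ) :
    Tendsto (fun N => rescale A Φ N s) atTop (𝓝 (Real.exp (-(V / 2) * s ^ 2) : ℂ)) := by
  have ht := tendsto_inv_sqrt_mul s
  have h1 : Tendsto (fun N : ℕ => (Real.exp (-(V / 2) * s ^ 2) : ℂ) *
      Complex.exp ((s ^ 2 : ℝ) * χ ((√(N : ℝ))⁻¹ * s)) * Z ((√(N : ℝ))⁻¹ * s)) atTop
      (𝓝 ((Real.exp (-(V / 2) * s ^ 2) : ℂ) * Complex.exp ((s ^ 2 : ℝ) * 0) * 1)) :=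
    ((((hχ.comp ht).const_mul _).cexp).const_mul _).mul (hZ.comp ht)
  rw [mul_zero, Complex.exp_zero, mul_one, mul_one] at h1
  have h2 : Tendsto (fun N : ℕ => C * θ ^ N) atTop (𝓝 0) := by
    simpa using (tendsto_pow_atTop_nhds_zero_of_lt_one hθ0.le hθ1).const_mul C
  have h3 : Tendsto (fun N : ℕ => rescale A Φ N s - (Real.exp (-(V / 2) * s ^ 2) : ℂ) *
      Complex.exp ((s ^ 2 : ℝ) * χ ((√(N : ℝ))⁻¹ * s)) * Z ((√(N : ℝ))⁻¹ * s)) atTop (𝓝 0) := by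
    refine squeeze_zero_norm' ?_ h2
    filter_upwards [ht.eventually happ, ht.eventually hμ, eventually_ge_atTop 1] with N hN1 hN2 hN
    rw [← rescaled_leading_term hN hN2, mul_assoc, rescale, ← mul_sub, norm_mul]
    have : -(Complex.I * A * √(N : ℝ) * s) = ((-(A * √(N : ℝ) * s) : ℝ) : ℂ) * Complex.I := by
      push_cast; ring
    rw [this, Complex.norm_exp_ofReal_mul_I, one_mul]
    exact hN1 N hN
  simpa using h3.add h1

theorem charFun_map_eq_rescale {Ω : Type*} [MeasurableSpace Ω] (P : Measure Ω) {S : ℕ → Ω → ℝ}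
    {Φ : ℕ → ℝ → ℂ} (A : ℝ) {N : ℕ} (hS : AEMeasurable (S N) P)
    (hΦ : ∀ t : ℝ, ∫ ω, Complex.exp (Complex.I * t * S N ω) ∂P = Φ N t) (hN : 1 ≤ N) (s : ℝ) :
    charFun (P.map fun ω => (S N ω - N * A) / √(N : ℝ)) s = rescale A Φ N s := by
  have hN0 : (0 : ℝ) < N := by exact_mod_cast hN
  have hs : (√(N : ℝ) : ℂ) ≠ 0 := by exact_mod_cast (Real.sqrt_pos.mpr hN0).ne'
  have hs2 : (N : ℂ) = (√(N : ℝ) : ℂ) ^ 2 := by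
    rw [← Complex.ofReal_pow, Real.sq_sqrt hN0.le, Complex.ofReal_natCast]
  rw [charFun_apply_real, integral_map (by fun_prop) (Continuous.aestronglyMeasurable (by fun_prop)),
    rescale, ← hΦ, ← integral_const_mul]
  congr 1
  ext ω
  rw [← Complex.exp_add]
  congr 1
  push_cast
  rw [hs2]
  field_simp
  ring

/-- Lévy's continuity theorem; the degenerate case V = 0 is covered as well. -/
theorem tendstoInDistribution_of_rescale {Ω : Type*} [MeasurableSpace Ω] {P : Measure Ω}
    [IsProbabilityMeasure P] {S : ℕ → Ω → ℝ} {Φ : ℕ → ℝ → ℂ} {A : ℝ} {V : ℝ≥0}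
    (hS : ∀ N, AEMeasurable (S N) P)
    (hΦ : ∀ N, 1 ≤ N → ∀ t : ℝ, ∫ ω, Complex.exp (Complex.I * t * S N ω) ∂P = Φ N t)
    (h : ∀ s : ℝ, Tendsto (fun N => rescale A Φ N s) atTop (𝓝 (Real.exp (-(V / 2) * s ^ 2) : ℂ))) :
    TendstoInDistribution (fun (N : ℕ) ω => (S N ω - N * A) / √(N : ℝ)) atTop (id : ℝ → ℝ)
      (fun _ => P) (gaussianReal 0 V) where
  forall_aemeasurable N := by have := hS N; fun_prop
  tendsto := by
    refine ProbabilityMeasure.tendsto_iff_tendsto_charFun.2 fun s => ?_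
    have h1 : charFun ((gaussianReal 0 V).map id) s = (Real.exp (-(V / 2) * s ^ 2) : ℂ) := by
      rw [Measure.map_id, charFun_gaussianReal]
      push_cast
      congr 1
      simp
      ring
    refine Tendsto.congr' ?_ ((h s).trans_eq ?_)
    · filter_upwards [eventually_ge_atTop 1] with N hN
      exact (charFun_map_eq_rescale P A (hS N) (hΦ N hN) hN s).symm
    · exact congrArg 𝓝 h1.symm

end CentralLimit

/-! ### From Fourier estimates to expansions of integrals. -/

section Expansion

open Polynomial

theorem integrable_gaussian_mul {V : ℝ≥0} (hV : 0 < V) (g : ℝ[X]) {f : ℝ → ℂ} (hf : Integrable f)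
    {a : ℝ} (ha : 0 < a) :
    Integrable fun z : ℝ => ((g.eval z * gaussianPDFReal 0 V z : ℝ) : ℂ) * f (z * a) := by
  obtain ⟨M, -, hM⟩ := exists_abs_eval_mul_gaussian_le hV g
  refine (hf.comp_mul_right' ha.ne').bdd_mul (c := M) ?_ (Eventually.of_forall fun z => ?_)
  · have := continuous_gaussianPDFReal_zero V
    exact Continuous.aestronglyMeasurable (by fun_prop)
  · rw [Complex.norm_real]
    exact hM z

/-- Applied to z ↦ f(z a), the inversion bound carries the L¹ norm a⁻¹ ‖f‖₁; with a = √N this is the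
extra half power of N in the global error. -/
theorem norm_integral_sub_edgeworth_le {m : Measure ℝ} [IsProbabilityMeasure m]
    (hm : Integrable (charFun m)) {V : ℝ≥0} (hV : 0 < V) (p q : ℝ[X]) (r : ℕ) {a : ℝ} (ha : 1 ≤ a)
    {f : ℝ → ℂ} (hf : Continuous f) (hfi : Integrable f) {M : ℝ} (hfM : ∀ x, ‖f x‖ ≤ M) :
    ‖∫ z, f (z * a) ∂m - ∑ j ∈ Finset.range (r + 1), ((a⁻¹ : ℝ) : ℂ) ^ j *
        ∫ z : ℝ, (((edgeworthPoly V p q r j).eval z * gaussianPDFReal 0 V z : ℝ) : ℂ) * f (z * a)‖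
      ≤ (∫ x, ‖f x‖) * (a⁻¹ * ∫ s, ‖charFun m s - edgeworthFourier V p q r a⁻¹ s‖) := by
  have ha0 : 0 < a := by linarith
  have hh : |a⁻¹| ≤ 1 := by
    rw [abs_of_pos (inv_pos.mpr ha0)]
    exact inv_le_one_of_one_le₀ ha
  have h1 := norm_integral_sub_le hm (integrable_edgeworthFourier (V := V) hV p q r hh)
    (f := fun z => f (z * a)) (by fun_prop) (hfi.comp_mul_right' ha0.ne') (fun x => hfM _)
  have h2 : ∫ x, f (x * a) * invFourier (edgeworthFourier V p q r a⁻¹) x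
      = ∑ j ∈ Finset.range (r + 1), ((a⁻¹ : ℝ) : ℂ) ^ j *
        ∫ z : ℝ, (((edgeworthPoly V p q r j).eval z * gaussianPDFReal 0 V z : ℝ) : ℂ) *
          f (z * a) := by
    simp only [invFourier_edgeworthFourier hV, Finset.mul_sum, ← integral_const_mul]
    rw [← integral_finsetSum _ fun j _ => (integrable_gaussian_mul hV _ hfi ha0).const_mul _]
    congr 1
    ext z
    exact Finset.sum_congr rfl fun j _ => by ring
  rw [h2, Measure.integral_comp_mul_right (fun x => ‖f x‖), abs_of_pos (inv_pos.mpr ha0),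
    smul_eq_mul] at h1
  refine h1.trans ?_
  have h3 : (2 * Real.pi)⁻¹ ≤ 1 := inv_le_one_of_one_le₀ (by linarith [Real.pi_gt_three])
  have h4 : 0 ≤ ∫ x, ‖f x‖ := integral_nonneg fun _ => norm_nonneg _
  have h5 : 0 ≤ ∫ s, ‖charFun m s - edgeworthFourier V p q r a⁻¹ s‖ :=
    integral_nonneg fun _ => norm_nonneg _
  calc _ = (∫ x, ‖f x‖) * (a⁻¹ * ((2 * Real.pi)⁻¹ *
          ∫ s, ‖charFun m s - edgeworthFourier V p q r a⁻¹ s‖)) := by ring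
    _ ≤ (∫ x, ‖f x‖) * (a⁻¹ * (1 *
          ∫ s, ‖charFun m s - edgeworthFourier V p q r a⁻¹ s‖)) := by gcongr
    _ = _ := by rw [one_mul]

/-- The polynomials of the local expansion. -/
noncomputable def localPoly (V : ℝ≥0) (g : ℕ → ℝ[X]) (r m : ℕ) : ℝ[X] :=
  ∑ j ∈ Finset.range (m + 1),
    monomial (m - j) ((g j * gaussianTaylor V (r + 1 - j)).coeff (m - j))

theorem localPoly_eq_zero {V : ℝ≥0} {g : ℕ → ℝ[X]} (hg : ∀ j i, Odd (j + i) → (g j).coeff i = 0)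
    (r : ℕ) {m : ℕ} (hm : Odd m) : localPoly V g r m = 0 := by
  refine Finset.sum_eq_zero fun j hj => ?_
  rw [coeff_mul_gaussianTaylor_eq_zero V _ (hg j), monomial_zero_right]
  rwa [Nat.add_sub_cancel' (Finset.mem_range_succ_iff.mp hj)]

/-- Regrouping by the total power m = i + j of h; truncating the j-th Taylor expansion below r + 1 -
j keeps exactly the terms with m ≤ r. -/
theorem sum_localPoly (V : ℝ≥0) (g : ℕ → ℝ[X]) (r : ℕ) (h x : ℝ) :
    ∑ m ∈ Finset.range (r + 1), h ^ m * (localPoly V g r m).eval x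
      = ∑ j ∈ Finset.range (r + 1), h ^ j * ∑ i ∈ Finset.range (r + 1 - j),
          (g j * gaussianTaylor V (r + 1 - j)).coeff i * (h * x) ^ i := by
  have h1 := Finset.sum_range_diag_flip (r + 1) fun j i =>
    h ^ j * ((g j * gaussianTaylor V (r + 1 - j)).coeff i * (h * x) ^ i)
  simp only [Finset.mul_sum]
  rw [← h1]
  refine Finset.sum_congr rfl fun m _ => ?_
  rw [localPoly, eval_finsetSum, Finset.mul_sum]
  refine Finset.sum_congr rfl fun j hj => ?_
  rw [eval_monomial, mul_pow]
  have : h ^ m = h ^ j * h ^ (m - j) := by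
    rw [← pow_add, Nat.add_sub_cancel' (Finset.mem_range_succ_iff.mp hj)]
  rw [this]
  ring

theorem natDegree_localPoly_le (V : ℝ≥0) (g : ℕ → ℝ[X]) (r m : ℕ) :
    (localPoly V g r m).natDegree ≤ m :=
  natDegree_sum_le_of_forall_le _ _ fun j _ => (natDegree_monomial_le _).trans (Nat.sub_le m j)

theorem integrable_eval_mul {f : ℝ → ℂ} {g : ℝ[X]} {n : ℕ} (hg : g.natDegree ≤ n)
    (hf : ∀ j ≤ n, Integrable fun x : ℝ => (x : ℂ) ^ j * f x) :
    Integrable fun x : ℝ => ((g.eval x : ℝ) : ℂ) * f x := by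
  have h1 : (fun x : ℝ => ((g.eval x : ℝ) : ℂ) * f x) = fun x : ℝ =>
      ∑ j ∈ Finset.range (g.natDegree + 1), (g.coeff j : ℂ) * ((x : ℂ) ^ j * f x) := by
    ext x
    rw [eval_eq_sum_range, Complex.ofReal_sum, Finset.sum_mul]
    refine Finset.sum_congr rfl fun j _ => ?_
    push_cast
    ring
  rw [h1]
  exact integrable_finsetSum _ fun j hj =>
    (hf j ((Finset.mem_range_succ_iff.mp hj).trans hg)).const_mul _

/-- The local expansion of the Gaussian terms. -/
theorem exists_norm_edgeworth_sub_local_le {V : ℝ≥0} (hV : 0 < V) {g : ℕ → ℝ[X]}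
    (hg : ∀ j i, Odd (j + i) → (g j).coeff i = 0) (r : ℕ) :
    ∃ C : ℝ, 0 ≤ C ∧ ∀ a : ℝ, 0 < a → ∀ f : ℝ → ℂ, ∀ M : ℝ,
      (∀ j ≤ r + 1, Integrable fun x : ℝ => (x : ℂ) ^ j * f x) →
      (∀ j ≤ r + 1, ∫ x : ℝ, |x| ^ j * ‖f x‖ ≤ M) →
      ‖(a : ℂ) * (∑ j ∈ Finset.range (r + 1), ((a⁻¹ : ℝ) : ℂ) ^ j *
          ∫ z : ℝ, (((g j).eval z * gaussianPDFReal 0 V z : ℝ) : ℂ) * f (z * a)) -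
        ∑ k ∈ Finset.range (r / 2 + 1), ((a⁻¹ : ℝ) : ℂ) ^ (2 * k) *
          ∫ x : ℝ, (((localPoly V g r (2 * k)).eval x : ℝ) : ℂ) * f x‖
      ≤ M * (C * a⁻¹ ^ (r + 1)) := by
  -- Truncating at order r + 1 - j makes the j-th remainder h^j |h x|^{r+1-j} = h^{r+1} |x|^{r+1-j}:
  -- every j contributes the same power of h, at the price of moments of f up to r + 1.
  choose C hC0 hC using fun j => exists_abs_eval_mul_gaussian_sub_le hV (g j) (r + 1 - j)
  refine ⟨∑ j ∈ Finset.range (r + 1), C j, Finset.sum_nonneg fun j _ => hC0 j,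
    fun a ha f M hf hM => ?_⟩
  set h := a⁻¹ with hh
  have hh0 : 0 < h := inv_pos.mpr ha
  have hfi : Integrable f := by simpa using hf 0 (Nat.zero_le _)
  have hnorm : ∀ j ≤ r + 1, Integrable fun x : ℝ => |x| ^ j * ‖f x‖ := fun j hj => by
    simpa only [norm_mul, norm_pow, Complex.norm_real, Real.norm_eq_abs] using (hf j hj).norm
  have hW : ∀ j, Integrable fun x : ℝ =>
      (((g j).eval (h * x) * gaussianPDFReal 0 V (h * x) : ℝ) : ℂ) * f x := fun j => by
    have h1 := (integrable_gaussian_mul hV (g j) hfi ha).comp_mul_left' hh0.ne'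
    refine h1.congr (Eventually.of_forall fun x => ?_)
    simp only
    rw [mul_right_comm h, hh, inv_mul_cancel₀ ha.ne', one_mul]
  have h1 : ∀ j, (a : ℂ) * ∫ z : ℝ, (((g j).eval z * gaussianPDFReal 0 V z : ℝ) : ℂ) * f (z * a)
      = ∫ x : ℝ, (((g j).eval (h * x) * gaussianPDFReal 0 V (h * x) : ℝ) : ℂ) * f x := fun j => by
    have h2 := Measure.integral_comp_inv_mul_left (fun z : ℝ =>
      (((g j).eval z * gaussianPDFReal 0 V z : ℝ) : ℂ) * f (z * a)) a
    rw [abs_of_pos ha, Complex.real_smul] at h2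
    rw [← h2]
    congr 1
    ext x
    rw [mul_right_comm a⁻¹, inv_mul_cancel₀ ha.ne', one_mul]
  have hL : ∀ m ≤ r, Integrable fun x : ℝ => (((localPoly V g r m).eval x : ℝ) : ℂ) * f x :=
    fun m hm => integrable_eval_mul ((natDegree_localPoly_le V g r m).trans hm)
      fun j hj => hf j (by omega)
  have h3 : (a : ℂ) * ∑ j ∈ Finset.range (r + 1), (h : ℂ) ^ j *
          ∫ z : ℝ, (((g j).eval z * gaussianPDFReal 0 V z : ℝ) : ℂ) * f (z * a)
      = ∫ x : ℝ, ∑ j ∈ Finset.range (r + 1), (h : ℂ) ^ j *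
          ((((g j).eval (h * x) * gaussianPDFReal 0 V (h * x) : ℝ) : ℂ) * f x) := by
    rw [integral_finsetSum _ fun j _ => (hW j).const_mul _, Finset.mul_sum]
    refine Finset.sum_congr rfl fun j _ => ?_
    rw [integral_const_mul, ← h1, mul_left_comm]
  have h4 : ∑ k ∈ Finset.range (r / 2 + 1), (h : ℂ) ^ (2 * k) *
          ∫ x : ℝ, (((localPoly V g r (2 * k)).eval x : ℝ) : ℂ) * f x
      = ∫ x : ℝ, ∑ m ∈ Finset.range (r + 1), (h : ℂ) ^ m *
          ((((localPoly V g r m).eval x : ℝ) : ℂ) * f x) := by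
    rw [integral_finsetSum _ fun m hm =>
      (hL m (Finset.mem_range_succ_iff.mp hm)).const_mul _]
    simp only [integral_const_mul]
    refine (sum_range_eq_sum_even (a := fun m => (h : ℂ) ^ m *
      ∫ x : ℝ, (((localPoly V g r m).eval x : ℝ) : ℂ) * f x) (fun m hm => ?_) r).symm
    simp [localPoly_eq_zero hg r hm]
  rw [h3, h4, ← integral_sub (integrable_finsetSum _ fun j _ => (hW j).const_mul _)
    (integrable_finsetSum _ fun m hm => (hL m (Finset.mem_range_succ_iff.mp hm)).const_mul _)]
  have h5 : ∀ x : ℝ, ‖∑ j ∈ Finset.range (r + 1), (h : ℂ) ^ j *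
          ((((g j).eval (h * x) * gaussianPDFReal 0 V (h * x) : ℝ) : ℂ) * f x) -
        ∑ m ∈ Finset.range (r + 1), (h : ℂ) ^ m * ((((localPoly V g r m).eval x : ℝ) : ℂ) * f x)‖
      ≤ ∑ j ∈ Finset.range (r + 1), (C j * h ^ (r + 1)) * (|x| ^ (r + 1 - j) * ‖f x‖) := by
    intro x
    have h6 : ∑ j ∈ Finset.range (r + 1), (h : ℂ) ^ j *
          ((((g j).eval (h * x) * gaussianPDFReal 0 V (h * x) : ℝ) : ℂ) * f x) -
        ∑ m ∈ Finset.range (r + 1), (h : ℂ) ^ m * ((((localPoly V g r m).eval x : ℝ) : ℂ) * f x)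
        = ((∑ j ∈ Finset.range (r + 1), h ^ j * ((g j).eval (h * x) * gaussianPDFReal 0 V (h * x) -
          ∑ i ∈ Finset.range (r + 1 - j),
            (g j * gaussianTaylor V (r + 1 - j)).coeff i * (h * x) ^ i) : ℝ) : ℂ) * f x := by
      simp only [mul_sub, Finset.sum_sub_distrib]
      rw [← sum_localPoly]
      push_cast
      simp only [sub_mul, Finset.sum_mul]
      congr 1 <;> exact Finset.sum_congr rfl fun j _ => by ring
    rw [h6, norm_mul, Complex.norm_real, Real.norm_eq_abs]
    refine (mul_le_mul_of_nonneg_right (Finset.abs_sum_le_sum_abs _ _) (norm_nonneg _)).trans ?_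
    rw [Finset.sum_mul]
    refine Finset.sum_le_sum fun j hj => ?_
    have hj' : j ≤ r + 1 := (Finset.mem_range.mp hj).le
    have h7 : h ^ (r + 1) = h ^ j * h ^ (r + 1 - j) := by
      rw [← pow_add, Nat.add_sub_cancel' hj']
    calc _ ≤ (h ^ j * (C j * |h * x| ^ (r + 1 - j))) * ‖f x‖ := by
          rw [abs_mul, abs_of_nonneg (pow_nonneg hh0.le j)]
          exact mul_le_mul_of_nonneg_right
            (mul_le_mul_of_nonneg_left (hC j _) (pow_nonneg hh0.le j)) (norm_nonneg _)
      _ = _ := by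
          rw [abs_mul, abs_of_pos hh0, mul_pow, h7]
          ring
  refine (norm_integral_le_of_norm_le (integrable_finsetSum _ fun j _ =>
    (hnorm _ (Nat.sub_le _ _)).const_mul _) (Eventually.of_forall h5)).trans ?_
  rw [integral_finsetSum _ fun j _ => (hnorm _ (Nat.sub_le _ _)).const_mul _, Finset.sum_mul,
    Finset.mul_sum]
  refine Finset.sum_le_sum fun j _ => ?_
  rw [integral_const_mul, mul_comm M]
  exact mul_le_mul_of_nonneg_left (hM _ (Nat.sub_le _ _)) (mul_nonneg (hC0 j) (by positivity))

end Expansion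

/-! ### The two weak Edgeworth expansions. -/

section Conclusion

open Polynomial

theorem inv_sqrt_pow_eq_rpow {x : ℝ} (hx : 0 ≤ x) (m : ℕ) :
    (√x)⁻¹ ^ m = x ^ (-(m : ℝ) / 2) := by
  rw [Real.sqrt_eq_rpow, ← Real.rpow_neg hx, ← Real.rpow_natCast, ← Real.rpow_mul hx]
  congr 1
  ring

theorem one_div_rpow_eq_inv_sqrt_pow {x : ℝ} (hx : 0 ≤ x) (m : ℕ) :
    1 / x ^ ((m : ℝ) / 2) = (√x)⁻¹ ^ m := by
  rw [inv_sqrt_pow_eq_rpow hx, neg_div, Real.rpow_neg hx, one_div]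

theorem one_div_pow_eq_inv_sqrt_pow {x : ℝ} (hx : 0 ≤ x) (m : ℕ) :
    1 / x ^ m = (√x)⁻¹ ^ (2 * m) := by
  rw [pow_mul, inv_pow, Real.sq_sqrt hx, inv_pow, one_div]

variable {Ω : Type*} [MeasurableSpace Ω] {P : Measure Ω} [IsProbabilityMeasure P]
  {S : ℕ → Ω → ℝ} {Φ : ℕ → ℝ → ℂ} {A : ℝ} {V : ℝ≥0} {p q : ℝ[X]} {r : ℕ}

theorem integrable_comp_of_mem (hS : ∀ N, AEMeasurable (S N) P) {k : ℕ} {f : ℝ → ℂ}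
    (hf : f ∈ FSpace 1 k) (N : ℕ) : Integrable (fun ω => f (S N ω - N * A)) P := by
  obtain ⟨M, hM⟩ := exists_norm_le_of_mem hf
  have := hS N
  refine Integrable.of_bound (C := M) ?_ (Eventually.of_forall fun ω => hM _)
  exact hf.1.continuous.comp_aestronglyMeasurable
    (AEMeasurable.aestronglyMeasurable (by fun_prop))

theorem norm_integral_comp_sub_edgeworth_le (hS : ∀ N, AEMeasurable (S N) P)
    (hΦ : ∀ N, 1 ≤ N → ∀ t : ℝ, ∫ ω, Complex.exp (Complex.I * t * S N ω) ∂P = Φ N t)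
    (hV : 0 < V) (p q : ℝ[X]) (r : ℕ) {N : ℕ} (hN : 1 ≤ N) (hi : Integrable (rescale A Φ N))
    {k : ℕ} {f : ℝ → ℂ} (hf : f ∈ FSpace 1 k) :
    ‖(∫ ω, f (S N ω - N * A) ∂P) - ∑ j ∈ Finset.range (r + 1), (((√(N : ℝ))⁻¹ : ℝ) : ℂ) ^ j *
        ∫ z : ℝ, (((edgeworthPoly V p q r j).eval z * gaussianPDFReal 0 V z : ℝ) : ℂ) *
          f (z * √(N : ℝ))‖
      ≤ CNorm 1 k f * ((√(N : ℝ))⁻¹ ^ (r + 1) * ∫ s, √(N : ℝ) ^ r *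
          ‖rescale A Φ N s - edgeworthFourier V p q r (√(N : ℝ))⁻¹ s‖) := by
  have hN1 : (1 : ℝ) ≤ N := by exact_mod_cast hN
  have hs1 : 1 ≤ √(N : ℝ) := Real.one_le_sqrt.mpr hN1
  have hs0 : 0 < √(N : ℝ) := by linarith
  obtain ⟨M, hM⟩ := exists_norm_le_of_mem hf
  have hSN := hS N
  have hmeas : AEMeasurable (fun ω => (S N ω - N * A) / √(N : ℝ)) P := by fun_prop
  have hprob := Measure.isProbabilityMeasure_map hmeas
  have hc : charFun (P.map fun ω => (S N ω - N * A) / √(N : ℝ)) = rescale A Φ N :=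
    funext (charFun_map_eq_rescale P A hSN (hΦ N hN) hN)
  have h1 := norm_integral_sub_edgeworth_le (hc ▸ hi) hV p q r hs1 hf.1.continuous
    (integrable_of_mem hf) hM
  have hfc := hf.1.continuous
  rw [integral_map hmeas (Continuous.aestronglyMeasurable (by fun_prop)), hc] at h1
  simp only [div_mul_cancel₀ _ hs0.ne'] at h1
  refine h1.trans ?_
  have h2 : 0 ≤ ∫ s, ‖rescale A Φ N s - edgeworthFourier V p q r (√(N : ℝ))⁻¹ s‖ :=
    integral_nonneg fun _ => norm_nonneg _
  have h3 : (√(N : ℝ))⁻¹ ^ (r + 1) * √(N : ℝ) ^ r = (√(N : ℝ))⁻¹ := by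
    rw [pow_succ, mul_right_comm, ← mul_pow, inv_mul_cancel₀ hs0.ne', one_pow, one_mul]
  rw [integral_const_mul, ← mul_assoc _ (√(N : ℝ) ^ r), h3]
  exact mul_le_mul_of_nonneg_right (integral_norm_le hf) (by positivity)

theorem admitsWeakGlobalExpansion_of_tendsto
    (hS : ∀ N, AEMeasurable (S N) P)
    (hΦ : ∀ N, 1 ≤ N → ∀ t : ℝ, ∫ ω, Complex.exp (Complex.I * t * S N ω) ∂P = Φ N t) (hV : 0 < V)
    (hlim : Tendsto (fun N : ℕ => ∫ s : ℝ, √(N : ℝ) ^ r *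
      ‖rescale A Φ N s - edgeworthFourier V p q r (√(N : ℝ))⁻¹ s‖) atTop (𝓝 0))
    (hint : ∀ᶠ N : ℕ in atTop, Integrable (rescale A Φ N)) :
    AdmitsWeakGlobalExpansion P S A V r (FSpace 1 0) (CNorm 1 0) := by
  refine ⟨edgeworthPoly V p q r, fun f hf N hN => ⟨integrable_comp_of_mem hS hf N, fun j _ =>
    integrable_gaussian_mul hV _ (integrable_of_mem hf)
      (Real.sqrt_pos.mpr (by exact_mod_cast hN))⟩, fun ε hε => ?_⟩
  filter_upwards [hlim.eventually_lt_const hε, hint, eventually_ge_atTop 1] with N h1 h2 hN f hf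
  have hN0 : (0 : ℝ) ≤ N := Nat.cast_nonneg N
  have h3 := norm_integral_comp_sub_edgeworth_le hS hΦ hV p q r hN h2 hf
  have h4 : (N : ℝ) ^ (-((r : ℝ) + 1) / 2) = (√(N : ℝ))⁻¹ ^ (r + 1) := by
    rw [inv_sqrt_pow_eq_rpow hN0]
    push_cast
    rfl
  simp only [one_div_rpow_eq_inv_sqrt_pow hN0, Complex.ofReal_pow]
  refine h3.trans (mul_le_mul_of_nonneg_left ?_ ENNReal.toReal_nonneg)
  rw [h4, mul_comm ε]
  exact mul_le_mul_of_nonneg_left h1.le (by positivity)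

theorem admitsWeakLocalExpansion_of_tendsto
    (hS : ∀ N, AEMeasurable (S N) P)
    (hΦ : ∀ N, 1 ≤ N → ∀ t : ℝ, ∫ ω, Complex.exp (Complex.I * t * S N ω) ∂P = Φ N t) (hV : 0 < V)
    (hlim : Tendsto (fun N : ℕ => ∫ s : ℝ, √(N : ℝ) ^ r *
      ‖rescale A Φ N s - edgeworthFourier V p q r (√(N : ℝ))⁻¹ s‖) atTop (𝓝 0))
    (hint : ∀ᶠ N : ℕ in atTop, Integrable (rescale A Φ N)) :
    AdmitsWeakLocalExpansion P S A r (FSpace 1 (r + 1)) (CNorm 1 (r + 1)) := by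
  obtain ⟨D, hD0, hD⟩ := exists_norm_edgeworth_sub_local_le hV
    (coeff_edgeworthPoly_eq_zero V p q r) r
  set g := edgeworthPoly V p q r with hg
  have hpi : (0 : ℝ) < 2 * Real.pi := by positivity
  have heval : ∀ (k : ℕ) (f : ℝ → ℂ), ((1 / (2 * Real.pi) : ℝ) : ℂ) *
      ∫ z : ℝ, (((C (2 * Real.pi) * localPoly V g r (2 * k)).eval z : ℝ) : ℂ) * f z
      = ∫ z : ℝ, (((localPoly V g r (2 * k)).eval z : ℝ) : ℂ) * f z := by
    intro k f
    rw [← integral_const_mul]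
    congr 1
    ext z
    rw [← mul_assoc, ← Complex.ofReal_mul, eval_mul, eval_C, ← mul_assoc,
      one_div_mul_cancel hpi.ne', one_mul]
  -- The factor 2π compensates the 1/(2π) in the normalization of the local expansion.
  refine ⟨fun k => C (2 * Real.pi) * localPoly V g r (2 * k), fun f hf => ⟨fun N _ =>
    integrable_comp_of_mem hS hf N, fun k hk => ?_⟩, fun ε hε => ?_⟩
  · refine integrable_eval_mul (n := r + 1) ((natDegree_C_mul_le _ _).trans
      ((natDegree_localPoly_le V g r (2 * k)).trans (by omega))) fun j hj =>
        integrable_pow_mul_of_mem hf hj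
  -- After multiplication by √N the Fourier error is o(N^{-r/2}), while the Taylor error is D
  -- N^{-(r+1)/2}, smaller than N^{-r/2} by the factor 1/√N.
  have hlim2 : Tendsto (fun N : ℕ => (∫ s : ℝ, √(N : ℝ) ^ r *
      ‖rescale A Φ N s - edgeworthFourier V p q r (√(N : ℝ))⁻¹ s‖) + (√(N : ℝ))⁻¹ * D)
      atTop (𝓝 0) := by
    simpa using hlim.add (tendsto_inv_sqrt_mul D)
  filter_upwards [hlim2.eventually_lt_const hε, hint, eventually_ge_atTop 1] with N h1 h2 hN f hf
  have hN0 : (0 : ℝ) < N := by exact_mod_cast hN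
  have hs0 : 0 < √(N : ℝ) := Real.sqrt_pos.mpr hN0
  have h3 := norm_integral_comp_sub_edgeworth_le hS hΦ hV p q r hN h2 hf
  have h4 := hD (√(N : ℝ)) hs0 f (CNorm 1 (r + 1) f)
    (fun j hj => integrable_pow_mul_of_mem hf hj) (fun j hj => integral_norm_pow_mul_le hf hj)
  have h5 : ((1 / (2 * Real.pi) : ℝ) : ℂ) *
          ∑ k ∈ Finset.range (r / 2 + 1), ((1 / (N : ℝ) ^ k : ℝ) : ℂ) *
            ∫ z : ℝ, (((C (2 * Real.pi) * localPoly V g r (2 * k)).eval z : ℝ) : ℂ) * f z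
      = ∑ k ∈ Finset.range (r / 2 + 1), (((√(N : ℝ))⁻¹ : ℝ) : ℂ) ^ (2 * k) *
          ∫ x : ℝ, (((localPoly V g r (2 * k)).eval x : ℝ) : ℂ) * f x := by
    rw [Finset.mul_sum]
    refine Finset.sum_congr rfl fun k _ => ?_
    rw [mul_left_comm, heval, one_div_pow_eq_inv_sqrt_pow hN0.le, Complex.ofReal_pow]
  rw [h5, ← inv_sqrt_pow_eq_rpow hN0.le]
  set U := ∑ j ∈ Finset.range (r + 1), (((√(N : ℝ))⁻¹ : ℝ) : ℂ) ^ j *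
    ∫ z : ℝ, (((g j).eval z * gaussianPDFReal 0 V z : ℝ) : ℂ) * f (z * √(N : ℝ)) with hU
  set κ := ∫ s, √(N : ℝ) ^ r * ‖rescale A Φ N s - edgeworthFourier V p q r (√(N : ℝ))⁻¹ s‖ with hκ
  have h6 : ‖((√(N : ℝ) : ℝ) : ℂ) * (∫ ω, f (S N ω - N * A) ∂P) - (√(N : ℝ) : ℂ) * U‖
      ≤ CNorm 1 (r + 1) f * ((√(N : ℝ))⁻¹ ^ r * κ) := by
    rw [← mul_sub, norm_mul, Complex.norm_real, Real.norm_of_nonneg hs0.le]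
    refine (mul_le_mul_of_nonneg_left h3 hs0.le).trans (le_of_eq ?_)
    rw [pow_succ]
    field_simp
  refine (norm_sub_le_norm_sub_add_norm_sub _ ((√(N : ℝ) : ℂ) * U) _).trans
    ((add_le_add h6 h4).trans ?_)
  rw [← mul_add]
  refine mul_le_mul_of_nonneg_left ?_ ENNReal.toReal_nonneg
  have h7 : (√(N : ℝ))⁻¹ ^ r * (κ + (√(N : ℝ))⁻¹ * D) ≤ (√(N : ℝ))⁻¹ ^ r * ε :=
    mul_le_mul_of_nonneg_left h1.le (by positivity)
  rw [pow_succ]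
  linarith

end Conclusion

end WeakEdgeworth

/-! ### The main theorem. -/

theorem mainTheorem6
    {Ω : Type*} [MeasurableSpace Ω] (P : Measure Ω) [IsProbabilityMeasure P]
    (X : ℕ → Ω → ℝ) (hX : ∀ n, AEMeasurable (X n) P)
    {B : Type*} [NormedAddCommGroup B] [NormedSpace ℂ B] [CompleteSpace B]
    (L : ℝ → B →L[ℂ] B) (v : B) (l : B →L[ℂ] ℂ)
    (hL : ∀ (N : ℕ), 1 ≤ N → ∀ t : ℝ,
      ∫ ω, Complex.exp (Complex.I * t * WeakEdgeworth.partialSum X N ω) ∂P = l ((L t ^ N) v))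
    (r : ℕ) (r₁ α : ℝ) (hr₁ : 0 < r₁) (hα : ((r : ℝ) + 1) / (2 * r₁) < α)
    (hA1 : WeakEdgeworth.AssumptionA1 L (r + 2))
    (hA2 : WeakEdgeworth.AssumptionA2 L)
    (hA3 : WeakEdgeworth.AssumptionA3 L)
    (hA4 : WeakEdgeworth.AssumptionA4 L r₁)
    (hA5 : WeakEdgeworth.AssumptionA5 L r₁ α) :
    -- the asymptotic mean `A` and the asymptotic variance `V`
    ∃ (A : ℝ) (V : ℝ≥0),
      TendstoInDistribution
        (fun (N : ℕ) ω => (WeakEdgeworth.partialSum X N ω - N * A) / √(N : ℝ))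
        atTop (id : ℝ → ℝ) (fun _ => P) (gaussianReal 0 V) ∧
      (0 < V →
        WeakEdgeworth.AdmitsWeakLocalExpansion P (WeakEdgeworth.partialSum X) A r
          (WeakEdgeworth.FSpace 1 (r + 1)) (WeakEdgeworth.CNorm 1 (r + 1)) ∧
        WeakEdgeworth.AdmitsWeakGlobalExpansion P (WeakEdgeworth.partialSum X) A V r
          (WeakEdgeworth.FSpace 1 0) (WeakEdgeworth.CNorm 1 0)) := by
  have hα0 : 0 < α := lt_of_le_of_lt (by positivity) hα
  have hS : ∀ N, AEMeasurable (WeakEdgeworth.partialSum X N) P := fun N =>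
    Finset.aemeasurable_fun_sum _ fun n _ => hX n
  set Φ : ℕ → ℝ → ℂ := fun N t => l ((L t ^ N) v) with hΦdef
  have hΦc : ∀ N, 1 ≤ N → Continuous (Φ N) := fun N _ => by
    have := hA1.1
    exact l.continuous.comp ((this.pow N).clm_apply continuous_const)
  have hexp : ∀ N (t : ℝ) ω, ‖Complex.exp (Complex.I * t * WeakEdgeworth.partialSum X N ω)‖ = 1 :=
    fun N t ω => by
      rw [mul_assoc, ← Complex.ofReal_mul, mul_comm, Complex.norm_exp_ofReal_mul_I]
  have hΦ1 : ∀ N, 1 ≤ N → ∀ t, ‖Φ N t‖ ≤ 1 := fun N hN t => by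
    rw [hΦdef]
    simp only
    rw [← hL N hN t]
    refine (norm_integral_le_integral_norm _).trans (le_of_eq ?_)
    simp only [hexp, integral_const, probReal_univ, smul_eq_mul, mul_one]
  have hΦconj : ∀ N, 1 ≤ N → ∀ t, Φ N (-t) = (starRingEnd ℂ) (Φ N t) := fun N hN t => by
    rw [hΦdef]
    simp only
    rw [← hL N hN t, ← hL N hN (-t), ← integral_conj]
    congr 1
    ext ω
    rw [← Complex.exp_conj]
    congr 1
    simp
  have hΦ0 : ∀ N, 1 ≤ N → Φ N 0 = 1 := fun N hN => by
    rw [hΦdef]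
    simp only
    rw [← hL N hN 0]
    simp
  obtain ⟨μ, Z, hμ, hZ, hμ0, C, θ, hC, hθ0, hθ1, happ⟩ :=
    WeakEdgeworth.exists_leading_eigenvalue (by omega) hA1 hA2 v l
  obtain ⟨hZ0, hμs, hZs, hμle⟩ := WeakEdgeworth.symm_of_norm_sub_le hΦ1 hΦconj hΦ0
    hμ.continuousAt hZ.continuousAt hμ0 hθ0 hθ1 happ
  obtain ⟨A, V, p, χ, hV0, hp0, hχ, hμχ⟩ := WeakEdgeworth.exists_exponent hμ hμ0 hμs hμle
  -- Order r is enough for Z; μ needs two more derivatives because u² is divided out of its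
  -- logarithm.
  obtain ⟨q, hq⟩ := WeakEdgeworth.exists_real_taylor (n := r)
    (hZ.of_le (by exact_mod_cast (by omega : r ≤ r + 2))) hZs
  lift V to ℝ≥0 using hV0
  have hχ0 : Tendsto χ (𝓝 0) (𝓝 0) := by
    have h1 : Tendsto (fun u : ℝ => χ u - Polynomial.aeval (Complex.I * u) p) (𝓝 0) (𝓝 0) :=
      (Asymptotics.isLittleO_one_iff ℝ).mp (hχ.trans_isBigO
        (Filter.Tendsto.isBigO_one (F := ℝ) ((continuous_pow r).tendsto (0 : ℝ))))
    have h2 : Tendsto (fun u : ℝ => Polynomial.aeval (Complex.I * u) p) (𝓝 0) (𝓝 0) := by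
      have := (WeakEdgeworth.continuous_aeval_I_mul p).tendsto 0
      simpa [Polynomial.aeval_def, Polynomial.eval₂_at_zero, hp0] using this
    simpa using h1.add h2
  refine ⟨A, V, WeakEdgeworth.tendstoInDistribution_of_rescale hS hL
    (WeakEdgeworth.tendsto_rescale hθ0 hθ1 happ hμχ hχ0 (hZ0 ▸ hZ.continuousAt)), fun hV => ?_⟩
  have hdecay : ∀ δ : ℝ, 0 < δ → ∃ D : ℝ, 0 < D ∧ ∀ᶠ N : ℕ in atTop, ∀ t : ℝ, δ ≤ |t| →
      ‖Φ N t‖ ≤ D / ((N : ℝ) ^ (r + 1) * (1 + t ^ 2)) := fun δ hδ => by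
    obtain ⟨D, hD, h⟩ := WeakEdgeworth.exists_pow_norm_le_inv hA1.1 hr₁ hα0 hA3 hA4 hA5 hδ (r + 1)
    refine ⟨(‖l‖ * ‖v‖ + 1) * D, by positivity, h.mono fun N hN t ht => ?_⟩
    calc ‖Φ N t‖ ≤ ‖l‖ * (‖L t ^ N‖ * ‖v‖) :=
          (l.le_opNorm _).trans (by gcongr; exact ContinuousLinearMap.le_opNorm _ _)
      _ = (‖l‖ * ‖v‖) * ‖L t ^ N‖ := by ring
      _ ≤ (‖l‖ * ‖v‖ + 1) * (D / ((N : ℝ) ^ (r + 1) * (1 + t ^ 2))) :=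
          mul_le_mul (by linarith) (hN t ht) (norm_nonneg _) (by positivity)
      _ = _ := by ring
  obtain ⟨hlim, hint⟩ := WeakEdgeworth.tendsto_integral_rescale_sub hΦc
    (show (0 : ℝ) < V from hV) hC hθ0 hθ1 happ hμχ hp0 hχ hq hdecay
  exact ⟨WeakEdgeworth.admitsWeakLocalExpansion_of_tendsto hS hL hV hlim hint,
    WeakEdgeworth.admitsWeakGlobalExpansion_of_tendsto hS hL hV hlim hint⟩
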